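/- For finite point sets $P,W$ in the Euclidean plane (which may share points), the \emph{witness Gabriel graph} $GG^-(P,W)$ has vertex set $P$, and distinct $a,b\in P$ are adjacent if and only if the closed disk $D_{ab}$ with diameter $ab$ contains no point of $W$ other than possibly $a$ and $b$, i.e. $W\cap (D_{ab}\setminus\{a,b\})=\varnothing$. An input consists of two such sets $P,W$, each given as an array of point coordinates without repetition, such that $P\cup W$ is in general position (no three points on a line, no four on a circle). Its size is $n=|P|+|W|$. The model of computation is the real RAM: a fixed finite program works on arrays of natural numbers and arrays of exact real numbers with computed natural-number indices; constants, memory accesses, addition and truncated subtraction of natural numbers, the operations $+,-,\times,/$ on reals, comparisons, assignments and the output of a pair of indices each cost one unit (there is no floor function). A program \emph{computes the witness Gabriel graph} if on every input it halts, having output each edge of $GG^-(P,W)$ exactly once, as a pair of indices of points of $P$. \textbf{Theorem.} Given two point sets $P,W$ with $|P|+|W|=n$, the graph $GG^-(P,W)$ can be computed in $\Theta(n^2)$ worst-case time. That is: (i) there are a program that computes the witness Gabriel graph and a constant $C$ such that, for every $n\ge 1$, the program makes at most $Cn^2$ steps on every input of size $n$; (ii) there is a constant $\kappa>0$ such that,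 for every program that computes the witness Gabriel graph and every $n\ge 2$, there is an input of size $n$ on which the program makes at least $\kappa n^2$ steps. -/

import Mathlib

/-- The Euclidean plane. -/
abbrev Plane : Type := EuclideanSpace ℝ (Fin 2)

/-- The closed disk having the segment `ab` as a diameter. -/
noncomputable def diametralDisk (a b : Plane) : Set Plane :=
  Metric.closedBall (midpoint ℝ a b) (dist a b / 2)

/-- The witness Gabriel graph of the vertex set `P` and the witness set `W`: distinct vertices
`a`, `b` are adjacent iff the closed disk with diameter `ab` contains no point of `W`
other than, possibly, `a` and `b`. -/
def witnessGabrielGraph (P W : Set Plane) : SimpleGraph P where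
  Adj a b := a ≠ b ∧ ∀ q ∈ W, q ∉ diametralDisk (a : Plane) (b : Plane) \ {(a : Plane), (b : Plane)}
  symm := ⟨by
    rintro a b ⟨hab, h⟩
    refine ⟨hab.symm, ?_⟩
    intro q hq
    have := h q hq
    rwa [diametralDisk, midpoint_comm, dist_comm, Set.pair_comm]⟩
  loopless := ⟨fun _ h => h.1 rfl⟩

/-- General position: no three points on a line and no four points on a circle. -/
def InGeneralPosition (S : Set Plane) : Prop :=
  (∀ T ⊆ S, T.ncard = 3 → ¬ Collinear ℝ T) ∧
  (∀ T ⊆ S, T.ncard = 4 → ¬ EuclideanGeometry.Cospherical T)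

namespace RealRAM

/-- The state of a real RAM. Its memory consists of arrays of natural numbers (used for counters,
addresses and pointers) and arrays of exact real numbers; `nat a i` and `real a i` are the
contents of cell `i` of the array number `a`. `out` is the sequence of pairs output so far. -/
structure State where
  nat : ℕ → ℕ → ℕ
  real : ℕ → ℕ → ℝ
  out : List (ℕ × ℕ)

/-- Integer expressions: constants, memory access with a computed index, sum, and truncated
difference. -/
inductive NExpr where
  | const (k : ℕ)
  | get (a : ℕ) (i : NExpr)
  | add (e f : NExpr)
  | sub (e f : NExpr)

/-- Real expressions: integer constants, memory access with a computed index, and the four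
arithmetic operations. There is no floor function and no conversion from reals to integers. -/
inductive RExpr where
  | const (k : ℕ)
  | get (a : ℕ) (i : NExpr)
  | add (e f : RExpr)
  | sub (e f : RExpr)
  | mul (e f : RExpr)
  | div (e f : RExpr)

/-- Tests: comparisons of integers and of reals, and their Boolean combinations. -/
inductive BExpr where
  | nlt (e f : NExpr)
  | rlt (e f : RExpr)
  | not (b : BExpr)
  | and (b c : BExpr)

/-- Programs. An array number is part of the program text, so that a program uses only finitely
many arrays; the index of a cell is computed at run time. -/
inductive Prog where
  | skip
  | nset (a : ℕ) (i : NExpr) (e : NExpr)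
  | rset (a : ℕ) (i : NExpr) (e : RExpr)
  | emit (i j : NExpr)
  | seq (c d : Prog)
  | ite (b : BExpr) (c d : Prog)
  | while (b : BExpr) (c : Prog)

namespace NExpr

def eval (s : State) : NExpr → ℕ
  | const k => k
  | get a i => s.nat a (i.eval s)
  | add e f => e.eval s + f.eval s
  | sub e f => e.eval s - f.eval s

/-- The number of unit-cost operations made by the evaluation. -/
def cost : NExpr → ℕ
  | const _ => 1
  | get _ i => i.cost + 1
  | add e f => e.cost + f.cost + 1
  | sub e f => e.cost + f.cost + 1

end NExpr

namespace RExpr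

noncomputable def eval (s : State) : RExpr → ℝ
  | const k => (k : ℝ)
  | get a i => s.real a (i.eval s)
  | add e f => e.eval s + f.eval s
  | sub e f => e.eval s - f.eval s
  | mul e f => e.eval s * f.eval s
  | div e f => e.eval s / f.eval s

/-- The number of unit-cost operations made by the evaluation. -/
def cost : RExpr → ℕ
  | const _ => 1
  | get _ i => i.cost + 1
  | add e f => e.cost + f.cost + 1
  | sub e f => e.cost + f.cost + 1
  | mul e f => e.cost + f.cost + 1
  | div e f => e.cost + f.cost + 1

end RExpr

namespace BExpr

def eval (s : State) : BExpr → Prop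
  | nlt e f => e.eval s < f.eval s
  | rlt e f => e.eval s < f.eval s
  | not b => ¬ b.eval s
  | and b c => b.eval s ∧ c.eval s

/-- The number of unit-cost operations made by the evaluation. -/
def cost : BExpr → ℕ
  | nlt e f => e.cost + f.cost + 1
  | rlt e f => e.cost + f.cost + 1
  | not b => b.cost + 1
  | and b c => b.cost + c.cost + 1

end BExpr

namespace State

def setNat (s : State) (a i v : ℕ) : State :=
  { s with nat := Function.update s.nat a (Function.update (s.nat a) i v) }

noncomputable def setReal (s : State) (a i : ℕ) (v : ℝ) : State :=
  { s with real := Function.update s.real a (Function.update (s.real a) i v) }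

def output (s : State) (i j : ℕ) : State :=
  { s with out := s.out ++ [(i, j)] }

end State

/-- `Exec c s t s'`: the program `c`, started in the state `s`, halts after exactly `t` steps in
the state `s'`. -/
inductive Exec : Prog → State → ℕ → State → Prop where
  | skip (s : State) : Exec .skip s 1 s
  | nset (s : State) (a : ℕ) (i e : NExpr) :
      Exec (.nset a i e) s (i.cost + e.cost + 1) (s.setNat a (i.eval s) (e.eval s))
  | rset (s : State) (a : ℕ) (i : NExpr) (e : RExpr) :
      Exec (.rset a i e) s (i.cost + e.cost + 1) (s.setReal a (i.eval s) (e.eval s))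
  | emit (s : State) (i j : NExpr) :
      Exec (.emit i j) s (i.cost + j.cost + 1) (s.output (i.eval s) (j.eval s))
  | seq {c d : Prog} {s s' s'' : State} {t t' : ℕ} :
      Exec c s t s' → Exec d s' t' s'' → Exec (.seq c d) s (t + t') s''
  | ite_true {b : BExpr} {c d : Prog} {s s' : State} {t : ℕ} :
      b.eval s → Exec c s t s' → Exec (.ite b c d) s (b.cost + 1 + t) s'
  | ite_false {b : BExpr} {c d : Prog} {s s' : State} {t : ℕ} :
      ¬ b.eval s → Exec d s t s' → Exec (.ite b c d) s (b.cost + 1 + t) s'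
  | while_false {b : BExpr} {c : Prog} {s : State} :
      ¬ b.eval s → Exec (.while b c) s (b.cost + 1) s
  | while_true {b : BExpr} {c : Prog} {s s' s'' : State} {t t' : ℕ} :
      b.eval s → Exec c s t s' → Exec (.while b c) s' t' s'' →
      Exec (.while b c) s (b.cost + 1 + t + t') s''

/-- Execution is deterministic: the running time and the final state are unique. -/
theorem Exec.deterministic {c : Prog} {s s₁ s₂ : State} {t₁ t₂ : ℕ}
    (h₁ : Exec c s t₁ s₁) (h₂ : Exec c s t₂ s₂) : t₁ = t₂ ∧ s₁ = s₂ := by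
  induction h₁ generalizing t₂ s₂ with
  | skip => cases h₂; exact ⟨rfl, rfl⟩
  | nset => cases h₂; exact ⟨rfl, rfl⟩
  | rset => cases h₂; exact ⟨rfl, rfl⟩
  | emit => cases h₂; exact ⟨rfl, rfl⟩
  | seq _ _ ih ih' =>
    cases h₂ with
    | seq k k' =>
      obtain ⟨rfl, rfl⟩ := ih k
      obtain ⟨rfl, rfl⟩ := ih' k'
      exact ⟨rfl, rfl⟩
  | ite_true hb _ ih =>
    cases h₂ with
    | ite_true _ k => obtain ⟨rfl, rfl⟩ := ih k; exact ⟨rfl, rfl⟩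
    | ite_false hb' _ => exact absurd hb hb'
  | ite_false hb _ ih =>
    cases h₂ with
    | ite_true hb' _ => exact absurd hb' hb
    | ite_false _ k => obtain ⟨rfl, rfl⟩ := ih k; exact ⟨rfl, rfl⟩
  | while_false hb =>
    cases h₂ with
    | while_false _ => exact ⟨rfl, rfl⟩
    | while_true hb' _ _ => exact absurd hb' hb
  | while_true hb _ _ ih ih' =>
    cases h₂ with
    | while_false hb' => exact absurd hb hb'
    | while_true _ k k' =>
      obtain ⟨rfl, rfl⟩ := ih k
      obtain ⟨rfl, rfl⟩ := ih' k'
      exact ⟨rfl, rfl⟩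

end RealRAM

/-- An input: the points of two finite sets `P = {p 0, …, p (m-1)}` and `W = {w 0, …, w (k-1)}`,
each listed without repetition in an arbitrary order, with `P ∪ W` in general position.
The two sets may have points in common. -/
structure PointInput where
  m : ℕ
  k : ℕ
  p : Fin m → Plane
  w : Fin k → Plane
  p_injective : Function.Injective p
  w_injective : Function.Injective w
  generalPosition : InGeneralPosition (Set.range p ∪ Set.range w)

namespace PointInput

/-- The input size `|P| + |W|`. -/
def size (I : PointInput) : ℕ := I.m + I.k

/-- The witness Gabriel graph of the input. -/
def graph (I : PointInput) : SimpleGraph (Set.range I.p) :=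
  witnessGabrielGraph (Set.range I.p) (Set.range I.w)

/-- The initial state: cells `0` and `1` of the integer array `0` hold `|P|` and `|W|`; the real
arrays `0` and `1` hold the coordinates of the points of `P`, and the real arrays `2` and `3`
those of the points of `W`; all other cells hold zero, and nothing has been output. -/
noncomputable def init (I : PointInput) : RealRAM.State where
  nat a i := if a = 0 ∧ i = 0 then I.m else if a = 0 ∧ i = 1 then I.k else 0
  real a i :=
    match a with
    | 0 => if h : i < I.m then I.p ⟨i, h⟩ 0 else 0
    | 1 => if h : i < I.m then I.p ⟨i, h⟩ 1 else 0
    | 2 => if h : i < I.k then I.w ⟨i, h⟩ 0 else 0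
    | 3 => if h : i < I.k then I.w ⟨i, h⟩ 1 else 0
    | _ => 0
  out := []

/-- The list `L` of pairs of indices lists every edge of the witness Gabriel graph exactly once
(as an unordered pair), and nothing else. -/
def IsEdgeList (I : PointInput) (L : List (ℕ × ℕ)) : Prop :=
  (L.map fun e => s(e.1, e.2)).Nodup ∧
  ∀ i j : ℕ, s(i, j) ∈ (L.map fun e => s(e.1, e.2)) ↔
    ∃ (hi : i < I.m) (hj : j < I.m),
      I.graph.Adj ⟨I.p ⟨i, hi⟩, Set.mem_range_self _⟩ ⟨I.p ⟨j, hj⟩, Set.mem_range_self _⟩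

end PointInput

/-- The program halts on every input and outputs the edges of the witness Gabriel graph. -/
def ComputesWitnessGabriel (c : RealRAM.Prog) : Prop :=
  ∀ I : PointInput, ∃ (t : ℕ) (s : RealRAM.State),
    RealRAM.Exec c I.init t s ∧ I.IsEdgeList s.out

/-!
The witness Gabriel graph is computed in quadratic time as follows. The points are sorted
lexicographically by counting, and the arrangement of their dual lines is built incrementally. The
rows of the arrangement list the other points by slope around each point `a`. Two rotational sweeps
around `a`, one in each direction, mark the points `b` for which some witness lies in the disk with
diameter `ab`: the witnesses that may still matter are kept in a queue. The lower bound comes from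
inputs without witnesses, whose graph is complete.
-/

namespace RealRAM

namespace State

@[simp] theorem setNat_nat (s : State) (a i v b : ℕ) :
    (s.setNat a i v).nat b = if b = a then Function.update (s.nat a) i v else s.nat b := by
  simp [setNat, Function.update_apply]

@[simp] theorem setNat_real (s : State) (a i v : ℕ) : (s.setNat a i v).real = s.real := rfl

@[simp] theorem setNat_out (s : State) (a i v : ℕ) : (s.setNat a i v).out = s.out := rfl

@[simp] theorem setReal_real (s : State) (a i : ℕ) (v : ℝ) (b : ℕ) :
    (s.setReal a i v).real b = if b = a then Function.update (s.real a) i v else s.real b := by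
  simp [setReal, Function.update_apply]

@[simp] theorem setReal_nat (s : State) (a i : ℕ) (v : ℝ) : (s.setReal a i v).nat = s.nat := rfl

@[simp] theorem setReal_out (s : State) (a i : ℕ) (v : ℝ) : (s.setReal a i v).out = s.out := rfl

@[simp] theorem output_nat (s : State) (i j : ℕ) : (s.output i j).nat = s.nat := rfl

@[simp] theorem output_real (s : State) (i j : ℕ) : (s.output i j).real = s.real := rfl

@[simp] theorem output_out (s : State) (i j : ℕ) : (s.output i j).out = s.out ++ [(i, j)] := rfl

end State

/-- The scalar variable stored in cell `0` of array `a`. -/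
abbrev NExpr.var (a : ℕ) : NExpr := .get a (.const 0)

/-- Assignment to the scalar variable stored in cell `0` of array `a`. -/
abbrev Prog.assign (a : ℕ) (e : NExpr) : Prog := .nset a (.const 0) e

namespace Prog

/-- Programs without loops. -/
def Straight : Prog → Prop
  | seq c d => c.Straight ∧ d.Straight
  | ite _ c d => c.Straight ∧ d.Straight
  | .while _ _ => False
  | _ => True

open Classical in
/-- The effect of a program without loops. -/
noncomputable def denote : Prog → State → State
  | skip, s => s
  | nset a i e, s => s.setNat a (i.eval s) (e.eval s)
  | rset a i e, s => s.setReal a (i.eval s) (e.eval s)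
  | emit i j, s => s.output (i.eval s) (j.eval s)
  | seq c d, s => d.denote (c.denote s)
  | ite b c d, s => if b.eval s then c.denote s else d.denote s
  | .while _ _, s => s

/-- An upper bound for the cost of a program without loops. -/
def maxCost : Prog → ℕ
  | skip => 1
  | nset _ i e => i.cost + e.cost + 1
  | rset _ i e => i.cost + e.cost + 1
  | emit i j => i.cost + j.cost + 1
  | seq c d => c.maxCost + d.maxCost
  | ite b c d => b.cost + 1 + (c.maxCost + d.maxCost)
  | .while _ _ => 0

theorem Straight.exec {c : Prog} (hc : c.Straight) (s : State) :
    ∃ t ≤ c.maxCost, Exec c s t (c.denote s) := by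
  induction c generalizing s with
  | skip => exact ⟨_, le_rfl, .skip s⟩
  | nset a i e => exact ⟨_, le_rfl, .nset s a i e⟩
  | rset a i e => exact ⟨_, le_rfl, .rset s a i e⟩
  | emit i j => exact ⟨_, le_rfl, .emit s i j⟩
  | seq c d ihc ihd =>
    obtain ⟨t, ht, h⟩ := ihc hc.1 s
    obtain ⟨t', ht', h'⟩ := ihd hc.2 (c.denote s)
    exact ⟨_, Nat.add_le_add ht ht', .seq h h'⟩
  | ite b c d ihc ihd =>
    by_cases hb : b.eval s
    · obtain ⟨t, ht, h⟩ := ihc hc.1 s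
      refine ⟨b.cost + 1 + t, by simp only [maxCost]; omega, ?_⟩
      rw [denote, if_pos hb]
      exact .ite_true hb h
    · obtain ⟨t, ht, h⟩ := ihd hc.2 s
      refine ⟨b.cost + 1 + t, by simp only [maxCost]; omega, ?_⟩
      rw [denote, if_neg hb]
      exact .ite_false hb h
  | _ b c => exact hc.elim

/-- The arrays of natural numbers that the program may write to. -/
def natWrites : Prog → List ℕ
  | nset a _ _ => [a]
  | seq c d => c.natWrites ++ d.natWrites
  | ite _ c d => c.natWrites ++ d.natWrites
  | .while _ c => c.natWrites
  | _ => []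

/-- The arrays of real numbers that the program may write to. -/
def realWrites : Prog → List ℕ
  | rset a _ _ => [a]
  | seq c d => c.realWrites ++ d.realWrites
  | ite _ c d => c.realWrites ++ d.realWrites
  | .while _ c => c.realWrites
  | _ => []

/-- The program contains no output instruction. -/
def Silent : Prog → Prop
  | emit _ _ => False
  | seq c d => c.Silent ∧ d.Silent
  | ite _ c d => c.Silent ∧ d.Silent
  | .while _ c => c.Silent
  | _ => True

end Prog

/-- The states `s` and `s'` agree on everything that `c` cannot modify. -/
def Frame (c : Prog) (s s' : State) : Prop :=
  (∀ a, a ∉ c.natWrites → s'.nat a = s.nat a) ∧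
  (∀ a, a ∉ c.realWrites → s'.real a = s.real a) ∧ (c.Silent → s'.out = s.out)

theorem Frame.refl (c : Prog) (s : State) : Frame c s s :=
  ⟨fun _ _ => rfl, fun _ _ => rfl, fun _ => rfl⟩

theorem Frame.trans {c : Prog} {s s' s'' : State} (h : Frame c s s') (h' : Frame c s' s'') :
    Frame c s s'' :=
  ⟨fun a ha => (h'.1 a ha).trans (h.1 a ha), fun a ha => (h'.2.1 a ha).trans (h.2.1 a ha),
    fun hc => (h'.2.2 hc).trans (h.2.2 hc)⟩

theorem Exec.frame {c : Prog} {s s' : State} {t : ℕ} (h : Exec c s t s') : Frame c s s' := by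
  induction h with
  | skip s => exact Frame.refl _ _
  | nset s a i e =>
    refine ⟨fun b hb => ?_, fun _ _ => rfl, fun _ => rfl⟩
    simp only [Prog.natWrites, List.mem_singleton] at hb
    simp [hb]
  | rset s a i e =>
    refine ⟨fun _ _ => rfl, fun b hb => ?_, fun _ => rfl⟩
    simp only [Prog.realWrites, List.mem_singleton] at hb
    simp [hb]
  | emit s i j => exact ⟨fun _ _ => rfl, fun _ _ => rfl, fun hc => hc.elim⟩
  | seq _ _ ih ih' =>
    simp only [Frame, Prog.natWrites, Prog.realWrites, Prog.Silent, List.mem_append, not_or]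
      at ih ih' ⊢
    exact ⟨fun a ha => (ih'.1 a ha.2).trans (ih.1 a ha.1),
      fun a ha => (ih'.2.1 a ha.2).trans (ih.2.1 a ha.1),
      fun hc => (ih'.2.2 hc.2).trans (ih.2.2 hc.1)⟩
  | ite_true _ _ ih =>
    simp only [Frame, Prog.natWrites, Prog.realWrites, Prog.Silent, List.mem_append, not_or]
      at ih ⊢
    exact ⟨fun a ha => ih.1 a ha.1, fun a ha => ih.2.1 a ha.1, fun hc => ih.2.2 hc.1⟩
  | ite_false _ _ ih =>
    simp only [Frame, Prog.natWrites, Prog.realWrites, Prog.Silent, List.mem_append, not_or]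
      at ih ⊢
    exact ⟨fun a ha => ih.1 a ha.2, fun a ha => ih.2.1 a ha.2, fun hc => ih.2.2 hc.2⟩
  | while_false _ => exact Frame.refl _ _
  | while_true _ _ _ ih ih' => exact Frame.trans ih ih'

/-- A program outputs at most one pair per step. -/
theorem Exec.length_out_le {c : Prog} {s s' : State} {t : ℕ} (h : Exec c s t s') :
    s'.out.length ≤ s.out.length + t := by
  induction h with
  | emit s i j => simp
  | skip | nset | rset | while_false => simp
  | seq | ite_true | ite_false | while_true => omega

/-- Started in `s`, the program `c` halts within `T` steps in a state satisfying `Q`. -/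
def Runs (c : Prog) (s : State) (T : ℕ) (Q : State → Prop) : Prop :=
  ∃ t s', Exec c s t s' ∧ t ≤ T ∧ Q s'

namespace Runs

variable {b : BExpr} {c d : Prog} {s : State} {T T' : ℕ} {Q Q' : State → Prop}

theorem mono (h : Runs c s T Q) (hT : T ≤ T') (hQ : ∀ s', Q s' → Q' s') : Runs c s T' Q' := by
  obtain ⟨t, s', he, ht, hq⟩ := h
  exact ⟨t, s', he, ht.trans hT, hQ s' hq⟩

theorem frame (h : Runs c s T Q) : Runs c s T (fun s' => Q s' ∧ Frame c s s') := by
  obtain ⟨t, s', he, ht, hq⟩ := h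
  exact ⟨t, s', he, ht, hq, he.frame⟩

theorem straight (hc : c.Straight) (h : Q (c.denote s)) : Runs c s c.maxCost Q := by
  obtain ⟨t, ht, he⟩ := hc.exec s
  exact ⟨t, _, he, ht, h⟩

theorem seq (h : Runs c s T (fun s' => Runs d s' T' Q)) : Runs (.seq c d) s (T + T') Q := by
  obtain ⟨t, s', he, ht, t', s'', he', ht', hq⟩ := h
  exact ⟨t + t', s'', .seq he he', Nat.add_le_add ht ht', hq⟩

/-- Loops are bounded by a measure on auxiliary data `γ` related to the state by `R`. -/
theorem while_rule {γ : Type*} (R : γ → State → Prop) (μ : γ → ℕ) (K : ℕ) (s₀ : State)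
    (hbody : ∀ g s, Frame c s₀ s → R g s → b.eval s →
      Runs c s K (fun s' => ∃ g', R g' s' ∧ μ g' < μ g))
    (g : γ) (hs : Frame c s₀ s) (hg : R g s) :
    Runs (.while b c) s ((μ g + 1) * (b.cost + 1 + K))
      (fun s' => ∃ g', R g' s' ∧ ¬ b.eval s' ∧ Frame c s₀ s') := by
  induction hn : μ g using Nat.strong_induction_on generalizing g s with
  | _ n ih =>
    subst hn
    by_cases hb : b.eval s
    · obtain ⟨t, s', he, ht, g', hg', hμ⟩ := hbody g s hs hg hb
      obtain ⟨t', s'', he', ht', hq⟩ := ih (μ g') hμ g' (hs.trans he.frame) hg' rfl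
      refine ⟨_, s'', .while_true hb he he', ?_, hq⟩
      have : (μ g' + 1) * (b.cost + 1 + K) ≤ μ g * (b.cost + 1 + K) :=
        Nat.mul_le_mul_right _ hμ
      have h2 : (μ g + 1) * (b.cost + 1 + K) = μ g * (b.cost + 1 + K) + (b.cost + 1 + K) := by
        ring
      omega
    · refine ⟨_, s, .while_false hb, ?_, g, hg, hb, hs⟩
      have : 1 * (b.cost + 1 + K) ≤ (μ g + 1) * (b.cost + 1 + K) :=
        Nat.mul_le_mul_right _ (by omega)
      omega

end Runs

/-- `for v in [e, f) do c`, where `v` is a scalar variable. -/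
abbrev Prog.forLoop (v : ℕ) (e f : NExpr) (c : Prog) : Prog :=
  .seq (.assign v e) (.while (.nlt (.var v) f) (.seq c (.assign v (.add (.var v) (.const 1)))))

/-- The rule for counting loops. -/
theorem Runs.for_rule {v : ℕ} {e f : NExpr} {c : Prog} {s : State} (Inv : ℕ → State → Prop)
    (K lo hi : ℕ) (he : e.eval s = lo) (hlo : lo ≤ hi) (hv : v ∉ c.natWrites)
    (hf : ∀ i s', Inv i s' → s'.nat v 0 = i → f.eval s' = hi)
    (h0 : Inv lo (s.setNat v 0 lo))
    (hbody : ∀ i s', lo ≤ i → i < hi → Inv i s' → s'.nat v 0 = i →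
      Runs c s' K (fun s'' => Inv (i + 1) (s''.setNat v 0 (i + 1)))) :
    Runs (.forLoop v e f c) s
      (e.cost + 2 + ((hi - lo) + 1) * (f.cost + 4 + (K + 6)))
      (fun s' => Inv hi s' ∧ s'.nat v 0 = hi) := by
  refine Runs.seq (T := e.cost + 2) (T' := ((hi - lo) + 1) * (f.cost + 4 + (K + 6))) ?_
  refine (Runs.straight (c := .assign v e) trivial ?_).mono
    (by simp [Prog.maxCost, NExpr.cost]; omega) (fun _ h => h)
  simp only [Prog.denote, NExpr.eval, he]
  have key := Runs.while_rule (b := .nlt (.var v) f)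
    (c := .seq c (.assign v (.add (.var v) (.const 1))))
    (fun (i : ℕ) (s' : State) => Inv i s' ∧ s'.nat v 0 = i ∧ lo ≤ i ∧ i ≤ hi)
    (fun i => hi - i) (K + 6) (s.setNat v 0 lo) (s := s.setNat v 0 lo) ?_ lo (Frame.refl _ _)
    ⟨h0, by simp, le_rfl, hlo⟩
  · refine key.mono (Nat.mul_le_mul_left _ (by simp [BExpr.cost, NExpr.cost]; omega)) ?_
    rintro s' ⟨i, ⟨hi1, hi2, hi3, hi4⟩, hb, -⟩
    simp only [BExpr.eval, NExpr.eval, hi2, hf i s' hi1 hi2] at hb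
    obtain rfl : i = hi := by omega
    exact ⟨hi1, hi2⟩
  · rintro i s' - ⟨h1, h2, h3, h4⟩ hb
    simp only [BExpr.eval, NExpr.eval, h2, hf i s' h1 h2] at hb
    refine Runs.seq (T := K) (T' := 6) ?_
    refine (hbody i s' h3 hb h1 h2).frame.mono le_rfl ?_
    rintro s'' ⟨hq, hfr⟩
    have hv' : s''.nat v 0 = i := by rw [hfr.1 v hv, h2]
    refine (Runs.straight (c := .assign v (.add (.var v) (.const 1))) trivial ?_).mono
      (by simp [Prog.maxCost, NExpr.cost]) (fun _ h => h)
    simp only [Prog.denote, NExpr.eval, hv']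
    exact ⟨i + 1, ⟨hq, by simp, by omega, by omega⟩, by omega⟩

end RealRAM

theorem Plane.ext_iff' {a b : Plane} : a = b ↔ a 0 = b 0 ∧ a 1 = b 1 := by
  constructor
  · rintro rfl; exact ⟨rfl, rfl⟩
  · rintro ⟨h0, h1⟩
    ext i
    fin_cases i
    · exact h0
    · exact h1

theorem Plane.dist_sq (a b : Plane) : dist a b ^ 2 = (a 0 - b 0) ^ 2 + (a 1 - b 1) ^ 2 := by
  rw [EuclideanSpace.dist_eq, Real.sq_sqrt (by positivity), Fin.sum_univ_two,
    Real.dist_eq, Real.dist_eq, sq_abs, sq_abs]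

/-- Three distinct collinear points have vanishing orientation determinant. -/
theorem Plane.collinear_iff {a b c : Plane} (hab : a ≠ b) :
    Collinear ℝ {a, b, c} ↔
      (b 0 - a 0) * (c 1 - a 1) - (b 1 - a 1) * (c 0 - a 0) = 0 := by
  rw [collinear_iff_of_mem (p₀ := a) (by simp)]
  constructor
  · rintro ⟨v, hv⟩
    obtain ⟨r, hr⟩ := hv b (by simp)
    obtain ⟨t, ht⟩ := hv c (by simp)
    have h1 : ∀ i, b i = r * v i + a i := fun i => by simp [hr]
    have h2 : ∀ i, c i = t * v i + a i := fun i => by simp [ht]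
    rw [h1, h1, h2, h2]; ring
  · intro h
    have hne : (b 0 - a 0) ^ 2 + (b 1 - a 1) ^ 2 ≠ 0 := by
      intro h0
      apply hab
      rw [Plane.ext_iff']
      constructor <;> nlinarith [sq_nonneg (b 0 - a 0), sq_nonneg (b 1 - a 1)]
    refine ⟨b - a, ?_⟩
    simp only [Set.mem_insert_iff, Set.mem_singleton_iff, forall_eq_or_imp, forall_eq]
    refine ⟨⟨0, by simp⟩, ⟨1, by simp⟩,
      ⟨((c 0 - a 0) * (b 0 - a 0) + (c 1 - a 1) * (b 1 - a 1)) /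
        ((b 0 - a 0) ^ 2 + (b 1 - a 1) ^ 2), ?_⟩⟩
    rw [Plane.ext_iff']
    simp only [vadd_eq_add, PiLp.add_apply, PiLp.smul_apply, PiLp.sub_apply, smul_eq_mul]
    constructor
    · field_simp
      linear_combination (-(b 1 - a 1)) * h
    · field_simp
      linear_combination (b 0 - a 0) * h

namespace LowerBound

/-- Points on the right half of a parabola. -/
noncomputable def parabola (i : ℕ) : Plane := !₂[(i : ℝ) + 1, ((i : ℝ) + 1) ^ 2]

theorem parabola_injective : Function.Injective parabola := by
  intro i j h
  have := (Plane.ext_iff'.1 h).1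
  simpa [parabola] using this

theorem not_collinear_parabola {i j k : ℕ} (hij : i ≠ j) (hik : i ≠ k) (hjk : j ≠ k) :
    ¬ Collinear ℝ {parabola i, parabola j, parabola k} := by
  rw [Plane.collinear_iff (parabola_injective.ne hij)]
  simp only [parabola, PiLp.toLp_apply, Matrix.cons_val_zero, Matrix.cons_val_one]
  intro h
  have h' : ((j : ℝ) - i) * ((k : ℝ) - i) * ((k : ℝ) - j) = 0 := by
    simp at h
    linear_combination h
  have h1 : (j : ℝ) - i ≠ 0 := sub_ne_zero.2 (by exact_mod_cast hij.symm)
  have h2 : (k : ℝ) - i ≠ 0 := sub_ne_zero.2 (by exact_mod_cast hik.symm)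
  have h3 : (k : ℝ) - j ≠ 0 := sub_ne_zero.2 (by exact_mod_cast hjk.symm)
  exact mul_ne_zero (mul_ne_zero h1 h2) h3 h'

theorem not_cospherical_parabola {i j k l : ℕ} (hij : i ≠ j) (hik : i ≠ k) (hil : i ≠ l)
    (hjk : j ≠ k) (hjl : j ≠ l) (hkl : k ≠ l) :
    ¬ EuclideanGeometry.Cospherical {parabola i, parabola j, parabola k, parabola l} := by
  rintro ⟨c, r, h⟩
  have key : ∀ a : ℕ, dist (parabola a) c = r →
      ((a : ℝ) + 1 - c 0) ^ 2 + (((a : ℝ) + 1) ^ 2 - c 1) ^ 2 = r ^ 2 := by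
    intro a ha
    rw [← ha, Plane.dist_sq]
    simp [parabola]
  have hi := key i (h _ (by simp))
  have hj := key j (h _ (by simp))
  have hk := key k (h _ (by simp))
  have hl := key l (h _ (by simp))
  generalize c 0 = u at *
  generalize c 1 = v at *
  have nij : (j : ℝ) - i ≠ 0 := sub_ne_zero.2 (by exact_mod_cast hij.symm)
  have nik : (k : ℝ) - i ≠ 0 := sub_ne_zero.2 (by exact_mod_cast hik.symm)
  have nil : (l : ℝ) - i ≠ 0 := sub_ne_zero.2 (by exact_mod_cast hil.symm)
  have njk : (k : ℝ) - j ≠ 0 := sub_ne_zero.2 (by exact_mod_cast hjk.symm)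
  have njl : (l : ℝ) - j ≠ 0 := sub_ne_zero.2 (by exact_mod_cast hjl.symm)
  have nkl : (l : ℝ) - k ≠ 0 := sub_ne_zero.2 (by exact_mod_cast hkl.symm)
  have pi : (0 : ℝ) ≤ i := Nat.cast_nonneg _
  have pj : (0 : ℝ) ≤ j := Nat.cast_nonneg _
  have pk : (0 : ℝ) ≤ k := Nat.cast_nonneg _
  have pl : (0 : ℝ) ≤ l := Nat.cast_nonneg _
  have e1 : ((i : ℝ) + 1 + (j + 1)) * ((i + 1) ^ 2 + (j + 1) ^ 2)
      + (1 - 2 * v) * (i + 1 + (j + 1)) - 2 * u = 0 := by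
    apply mul_left_cancel₀ nij; linear_combination hj - hi
  have e2 : ((i : ℝ) + 1 + (k + 1)) * ((i + 1) ^ 2 + (k + 1) ^ 2)
      + (1 - 2 * v) * (i + 1 + (k + 1)) - 2 * u = 0 := by
    apply mul_left_cancel₀ nik; linear_combination hk - hi
  have e3 : ((i : ℝ) + 1 + (l + 1)) * ((i + 1) ^ 2 + (l + 1) ^ 2)
      + (1 - 2 * v) * (i + 1 + (l + 1)) - 2 * u = 0 := by
    apply mul_left_cancel₀ nil; linear_combination hl - hi
  have e4 : ((i : ℝ) + 1) ^ 2 + (i + 1) * (j + 1 + (k + 1)) + (j + 1) ^ 2 + (j + 1) * (k + 1)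
      + (k + 1) ^ 2 + (1 - 2 * v) = 0 := by
    apply mul_left_cancel₀ njk; linear_combination e2 - e1
  have e5 : ((i : ℝ) + 1) ^ 2 + (i + 1) * (j + 1 + (l + 1)) + (j + 1) ^ 2 + (j + 1) * (l + 1)
      + (l + 1) ^ 2 + (1 - 2 * v) = 0 := by
    apply mul_left_cancel₀ njl; linear_combination e3 - e1
  have e6 : (i : ℝ) + 1 + (j + 1) + (k + 1) + (l + 1) = 0 := by
    apply mul_left_cancel₀ nkl; linear_combination e5 - e4
  linarith

/-- The input consisting of `n` points of `P` on a parabola, and no witness. -/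
noncomputable def parabolaInput (n : ℕ) : PointInput where
  m := n
  k := 0
  p i := parabola i
  w i := i.elim0
  p_injective := parabola_injective.comp Fin.val_injective
  w_injective := fun i => i.elim0
  generalPosition := by
    constructor
    · intro T hT hc
      obtain ⟨x, y, z, hxy, hxz, hyz, rfl⟩ := Set.ncard_eq_three.1 hc
      simp only [Set.range_eq_empty, Set.union_empty] at hT
      obtain ⟨i, rfl⟩ := hT (a := x) (by simp)
      obtain ⟨j, rfl⟩ := hT (a := y) (by simp)
      obtain ⟨k, rfl⟩ := hT (a := z) (by simp)
      exact not_collinear_parabola (fun h => hxy (by simp [h])) (fun h => hxz (by simp [h]))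
        (fun h => hyz (by simp [h]))
    · intro T hT hc
      obtain ⟨x, T', hx, rfl, hc'⟩ := (Set.ncard_eq_succ (Set.finite_of_ncard_pos (by omega))).1 hc
      obtain ⟨y, z, t, hyz, hyt, hzt, rfl⟩ := Set.ncard_eq_three.1 hc'
      simp only [Set.mem_insert_iff, Set.mem_singleton_iff, not_or] at hx
      simp only [Set.range_eq_empty, Set.union_empty] at hT
      obtain ⟨i, rfl⟩ := hT (a := x) (by simp)
      obtain ⟨j, rfl⟩ := hT (a := y) (by simp)
      obtain ⟨k, rfl⟩ := hT (a := z) (by simp)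
      obtain ⟨l, rfl⟩ := hT (a := t) (by simp)
      exact not_cospherical_parabola (fun h => hx.1 (by simp [h])) (fun h => hx.2.1 (by simp [h]))
        (fun h => hx.2.2 (by simp [h])) (fun h => hyz (by simp [h])) (fun h => hyt (by simp [h]))
        (fun h => hzt (by simp [h]))

theorem parabolaInput_adj {n i j : ℕ} (hi : i < n) (hj : j < n) (hij : i ≠ j) :
    (parabolaInput n).graph.Adj ⟨(parabolaInput n).p ⟨i, hi⟩, Set.mem_range_self _⟩
      ⟨(parabolaInput n).p ⟨j, hj⟩, Set.mem_range_self _⟩ := by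
  refine ⟨fun h => hij (parabola_injective (Subtype.ext_iff.1 h)), ?_⟩
  rintro q ⟨x, -⟩
  exact x.elim0

theorem le_length_of_isEdgeList {n : ℕ} {L : List (ℕ × ℕ)}
    (hL : (parabolaInput n).IsEdgeList L) : n.choose 2 ≤ L.length := by
  classical
  have h : ((Finset.range n).powersetCard 2).card ≤ (L.map fun e => s(e.1, e.2)).toFinset.card := by
    refine Finset.card_le_card_of_surjOn (fun z => z.toFinset) ?_
    intro t ht
    simp only [Finset.mem_coe, Finset.mem_powersetCard] at ht
    obtain ⟨i, j, hij, rfl⟩ := Finset.card_eq_two.1 ht.2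
    have hi : i < n := Finset.mem_range.1 (ht.1 (by simp))
    have hj : j < n := Finset.mem_range.1 (ht.1 (by simp))
    refine ⟨s(i, j), ?_, ?_⟩
    · simp only [List.coe_toFinset, Set.mem_ofPred_eq]
      exact (hL.2 i j).2 ⟨hi, hj, parabolaInput_adj hi hj hij⟩
    · ext x; simp
  rw [Finset.card_powersetCard, Finset.card_range] at h
  exact h.trans ((List.toFinset_card_le _).trans (by simp))

theorem exists_slow_input {c : RealRAM.Prog} (hc : ComputesWitnessGabriel c) {n : ℕ} (hn : 2 ≤ n) :
    ∃ I : PointInput, I.size = n ∧ ∀ (t : ℕ) (s : RealRAM.State), RealRAM.Exec c I.init t s →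
      1 / 4 * (n : ℝ) ^ 2 ≤ (t : ℝ) := by
  refine ⟨parabolaInput n, rfl, fun t s h => ?_⟩
  obtain ⟨t', s', h', hL⟩ := hc (parabolaInput n)
  obtain ⟨rfl, rfl⟩ := h.deterministic h'
  have h1 := h.length_out_le
  have h2 := le_length_of_isEdgeList hL
  have h3 : n.choose 2 ≤ t := by
    have : (parabolaInput n).init.out.length = 0 := rfl
    omega
  have h4 : ((n.choose 2 : ℕ) : ℝ) ≤ t := by exact_mod_cast h3
  rw [Nat.cast_choose_two] at h4
  have : (2 : ℝ) ≤ n := by exact_mod_cast hn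
  nlinarith

end LowerBound

/-- The functions `nx` and `pv` represent a circular doubly linked list with sentinel `0`
that contains the elements of `S` in the order of increasing keys. -/
structure Linked (key : ℕ → ℝ) (S : Finset ℕ) (nx pv : ℕ → ℕ) : Prop where
  zero : 0 ∉ S
  nx_mem : ∀ p, p = 0 ∨ p ∈ S → nx p = 0 ∨ nx p ∈ S
  pv_mem : ∀ p, p = 0 ∨ p ∈ S → pv p = 0 ∨ pv p ∈ S
  pv_nx : ∀ p, p = 0 ∨ p ∈ S → pv (nx p) = p
  nx_pv : ∀ p, p = 0 ∨ p ∈ S → nx (pv p) = p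
  lt : ∀ p, p ∈ S → nx p ≠ 0 → key p < key (nx p)
  gap : ∀ p, p = 0 ∨ p ∈ S → ∀ l ∈ S, (p ≠ 0 ∧ key l ≤ key p) ∨ (nx p ≠ 0 ∧ key (nx p) ≤ key l)

namespace Linked

variable {key : ℕ → ℝ} {S : Finset ℕ} {nx pv : ℕ → ℕ}

theorem empty (key : ℕ → ℝ) : Linked key ∅ (fun _ => 0) (fun _ => 0) := by
  constructor <;> simp

theorem insert (h : Linked key S nx pv)
    (hk : ∀ a ∈ S, ∀ b ∈ S, key a = key b → a = b) {v p : ℕ} (hv : v ∉ S) (hv0 : v ≠ 0)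
    (hp : p = 0 ∨ p ∈ S) (h1 : p ≠ 0 → key p < key v) (h2 : nx p ≠ 0 → key v < key (nx p)) :
    Linked key (insert v S) (Function.update (Function.update nx p v) v (nx p))
      (Function.update (Function.update pv (nx p) v) v p) := by
  have hpv : p ≠ v := by rintro rfl; tauto
  have hqv : nx p ≠ v := by
    intro e
    rcases h.nx_mem p hp with h' | h'
    · exact hv0 (by rw [← e, h'])
    · rw [e] at h'; exact hv h'
  have hz := h.zero
  have hinj : ∀ a b, (a = 0 ∨ a ∈ S) → (b = 0 ∨ b ∈ S) → nx a = nx b → a = b := by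
    intro a b ha hb e
    rw [← h.pv_nx a ha, ← h.pv_nx b hb, e]
  have hS : ∀ a, (a = 0 ∨ a ∈ Insert.insert v S) ↔ a = v ∨ (a = 0 ∨ a ∈ S) := by
    intro a; simp only [Finset.mem_insert]; tauto
  have hne : ∀ a, (a = 0 ∨ a ∈ S) → a ≠ v := by rintro a ha rfl; tauto
  constructor
  · simp [hz, hv0.symm]
  · intro a ha
    rw [hS] at ha ⊢
    simp only [Function.update_apply]
    rcases ha with rfl | ha
    · rw [if_pos rfl]; exact Or.inr (h.nx_mem p hp)
    · rw [if_neg (hne a ha)]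
      split_ifs
      · exact Or.inl rfl
      · exact Or.inr (h.nx_mem a ha)
  · intro a ha
    rw [hS] at ha ⊢
    simp only [Function.update_apply]
    rcases ha with rfl | ha
    · rw [if_pos rfl]; exact Or.inr hp
    · rw [if_neg (hne a ha)]
      split_ifs
      · exact Or.inl rfl
      · exact Or.inr (h.pv_mem a ha)
  · intro a ha
    rw [hS] at ha
    simp only [Function.update_apply]
    rcases ha with rfl | ha
    · simp [hqv]
    · rw [if_neg (hne a ha)]
      by_cases hap : a = p
      · simp [hap]
      · rw [if_neg hap, if_neg (hne _ (h.nx_mem a ha)),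
          if_neg (fun e => hap (hinj a p ha hp e)), h.pv_nx a ha]
  · intro a ha
    rw [hS] at ha
    simp only [Function.update_apply]
    rcases ha with rfl | ha
    · simp [hpv]
    · rw [if_neg (hne a ha)]
      by_cases hap : a = nx p
      · simp [hap]
      · rw [if_neg hap, if_neg (hne _ (h.pv_mem a ha)), if_neg, h.nx_pv a ha]
        intro e
        exact hap (by rw [← e, h.nx_pv a ha])
  · intro a ha h0
    simp only [Function.update_apply] at h0 ⊢
    rw [Finset.mem_insert] at ha
    rcases ha with rfl | ha
    · simp only [if_true] at h0 ⊢
      exact h2 h0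
    · rw [if_neg (hne a (Or.inr ha))] at h0 ⊢
      by_cases hap : a = p
      · subst hap
        simp only [if_true]
        exact h1 (fun e => hz (e ▸ ha))
      · rw [if_neg hap] at h0 ⊢
        exact h.lt a ha h0
  · intro a ha l hl
    rw [hS] at ha
    rw [Finset.mem_insert] at hl
    simp only [Function.update_apply]
    rcases ha with rfl | ha
    · simp only [if_true]
      rcases hl with rfl | hl
      · exact Or.inl ⟨hv0, le_rfl⟩
      · rcases h.gap p hp l hl with ⟨e, e'⟩ | e
        · exact Or.inl ⟨hv0, e'.trans (h1 e).le⟩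
        · exact Or.inr e
    · rw [if_neg (hne a ha)]
      by_cases hap : a = p
      · subst hap
        simp only [if_true]
        rcases hl with rfl | hl
        · exact Or.inr ⟨hv0, le_rfl⟩
        · rcases h.gap a ha l hl with e | ⟨e, e'⟩
          · exact Or.inl e
          · exact Or.inr ⟨hv0, (h2 e).le.trans e'⟩
      · rw [if_neg hap]
        rcases hl with rfl | hl
        · rcases hp with rfl | hp
          · have hq : nx 0 ∈ S := by
              rcases ha with rfl | ha
              · exact absurd rfl hap
              · rcases h.nx_mem 0 (Or.inl rfl) with e | e
                · rcases h.gap 0 (Or.inl rfl) a ha with ⟨e', -⟩ | ⟨e', -⟩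
                  · exact absurd rfl e'
                  · exact absurd e e'
                · exact e
            have hq0 : nx 0 ≠ 0 := fun e => hz (e ▸ hq)
            rcases h.gap a ha _ hq with ⟨e, e'⟩ | ⟨e, e'⟩
            · exact Or.inl ⟨e, (h2 hq0).le.trans e'⟩
            · have ha' : a ∈ S := ha.resolve_left hap
              rcases h.gap 0 (Or.inl rfl) a ha' with ⟨e1, -⟩ | ⟨-, e1⟩
              · exact absurd rfl e1
              · exact Or.inl ⟨fun e => hap e, (h2 hq0).le.trans e1⟩
          · have hp0 : p ≠ 0 := fun e => hz (e ▸ hp)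
            rcases h.gap a ha p hp with ⟨e, e'⟩ | ⟨e, e'⟩
            · have ha' : a ∈ S := ha.resolve_left e
              rcases h.gap p (Or.inr hp) a ha' with ⟨-, e1⟩ | ⟨e0, e1⟩
              · exact absurd (hk a ha' p hp (le_antisymm e1 e')) hap
              · exact Or.inl ⟨e, (h2 e0).le.trans e1⟩
            · exact Or.inr ⟨e, e'.trans (h1 hp0).le⟩
        · exact h.gap a ha l hl

/-- The linked list, as a list. -/
theorem exists_list (h : Linked key S nx pv)
    (hk : ∀ a ∈ S, ∀ b ∈ S, key a = key b → a = b) :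
    ∃ L : List ℕ, L.Pairwise (fun a b => key a < key b) ∧ (∀ x, x ∈ L ↔ x ∈ S) ∧
      (0 :: L ++ [0]).IsChain (fun a b => nx a = b ∧ pv b = a) := by
  classical
  have key_lemma : ∀ n p, (p = 0 ∨ p ∈ S) →
      (S.filter (fun l => p ≠ 0 → key p < key l)).card ≤ n →
      ∃ L : List ℕ, L.Pairwise (fun a b => key a < key b) ∧
        (∀ x, x ∈ L ↔ x ∈ S ∧ (p ≠ 0 → key p < key x)) ∧
        (p :: L ++ [0]).IsChain (fun a b => nx a = b ∧ pv b = a) := by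
    intro n
    induction n with
    | zero =>
      intro p hp hc
      have hc' : S.filter (fun l => p ≠ 0 → key p < key l) = ∅ := by
        rw [← Finset.card_eq_zero]; omega
      have hc2 : ∀ l ∈ S, ¬ (p ≠ 0 → key p < key l) := fun l hl hq => by
        have : l ∈ S.filter (fun l => p ≠ 0 → key p < key l) := by simp [hl]; tauto
        rw [hc'] at this; simp at this
      refine ⟨[], by simp, fun x => ?_, ?_⟩
      · simp only [List.not_mem_nil, false_iff]
        rintro ⟨hx, hx'⟩
        exact hc2 x hx hx'
      · simp only [List.cons_append, List.nil_append, List.isChain_pair]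
        have : nx p = 0 := by
          by_contra hq
          have hq' := (h.nx_mem p hp).resolve_left hq
          exact hc2 _ hq' (fun hp0 => h.lt p (hp.resolve_left hp0) hq)
        exact ⟨this, by rw [← this, h.pv_nx p hp]⟩
    | succ n ih =>
      intro p hp hc
      by_cases hq : nx p = 0
      · refine ⟨[], by simp, fun x => ?_, ?_⟩
        · simp only [List.not_mem_nil, false_iff]
          rintro ⟨hx, hx'⟩
          rcases h.gap p hp x hx with ⟨h1, h2⟩ | ⟨h1, -⟩
          · exact absurd (hx' h1) (not_lt.2 h2)
          · exact h1 hq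
        · simp only [List.cons_append, List.nil_append, List.isChain_pair]
          exact ⟨hq, by rw [← hq, h.pv_nx p hp]⟩
      · have hq' := (h.nx_mem p hp).resolve_left hq
        have hlt : p ≠ 0 → key p < key (nx p) := fun hp0 => h.lt p (hp.resolve_left hp0) hq
        obtain ⟨L, hL1, hL2, hL3⟩ := ih (nx p) (Or.inr hq') (by
          refine Nat.le_of_lt_succ (lt_of_lt_of_le (Finset.card_lt_card ?_) hc)
          rw [Finset.ssubset_iff_of_subset]
          · refine ⟨nx p, by simp only [Finset.mem_filter]; exact ⟨hq', hlt⟩, by simp [hq]⟩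
          · intro l hl
            simp only [Finset.mem_filter] at hl ⊢
            exact ⟨hl.1, fun hp0 => (hlt hp0).trans (hl.2 hq)⟩)
        refine ⟨nx p :: L, ?_, fun x => ?_, ?_⟩
        · rw [List.pairwise_cons]
          exact ⟨fun x hx => ((hL2 x).1 hx).2 hq, hL1⟩
        · rw [List.mem_cons, hL2]
          constructor
          · rintro (rfl | ⟨h1, h2⟩)
            · exact ⟨hq', hlt⟩
            · exact ⟨h1, fun hp0 => (hlt hp0).trans (h2 hq)⟩
          · rintro ⟨h1, h2⟩
            by_cases hx : x = nx p
            · exact Or.inl hx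
            · refine Or.inr ⟨h1, fun _ => ?_⟩
              rcases h.gap p hp x h1 with ⟨h3, h4⟩ | ⟨-, h4⟩
              · exact absurd (h2 h3) (not_lt.2 h4)
              · exact lt_of_le_of_ne h4 fun e => hx (hk x h1 _ hq' e.symm)
        · simp only [List.cons_append, List.isChain_cons_cons]
          exact ⟨⟨trivial, h.pv_nx p hp⟩, by simpa using hL3⟩
  obtain ⟨L, h1, h2, h3⟩ := key_lemma _ 0 (Or.inl rfl) le_rfl
  exact ⟨L, h1, fun x => by simp [h2], h3⟩

end Linked

/-- A simple arrangement of the lines `1, …, N`, the graphs of the functions `f i`, numbered by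
decreasing slope; `X i j` is the abscissa of the crossing of the lines `i` and `j`. -/
structure Lines (N : ℕ) where
  f : ℕ → ℝ → ℝ
  X : ℕ → ℕ → ℝ
  symm : ∀ i j, X i j = X j i
  above : ∀ i j, 1 ≤ j → j < i → i ≤ N → ∀ s, f i s < f j s ↔ X i j < s
  below : ∀ i j, 1 ≤ j → j < i → i ≤ N → ∀ s, f j s < f i s ↔ s < X i j
  simple : ∀ i j k, 1 ≤ i → 1 ≤ j → 1 ≤ k → i ≤ N → j ≤ N → k ≤ N → i ≠ j → i ≠ k → j ≠ k →
    X i j ≠ X i k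

namespace Lines

variable {N : ℕ} (A : Lines N)

theorem eq_at {i j : ℕ} (hi : 1 ≤ i) (hj : 1 ≤ j) (hi' : i ≤ N) (hj' : j ≤ N) :
    A.f i (A.X i j) = A.f j (A.X i j) := by
  rcases lt_trichotomy i j with h | rfl | h
  · rw [A.symm i j]
    apply le_antisymm
    · exact not_lt.1 fun e => absurd ((A.above j i hi h hj' _).1 e) (lt_irrefl _)
    · exact not_lt.1 fun e => absurd ((A.below j i hi h hj' _).1 e) (lt_irrefl _)
  · rfl
  · apply le_antisymm
    · exact not_lt.1 fun e => absurd ((A.below i j hj h hi' _).1 e) (lt_irrefl _)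
    · exact not_lt.1 fun e => absurd ((A.above i j hj h hi' _).1 e) (lt_irrefl _)

/-- Two lines cross only once. -/
theorem lt_between {i j : ℕ} (hi : 1 ≤ i) (hj : 1 ≤ j) (hi' : i ≤ N) (hj' : j ≤ N)
    {s t u : ℝ} (hst : s ≤ t) (htu : t ≤ u) (hs : A.f i s < A.f j s) (hu : A.f i u < A.f j u) :
    A.f i t < A.f j t := by
  rcases lt_trichotomy i j with h | rfl | h
  · rw [A.below j i hi h hj'] at *; linarith
  · exact absurd hs (lt_irrefl _)
  · rw [A.above i j hj h hi'] at *; linarith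

theorem lt_between' {i j : ℕ} (hi : 1 ≤ i) (hj : 1 ≤ j) (hi' : i ≤ N) (hj' : j ≤ N)
    {s t u : ℝ} (hst : s ≤ t) (htu : t < u) (hs : A.f i s < A.f j s) (hu : A.f i u ≤ A.f j u) :
    A.f i t < A.f j t := by
  rcases lt_trichotomy i j with h | rfl | h
  · rw [A.below j i hi h hj'] at *
    have := mt (A.above j i hi h hj' u).2 (not_lt.2 hu)
    linarith
  · exact absurd hs (lt_irrefl _)
  · rw [A.above i j hj h hi'] at *; linarith

/-- While line `r` is inserted and has crossed the lines in `J`, the elements of list `i`. -/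
def elems (r : ℕ) (J : Finset ℕ) (i : ℕ) : Finset ℕ :=
  (Finset.Icc 1 r).filter (fun l => l ≠ i ∧ (l = r → i ∈ J))

theorem mem_elems {r i l : ℕ} {J : Finset ℕ} :
    l ∈ elems r J i ↔ 1 ≤ l ∧ l ≤ r ∧ l ≠ i ∧ (l = r → i ∈ J) := by
  simp [elems, and_assoc]

/-- `J` is a set of lines `< r`, crossed by line `r` before all the other lines `< r`, and `cur`
is the line of `J` crossed last. -/
structure Crossed (r : ℕ) (J : Finset ℕ) (cur : ℕ) : Prop where
  hr : r ≤ N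
  sub : ∀ j ∈ J, 1 ≤ j ∧ j < r
  lt : ∀ j ∈ J, ∀ l, 1 ≤ l → l < r → l ∉ J → A.X r j < A.X r l
  cur : (cur = 0 ∧ J = ∅) ∨ (cur ∈ J ∧ ∀ j ∈ J, A.X r j ≤ A.X r cur)

/-- The walk is at abscissa `x` on line `k`, where the lower envelope of `J` passes from line `p`
to line `k`, and is about to continue to the right. -/
structure Up (r : ℕ) (J : Finset ℕ) (cur k p : ℕ) (x : ℝ) : Prop where
  mem : k ∈ J
  p_mem : p ∈ elems r J k
  x_eq : A.X k p = x
  cur_le : A.X r cur ≤ x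
  low : ∀ j ∈ J, j ≠ k → A.f k x < A.f j x ∨ (j = p ∧ j < k)
  high : ∀ l, 1 ≤ l → l < r → l ∉ J → A.f l x < A.f k x

/-- The walk is at abscissa `x` on line `k`, on the upper envelope of the lines not in `J`, and is
about to continue to the left. -/
structure Down (r : ℕ) (J : Finset ℕ) (k p : ℕ) (x : ℝ) : Prop where
  one_le : 1 ≤ k
  lt_r : k < r
  not_mem : k ∉ J
  p_mem : p = 0 ∨ p ∈ elems r J k
  x_eq : p ≠ 0 → A.X k p = x
  x_gt : p = 0 → ∀ l ∈ elems r J k, A.X k l < x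
  r_lt : A.X r k < x
  low : ∀ j ∈ J, A.f k x ≤ A.f j x
  high : ∀ l, 1 ≤ l → l < r → l ∉ J → l ≠ k → A.f l x < A.f k x ∨ (l = p ∧ l < k)

/-- The elements of `D` have left the lower envelope of `J` for good (upward phase). -/
def LeftUp (J D : Finset ℕ) (x : ℝ) : Prop :=
  ∀ i ∈ D, i ∈ J ∧ ∀ s, x < s → ∃ j ∈ J, A.f j s < A.f i s

/-- The elements of `D` have left the lower envelope of `J` for good (downward phase). -/
def LeftDown (r : ℕ) (J D : Finset ℕ) : Prop :=
  ∀ i ∈ D, i ∈ J ∧ ∀ l, 1 ≤ l → l < r → l ∉ J → ∀ s, A.X r l < s →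
    ∃ j, (j ∈ J ∨ j = l) ∧ A.f j s < A.f i s

/-- Line `d` is on the upper envelope of the lines not in `J`, above line `r`. -/
def Seen (r : ℕ) (J : Finset ℕ) (d : ℕ) (s : ℝ) : Prop :=
  A.X r d < s ∧ ∀ l, 1 ≤ l → l < r → l ∉ J → A.f l s ≤ A.f d s

/-- The elements of `E` have been entered in downward phases (upward phase). -/
def EnteredUp (r : ℕ) (J E : Finset ℕ) (cur : ℕ) : Prop :=
  ∀ d ∈ E, (1 ≤ d ∧ d < r) ∧ cur ≠ 0 ∧ ∃ s, A.Seen r J d s ∧ A.f cur s ≤ A.f d s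

/-- The elements of `E` have been entered in downward phases (downward phase). -/
def EnteredDown (r : ℕ) (J E : Finset ℕ) (cur k : ℕ) : Prop :=
  ∀ d ∈ E, (1 ≤ d ∧ d < r) ∧
    ((cur ≠ 0 ∧ ∃ s, A.Seen r J d s ∧ A.f cur s ≤ A.f d s) ∨ (d ≤ k ∧ ∃ s, A.Seen r J d s))

variable {A} {r : ℕ} {J D E : Finset ℕ} {cur k p q : ℕ} {x : ℝ}

/-- There are abscissas to the right of all crossings. -/
theorem exists_large (A : Lines N) (r : ℕ) : ∃ M, ∀ i j, i ≤ r → j ≤ r → A.X i j < M := by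
  obtain ⟨M, hM⟩ := (((Finset.range (r + 1) ×ˢ Finset.range (r + 1)).image
    (fun z => A.X z.1 z.2)).finite_toSet).bddAbove
  refine ⟨M + 1, fun i j hi hj => ?_⟩
  have : A.X i j ≤ M := hM (by
    simp only [Finset.coe_image, Set.mem_image]
    exact ⟨(i, j), by simp; omega, rfl⟩)
  linarith

/-- The walk reaches the right end of a line: it continues on the next line, from the right. -/
theorem Up.unbounded (hc : A.Crossed r J cur) (hu : (k = 0 ∧ J = ∅) ∨ A.Up r J cur k p x)
    (hne : ∃ l, 1 ≤ l ∧ l < r ∧ l ∉ J)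
    (hq : k = 0 ∨ ∀ l ∈ elems r J k, A.X k l ≤ x)
    (hD : A.LeftUp J D x) (hE : A.EnteredUp r J E cur) :
    ∃ x', A.Down r J (k + 1) 0 x' ∧ A.LeftDown r J D ∧ A.EnteredDown r J E cur (k + 1) := by
  have hr := hc.hr
  have hJ : ∀ l, 1 ≤ l → l < r → (l ∈ J ↔ l ≤ k) := by
    rcases hu with ⟨rfl, rfl⟩ | hu
    · intro l h1 h2; simp; omega
    have hk := hc.sub k hu.mem
    have hq' := hq.resolve_left (by omega)
    intro l h1 h2
    constructor
    · intro hl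
      by_contra hlk
      have h3 := hq' l (mem_elems.2 ⟨h1, h2.le, by omega, by omega⟩)
      rcases hu.low l hl (by omega) with h4 | ⟨-, h4⟩
      · rw [A.below l k hk.1 (by omega) (by omega), A.symm] at h4; linarith
      · omega
    · intro hlk
      by_contra hl
      have h3 : l ≠ k := by rintro rfl; exact hl hu.mem
      have h4 := hq' l (mem_elems.2 ⟨h1, h2.le, by omega, by omega⟩)
      have h5 := hu.high l h1 h2 hl
      rw [A.below k l h1 (by omega) (by omega)] at h5
      linarith
  obtain ⟨M, hM⟩ := exists_large A r
  have hk1 : k + 1 < r := by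
    obtain ⟨l, h1, h2, h3⟩ := hne
    rw [hJ l h1 h2] at h3; omega
  refine ⟨M, ⟨by omega, hk1, ?_, Or.inl rfl, by simp, ?_, ?_, ?_, ?_⟩, ?_, ?_⟩
  · rw [hJ _ (by omega) hk1]; omega
  · intro _ l hl
    rw [mem_elems] at hl
    exact hM _ _ hk1.le hl.2.1
  · exact hM _ _ le_rfl hk1.le
  · intro j hj
    have := hc.sub j hj
    have h1 := (hJ j this.1 this.2).1 hj
    exact ((A.above (k + 1) j this.1 (by omega) (by omega) M).2 (hM _ _ hk1.le (by omega))).le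
  · intro l h1 h2 h3 h4
    rw [hJ l h1 h2] at h3
    exact Or.inl ((A.above l (k + 1) (by omega) (by omega) (by omega) M).2
      (hM _ _ (by omega) hk1.le))
  · intro i hi
    refine ⟨(hD i hi).1, fun l h1 h2 h3 s hs => ⟨l, Or.inr rfl, ?_⟩⟩
    have hi' := hc.sub i (hD i hi).1
    have h4 := (hJ i hi'.1 hi'.2).1 (hD i hi).1
    rw [hJ l h1 h2] at h3
    have h5 := hc.lt i (hD i hi).1 l h1 h2 (by rw [hJ l h1 h2]; omega)
    have h6 := (A.above r i hi'.1 hi'.2 hr (A.X r l)).2 h5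
    rw [A.eq_at (by omega) h1 hr (by omega), A.above l i hi'.1 (by omega) (by omega)] at h6
    rw [A.above l i hi'.1 (by omega) (by omega)]
    linarith
  · intro d hd
    exact ⟨(hE d hd).1, Or.inl (hE d hd).2⟩

theorem Up.next_at (hc : A.Crossed r J cur) (hu : A.Up r J cur k p x) (hq : q ∈ elems r J k)
    (hxq : x < A.X k q) (hgap : ∀ l ∈ elems r J k, A.X k l ≤ x ∨ A.X k q ≤ A.X k l) :
    q < r ∧ (∀ j ∈ J, j ≠ k → j ≠ q → A.f k (A.X k q) < A.f j (A.X k q)) ∧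
      (∀ l, 1 ≤ l → l < r → l ∉ J → l ≠ q → A.f l (A.X k q) < A.f k (A.X k q)) ∧
      (∀ s, x < s → s < A.X k q → ∀ j ∈ J, j ≠ k → A.f k s < A.f j s) ∧
      (k < q → q ∈ J) ∧ (q < k → q ∉ J) := by
  have hr := hc.hr
  have hk := hc.sub k hu.mem
  rw [mem_elems] at hq
  have hqr : q < r := by
    refine lt_of_le_of_ne hq.2.1 ?_
    rintro rfl
    have h1 : A.X q k ≤ A.X q cur := by
      rcases hc.cur with ⟨-, h⟩ | ⟨-, h⟩
      · rw [h] at hu; exact absurd hu.mem (by simp)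
      · exact h k hu.mem
    rw [A.symm] at h1
    linarith [hu.cur_le]
  have hlow : ∀ s, x < s → s ≤ A.X k q → ∀ j ∈ J, j ≠ k → (j = q → s < A.X k q) →
      A.f k s < A.f j s := by
    intro s h1 h2 j hj hjk hjq
    have hj' := hc.sub j hj
    rcases lt_or_gt_of_ne hjk with h | h
    · rw [A.above k j hj'.1 h (by omega)]
      rcases hu.low j hj hjk with h3 | ⟨h3, -⟩
      · rw [A.above k j hj'.1 h (by omega)] at h3; linarith
      · rw [h3, hu.x_eq]; exact h1
    · rcases hu.low j hj hjk with h3 | ⟨-, h3⟩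
      · rw [A.below j k hk.1 h (by omega)] at h3 ⊢
        rw [A.symm j k] at h3 ⊢
        rcases hgap j (mem_elems.2 ⟨hj'.1, by omega, hjk, by omega⟩) with h4 | h4
        · linarith
        · by_cases hjq' : j = q
          · have := hjq hjq'; rwa [hjq']
          · refine lt_of_le_of_ne (h2.trans h4) fun e => ?_
            have : A.X k q = A.X k j := le_antisymm h4 (e ▸ h2)
            exact A.simple k q j hk.1 hq.1 hj'.1 (by omega) (by omega) (by omega) (by omega)
              (by omega) (by omega) this
      · omega
  refine ⟨hqr, ?_, ?_, ?_, ?_, ?_⟩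
  · intro j hj hjk hjq
    exact hlow _ hxq le_rfl j hj hjk (fun h => absurd h hjq)
  · intro l h1 h2 h3 h4
    have hlk : l ≠ k := by rintro rfl; exact h3 hu.mem
    have h5 := hu.high l h1 h2 h3
    have h6 := hgap l (mem_elems.2 ⟨h1, by omega, hlk, by omega⟩)
    have h7 := A.simple k q l hk.1 hq.1 h1 (by omega) (by omega) (by omega) (by omega)
              (by omega) (by omega)
    rcases lt_or_gt_of_ne hlk with h | h
    · rw [A.below k l h1 h (by omega)] at h5 ⊢
      rcases h6 with h6 | h6
      · linarith
      · exact lt_of_le_of_ne h6 h7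
    · rw [A.above l k hk.1 h (by omega)] at h5 ⊢
      linarith
  · intro s h1 h2 j hj hjk
    exact hlow s h1 h2.le j hj hjk fun _ => h2
  · intro h
    by_contra hqJ
    have h1 := hu.high q hq.1 hqr hqJ
    rw [A.above q k hk.1 h (by omega), A.symm] at h1
    linarith
  · intro h hqJ
    rcases hu.low q hqJ (by omega) with h1 | ⟨h1, -⟩
    · rw [A.above k q hq.1 h (by omega)] at h1; linarith
    · rw [h1, hu.x_eq] at hxq; exact absurd hxq (lt_irrefl _)

/-- The walk follows the lower envelope to the right. -/
theorem Up.stay (hc : A.Crossed r J cur) (hu : A.Up r J cur k p x) (hq : q ∈ elems r J k)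
    (hxq : x < A.X k q) (hgap : ∀ l ∈ elems r J k, A.X k l ≤ x ∨ A.X k q ≤ A.X k l)
    (hD : A.LeftUp J D x) (hkq : k < q) :
    A.Up r J cur q k (A.X k q) ∧ k ∉ D ∧ A.LeftUp J (insert k D) (A.X k q) := by
  obtain ⟨h1, h2, h3, h4, h5, -⟩ := hu.next_at hc hq hxq hgap
  have hr := hc.hr
  have hk := hc.sub k hu.mem
  have hq1 := (mem_elems.1 hq).1
  have he := A.eq_at hk.1 hq1 (by omega) (by omega)
  refine ⟨⟨h5 hkq, mem_elems.2 ⟨hk.1, by omega, by omega, by omega⟩, A.symm _ _,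
    hu.cur_le.trans hxq.le, ?_, ?_⟩, ?_, ?_⟩
  · intro j hj hjq
    by_cases hjk : j = k
    · exact Or.inr ⟨hjk, by omega⟩
    · rw [← he]; exact Or.inl (h2 j hj hjk hjq)
  · intro l l1 l2 l3
    rw [← he]
    exact h3 l l1 l2 l3 (by rintro rfl; exact l3 (h5 hkq))
  · intro hkD
    obtain ⟨s, hs1, hs2⟩ := exists_between hxq
    obtain ⟨j, hj, hjs⟩ := (hD k hkD).2 s hs1
    by_cases hjk : j = k
    · rw [hjk] at hjs; exact lt_irrefl _ hjs
    · exact lt_asymm hjs (h4 s hs1 hs2 j hj hjk)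
  · intro i hi
    rw [Finset.mem_insert] at hi
    rcases hi with rfl | hi
    · refine ⟨hu.mem, fun s hs => ⟨q, h5 hkq, ?_⟩⟩
      rw [A.above q i hk.1 hkq (by omega), A.symm]
      exact hs
    · exact ⟨(hD i hi).1, fun s hs => (hD i hi).2 s (hxq.trans hs)⟩

/-- The walk passes from the lower envelope of `J` to the upper envelope of the other lines. -/
theorem Up.turn (hc : A.Crossed r J cur) (hu : A.Up r J cur k p x) (hq : q ∈ elems r J k)
    (hxq : x < A.X k q) (hgap : ∀ l ∈ elems r J k, A.X k l ≤ x ∨ A.X k q ≤ A.X k l)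
    (hD : A.LeftUp J D x) (hE : A.EnteredUp r J E cur) (hkq : q < k) :
    A.Down r J q k (A.X k q) ∧ A.LeftDown r J D ∧ A.EnteredDown r J E cur q := by
  obtain ⟨h1, h2, h3, h4, -, h5⟩ := hu.next_at hc hq hxq hgap
  have hr := hc.hr
  have hk := hc.sub k hu.mem
  have hq1 := (mem_elems.1 hq).1
  have he := A.eq_at hk.1 hq1 (by omega) (by omega)
  have hqJ := h5 hkq
  have hrk : A.X r k ≤ A.X r cur := by
    rcases hc.cur with ⟨-, h⟩ | ⟨-, h⟩
    · rw [h] at hu; exact absurd hu.mem (by simp)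
    · exact h k hu.mem
  have hlow : ∀ j ∈ J, A.f k (A.X k q) ≤ A.f j (A.X k q) := by
    intro j hj
    by_cases hjk : j = k
    · rw [hjk]
    · exact (h2 j hj hjk (by rintro rfl; exact hqJ hj)).le
  refine ⟨⟨hq1, h1, hqJ, Or.inr (mem_elems.2 ⟨hk.1, by omega, by omega, by omega⟩),
    fun _ => A.symm _ _, by omega, ?_, ?_, ?_⟩, ?_, ?_⟩
  · rw [← A.above r q hq1 h1 hr, ← he, A.above r k hk.1 hk.2 hr]
    linarith [hu.cur_le]
  · intro j hj
    rw [← he]; exact hlow j hj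
  · intro l l1 l2 l3 l4
    rw [← he]; exact Or.inl (h3 l l1 l2 l3 l4)
  · intro i hi
    obtain ⟨hiJ, hi2⟩ := hD i hi
    have hi' := hc.sub i hiJ
    refine ⟨hiJ, fun l l1 l2 l3 s hs => ?_⟩
    by_cases hsq : A.X k q < s
    · obtain ⟨j, hj, hjs⟩ := hi2 s (hxq.trans hsq)
      exact ⟨j, Or.inl hj, hjs⟩
    · refine ⟨l, Or.inr rfl, ?_⟩
      have hik : i ≠ k := by
        rintro rfl
        obtain ⟨s, hs1, hs2⟩ := exists_between hxq
        obtain ⟨j, hj, hjs⟩ := hi2 s hs1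
        by_cases hjk : j = i
        · rw [hjk] at hjs; exact lt_irrefl _ hjs
        · exact lt_asymm hjs (h4 s hs1 hs2 j hj hjk)
      have a1 : A.f l (A.X r l) < A.f i (A.X r l) := by
        rw [← A.eq_at (by omega) l1 hr (by omega), A.above r i hi'.1 hi'.2 hr]
        exact hc.lt i hiJ l l1 l2 l3
      have a2 : A.f l (A.X k q) < A.f i (A.X k q) := by
        have := h2 i hiJ hik (by rintro rfl; exact hqJ hiJ)
        by_cases hlq : l = q
        · rw [hlq, ← he]; exact this
        · exact (h3 l l1 l2 l3 hlq).trans this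
      exact A.lt_between l1 hi'.1 (by omega) (by omega) hs.le (not_lt.1 hsq) a1 a2
  · intro d hd
    exact ⟨(hE d hd).1, Or.inl (hE d hd).2⟩

/-- The walk follows the upper envelope to the left. -/
theorem Down.stay (hc : A.Crossed r J cur) (hd : A.Down r J k p x) (hq : q ∈ elems r J k)
    (hqx : A.X k q < x) (hgap : ∀ l ∈ elems r J k, A.X k l ≤ A.X k q ∨ x ≤ A.X k l)
    (hkq : k < q) (hrq : A.X r k < A.X k q) (hE : A.EnteredDown r J E cur k) :
    A.Down r J q k (A.X k q) ∧ q ∉ E ∧ A.EnteredDown r J (insert q E) cur q := by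
  have hr := hc.hr
  have hk1 := hd.one_le
  have hkr := hd.lt_r
  rw [mem_elems] at hq
  have hqr : q < r := by
    refine lt_of_le_of_ne hq.2.1 fun e => hd.not_mem (hq.2.2.2 e)
  have he := A.eq_at hk1 hq.1 (by omega) (by omega)
  have hqx' : A.f q x < A.f k x := by
    rw [A.above q k hk1 hkq (by omega), A.symm]; exact hqx
  have hqJ : q ∉ J := fun h => absurd (hd.low q h) (not_le.2 hqx')
  have hrq' : A.X r q < A.X k q := by
    rw [← A.above r q hq.1 hqr hr, ← he, A.above r k hk1 hkr hr]; exact hrq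
  have hlow : ∀ j ∈ J, A.f k (A.X k q) < A.f j (A.X k q) := by
    intro j hj
    have hj' := hc.sub j hj
    have h1 : A.f k (A.X r k) < A.f j (A.X r k) := by
      rw [← A.eq_at (by omega) hk1 hr (by omega), A.above r j hj'.1 hj'.2 hr]
      exact hc.lt j hj k hk1 hkr hd.not_mem
    exact A.lt_between' hk1 hj'.1 (by omega) (by omega) hrq.le hqx h1 (hd.low j hj)
  have hhigh : ∀ l, 1 ≤ l → l < r → l ∉ J → l ≠ q → l ≠ k → A.f l (A.X k q) < A.f k (A.X k q) := by
    intro l l1 l2 l3 l4 l5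
    have h6 := hgap l (mem_elems.2 ⟨l1, by omega, l5, by omega⟩)
    have h7 := A.simple k q l hk1 hq.1 l1 (by omega) (by omega) (by omega) (by omega)
              (by omega) (by omega)
    rcases lt_or_gt_of_ne l5 with h | h
    · rw [A.below k l l1 h (by omega)]
      rcases hd.high l l1 l2 l3 l5 with h5 | ⟨h5, -⟩
      · rw [A.below k l l1 h (by omega)] at h5; linarith
      · rw [h5, hd.x_eq (by omega)]; exact hqx
    · rcases hd.high l l1 l2 l3 l5 with h5 | ⟨-, h5⟩
      · rw [A.above l k hk1 h (by omega), A.symm] at h5 ⊢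
        rcases h6 with h6 | h6
        · exact lt_of_le_of_ne h6 h7.symm
        · linarith
      · omega
  refine ⟨⟨hq.1, hqr, hqJ, Or.inr (mem_elems.2 ⟨hk1, by omega, by omega, by omega⟩),
    fun _ => A.symm _ _, by omega, hrq', ?_, ?_⟩, ?_, ?_⟩
  · intro j hj
    rw [← he]; exact (hlow j hj).le
  · intro l l1 l2 l3 l4
    by_cases hlk : l = k
    · exact Or.inr ⟨hlk, by omega⟩
    · rw [← he]; exact Or.inl (hhigh l l1 l2 l3 l4 hlk)
  · intro hqE
    rcases (hE q hqE).2 with ⟨hcur, s, ⟨hs1, hs2⟩, hs3⟩ | ⟨h, -⟩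
    · have hcJ : cur ∈ J := by
        rcases hc.cur with ⟨h, -⟩ | ⟨h, -⟩
        · exact absurd h hcur
        · exact h
      have hc' := hc.sub cur hcJ
      rcases lt_or_ge (A.X k q) s with h | h
      · have := hs2 k hk1 hkr hd.not_mem
        have h2 := (A.above q k hk1 hkq (by omega) s).2 (by rw [A.symm]; exact h)
        linarith
      · have h1 : A.f q (A.X r q) < A.f cur (A.X r q) := by
          rw [← A.eq_at (by omega) hq.1 hr (by omega), A.above r cur hc'.1 hc'.2 hr]
          exact hc.lt cur hcJ q hq.1 hqr hqJ
        have h2 := hqx'.trans_le (hd.low cur hcJ)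
        have := A.lt_between hq.1 hc'.1 (by omega) (by omega) hs1.le (h.trans hqx.le) h1 h2
        linarith
    · omega
  · intro d hdE
    rw [Finset.mem_insert] at hdE
    rcases hdE with rfl | hdE
    · refine ⟨⟨hq.1, hqr⟩, Or.inr ⟨le_rfl, A.X k d, hrq', fun l l1 l2 l3 => ?_⟩⟩
      rw [← he]
      by_cases hlk : l = k
      · rw [hlk]
      · by_cases hlq : l = d
        · rw [hlq, he]
        · exact (hhigh l l1 l2 l3 hlq hlk).le
    · refine ⟨(hE d hdE).1, ?_⟩
      rcases (hE d hdE).2 with h | ⟨h1, h2⟩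
      · exact Or.inl h
      · exact Or.inr ⟨by omega, h2⟩

/-- The walk returns to line `r`, on its next crossing. -/
theorem Down.cross (hc : A.Crossed r J cur) (hd : A.Down r J k p x)
    (hq : q = 0 ∨ (q ∈ elems r J k ∧ A.X k q < x))
    (hgap : ∀ l ∈ elems r J k, (q ≠ 0 ∧ A.X k l ≤ A.X k q) ∨ x ≤ A.X k l)
    (hqr : ¬ (k < q ∧ A.X r k < A.X k q))
    (hD : A.LeftDown r J D) (hE : A.EnteredDown r J E cur k) :
    A.Crossed r (insert k J) k ∧ A.Up r (insert k J) k k r (A.X k r) ∧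
      A.LeftUp (insert k J) D (A.X k r) ∧ A.EnteredUp r (insert k J) E k ∧
      (q ≠ 0 → A.X k q < A.X k r) := by
  have hr := hc.hr
  have hk1 := hd.one_le
  have hkr := hd.lt_r
  have hq' : q ≠ 0 → A.X k q < A.X k r := by
    intro hq0
    obtain ⟨hq1, hq2⟩ := hq.resolve_left hq0
    rw [mem_elems] at hq1
    have hqr' : q < r := lt_of_le_of_ne hq1.2.1 fun e => hd.not_mem (hq1.2.2.2 e)
    have hne := A.simple k q r hk1 hq1.1 (by omega) (by omega) (by omega) (by omega) (by omega)
      (by omega) (by omega)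
    rw [A.symm r k] at hqr
    refine lt_of_le_of_ne (not_lt.1 fun h => ?_) hne
    rcases lt_or_gt_of_ne hq1.2.2.1 with h' | h'
    · by_cases hqJ : q ∈ J
      · have h1 := hc.lt q hqJ k hk1 hkr hd.not_mem
        rw [← A.above r q hq1.1 hqr' hr, A.eq_at (by omega) hk1 hr (by omega),
          A.above k q hq1.1 h' (by omega), A.symm r k] at h1
        linarith
      · rcases hd.high q hq1.1 hqr' hqJ hq1.2.2.1 with h1 | ⟨h1, -⟩
        · rw [A.below k q hq1.1 h' (by omega)] at h1; linarith
        · rw [← hd.x_eq (by omega), ← h1] at hq2; exact lt_irrefl _ hq2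
    · exact hqr ⟨h', h⟩
  have hnext : ∀ l, 1 ≤ l → l < r → l ∉ J → l ≠ k → A.X r k < A.X r l := by
    intro l l1 l2 l3 l4
    rw [← A.below r l l1 l2 hr, A.eq_at (by omega) hk1 hr (by omega)]
    rcases lt_or_gt_of_ne l4 with h | h
    · rw [A.below k l l1 h (by omega)]
      rcases hd.high l l1 l2 l3 l4 with h5 | ⟨h5, -⟩
      · rw [A.below k l l1 h (by omega)] at h5; linarith [hd.r_lt]
      · rw [h5, hd.x_eq (by omega)]; exact hd.r_lt
    · rcases hd.high l l1 l2 l3 l4 with h5 | ⟨-, h5⟩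
      · rw [A.above l k hk1 h (by omega), A.symm] at h5 ⊢
        rcases hgap l (mem_elems.2 ⟨l1, by omega, l4, by omega⟩) with ⟨h6, h7⟩ | h6
        · have := hq' h6
          rw [A.symm r k]; linarith
        · linarith
      · omega
  have hcr : A.Crossed r (insert k J) k := by
    refine ⟨hr, ?_, ?_, Or.inr ⟨by simp, ?_⟩⟩
    · intro j hj
      rw [Finset.mem_insert] at hj
      rcases hj with rfl | hj
      · exact ⟨hk1, hkr⟩
      · exact hc.sub j hj
    · intro j hj l l1 l2 l3
      rw [Finset.mem_insert, not_or] at l3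
      rw [Finset.mem_insert] at hj
      rcases hj with rfl | hj
      · exact hnext l l1 l2 l3.2 l3.1
      · exact hc.lt j hj l l1 l2 l3.2
    · intro j hj
      rw [Finset.mem_insert] at hj
      rcases hj with rfl | hj
      · exact le_rfl
      · exact (hc.lt j hj k hk1 hkr hd.not_mem).le
  refine ⟨hcr, ⟨by simp, mem_elems.2 ⟨by omega, le_rfl, by omega, by simp⟩, rfl,
    (A.symm _ _).le, ?_, ?_⟩, ?_, ?_, hq'⟩
  · intro j hj hjk
    have hj : j ∈ J := (Finset.mem_insert.1 hj).resolve_left hjk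
    have hj' := hc.sub j hj
    rw [A.eq_at hk1 (by omega) (by omega) hr, A.above r j hj'.1 hj'.2 hr, A.symm k r]
    exact Or.inl (hc.lt j hj k hk1 hkr hd.not_mem)
  · intro l l1 l2 l3
    rw [Finset.mem_insert, not_or] at l3
    rw [A.eq_at hk1 (by omega) (by omega) hr, A.below r l l1 l2 hr, A.symm k r]
    exact hnext l l1 l2 l3.2 l3.1
  · intro i hi
    refine ⟨by simp [(hD i hi).1], fun s hs => ?_⟩
    obtain ⟨j, hj, hjs⟩ := (hD i hi).2 k hk1 hkr hd.not_mem s (by rw [A.symm]; exact hs)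
    exact ⟨j, by rw [Finset.mem_insert]; tauto, hjs⟩
  · intro d hdE
    refine ⟨(hE d hdE).1, by omega, ?_⟩
    have : ∃ s, A.Seen r J d s := by
      rcases (hE d hdE).2 with ⟨-, s, hs, -⟩ | ⟨-, s, hs⟩ <;> exact ⟨s, hs⟩
    obtain ⟨s, hs1, hs2⟩ := this
    refine ⟨s, ⟨hs1, fun l l1 l2 l3 => ?_⟩, hs2 k hk1 hkr hd.not_mem⟩
    rw [Finset.mem_insert, not_or] at l3
    exact hs2 l l1 l2 l3.2

end Lines

namespace Lines

/-- A configuration of the walk: the linked lists, the position, the line crossed last, the number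
of lines crossed, and whether the walk moves up. -/
structure Conf where
  nx : ℕ → ℕ → ℕ
  pv : ℕ → ℕ → ℕ
  k : ℕ
  p : ℕ
  cur : ℕ
  cnt : ℕ
  up : ℕ

/-- Insert `v` between `p` and `q` in row `i`; `nx` and `pv` arise by exchanging `p` and `q`. -/
def link (g : ℕ → ℕ → ℕ) (i p v q : ℕ) : ℕ → ℕ → ℕ :=
  Function.update g i (Function.update (Function.update (g i) p v) v q)

open Classical in
/-- One step of the walk along line `r`; `test k q` tells whether the crossing of the lines `k` and
`q` is above line `r`. -/
noncomputable def Conf.step (test : ℕ → ℕ → Prop) (r : ℕ) (c : Conf) : Conf :=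
  if 0 < c.up then
    if 0 < c.nx c.k c.p then
      { c with up := if c.nx c.k c.p < c.k then 0 else c.up, p := c.k, k := c.nx c.k c.p }
    else { c with k := c.k + 1, p := 0, up := 0 }
  else if c.k < c.pv c.k c.p ∧ test c.k (c.pv c.k c.p) then
    { c with p := c.k, k := c.pv c.k c.p }
  else
    { nx := link (link c.nx c.k (c.pv c.k c.p) r c.p) r c.cur c.k 0
      pv := link (link c.pv c.k c.p r (c.pv c.k c.p)) r 0 c.k c.cur
      k := c.k, p := r, cur := c.k, cnt := c.cnt + 1, up := 1 }

variable {N : ℕ} (A : Lines N)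

/-- The lists describe the arrangement of the lines `1, …, r`. -/
structure Built (r : ℕ) (nx pv : ℕ → ℕ → ℕ) : Prop where
  rows : ∀ i, 1 ≤ i → i ≤ r → Linked (A.X i) ((Finset.Icc 1 r).erase i) (nx i) (pv i)
  zero : nx 0 = 0
  untouched : ∀ i, r < i → nx i = 0 ∧ pv i = 0

/-- The invariant of the walk along line `r`. -/
structure Walk (r : ℕ) (c : Conf) (J D E : Finset ℕ) (x : ℝ) : Prop where
  crossed : A.Crossed r J c.cur
  card : c.cnt = J.card
  rows : ∀ i, 1 ≤ i → i < r → Linked (A.X i) (elems r J i) (c.nx i) (c.pv i)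
  row : Linked (A.X r) J (c.nx r) (c.pv r)
  zero : c.nx 0 = 0
  untouched : ∀ i, r < i → c.nx i = 0 ∧ c.pv i = 0
  phase : (c.up = 1 ∧ ((c.k = 0 ∧ c.p = 0 ∧ J = ∅) ∨ A.Up r J c.cur c.k c.p x) ∧ A.LeftUp J D x ∧
      A.EnteredUp r J E c.cur) ∨
    (c.up = 0 ∧ A.Down r J c.k c.p x ∧ A.LeftDown r J D ∧ A.EnteredDown r J E c.cur c.k)

/-- The number of steps left. -/
def stepsLeft (r up : ℕ) (J D E : Finset ℕ) : ℕ :=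
  2 * (r - J.card) + up + (r - D.card) + (r - E.card)

variable {A} {r : ℕ} {c : Conf} {J D E : Finset ℕ} {x : ℝ}

theorem X_injOn {i : ℕ} (hi : 1 ≤ i) (hiN : i ≤ N) {S : Finset ℕ}
    (hS : ∀ a ∈ S, 1 ≤ a ∧ a ≤ N ∧ a ≠ i) : ∀ a ∈ S, ∀ b ∈ S, A.X i a = A.X i b → a = b := by
  intro a ha b hb h
  by_contra hab
  obtain ⟨a1, a2, a3⟩ := hS a ha
  obtain ⟨b1, b2, b3⟩ := hS b hb
  exact A.simple i a b hi a1 b1 hiN a2 b2 a3.symm b3.symm hab h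

theorem card_lt_of_sub {S : Finset ℕ} (hr : 1 ≤ r) (hS : ∀ a ∈ S, 1 ≤ a ∧ a < r) : S.card < r := by
  have : S ⊆ Finset.Icc 1 (r - 1) := fun a ha => by
    have := hS a ha
    simp; omega
  have := Finset.card_le_card this
  simp at this; omega

theorem Built.start {nx pv : ℕ → ℕ → ℕ} (hb : A.Built r nx pv) (hr : r + 1 ≤ N) :
    A.Walk (r + 1) ⟨nx, pv, 0, 0, 0, 0, 1⟩ ∅ ∅ ∅ 0 := by
  refine ⟨⟨hr, by simp, by simp, Or.inl ⟨rfl, rfl⟩⟩, by simp, ?_, ?_, hb.zero,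
    fun i hi => hb.untouched i (by omega),
    Or.inl ⟨rfl, Or.inl ⟨rfl, rfl, rfl⟩, by simp [LeftUp], by simp [EnteredUp]⟩⟩
  · intro i h1 h2
    have : elems (r + 1) ∅ i = (Finset.Icc 1 r).erase i := by
      ext l
      rw [mem_elems]
      simp; omega
    rw [this]
    exact hb.rows i h1 (by omega)
  · obtain ⟨h1, h2⟩ := hb.untouched (r + 1) (by omega)
    simp only [h1, h2]
    exact Linked.empty _

theorem Walk.built (h : A.Walk r c J D E x) (hr : 1 ≤ r) (hc : ¬ c.cnt + 1 < r) :
    A.Built r c.nx c.pv := by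
  have hJ : J = Finset.Icc 1 (r - 1) := by
    apply Finset.eq_of_subset_of_card_le
    · intro a ha
      have := h.crossed.sub a ha
      simp; omega
    · rw [← h.card]; simp; omega
  refine ⟨fun i h1 h2 => ?_, h.zero, h.untouched⟩
  rcases h2.eq_or_lt with rfl | h2
  · have : (Finset.Icc 1 i).erase i = J := by
      rw [hJ]; ext l; simp; omega
    rw [this]
    exact h.row
  · have : (Finset.Icc 1 r).erase i = elems r J i := by
      ext l
      rw [mem_elems, hJ]
      simp; omega
    rw [this]
    exact h.rows i h1 h2

theorem Walk.card_J_lt (h : A.Walk r c J D E x) (hr : 1 ≤ r) : J.card < r :=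
  card_lt_of_sub hr h.crossed.sub

theorem Walk.card_D_lt (h : A.Walk r c J D E x) (hr : 1 ≤ r) : D.card < r := by
  apply card_lt_of_sub hr
  intro a ha
  rcases h.phase with ⟨-, -, h1, -⟩ | ⟨-, -, h1, -⟩ <;> exact h.crossed.sub a (h1 a ha).1

theorem Walk.card_E_lt (h : A.Walk r c J D E x) (hr : 1 ≤ r) : E.card < r := by
  apply card_lt_of_sub hr
  intro a ha
  rcases h.phase with ⟨-, -, -, h1⟩ | ⟨-, -, -, h1⟩ <;> exact (h1 a ha).1

/-- The indices occurring in a step are in range. -/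
theorem Walk.bounds (h : A.Walk r c J D E x) :
    c.k ≤ r ∧ c.p ≤ r ∧ c.cur ≤ r ∧ c.nx c.k c.p ≤ r ∧ (c.up = 0 → c.k < r ∧ c.pv c.k c.p ≤ r) := by
  have hcur : c.cur ≤ r := by
    rcases h.crossed.cur with ⟨h1, -⟩ | ⟨h1, -⟩
    · omega
    · exact (h.crossed.sub _ h1).2.le
  have hle : ∀ {J i l}, (l = 0 ∨ l ∈ elems r J i) → l ≤ r := by
    rintro J i l (rfl | hl)
    · omega
    · exact (mem_elems.1 hl).2.1
  rcases h.phase with ⟨h1, ⟨h2, h3, h4⟩ | h2, -⟩ | ⟨h1, h2, -⟩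
  · simp [h2, h3, h.zero, hcur, h1]
  · have hk := h.crossed.sub _ h2.mem
    have hp := h2.p_mem
    exact ⟨hk.2.le, hle (Or.inr hp), hcur, hle ((h.rows _ hk.1 hk.2).nx_mem _ (Or.inr hp)), by omega⟩
  · have hl := h.rows _ h2.one_le h2.lt_r
    exact ⟨h2.lt_r.le, hle h2.p_mem, hcur, hle (hl.nx_mem _ h2.p_mem),
      fun _ => ⟨h2.lt_r, hle (hl.pv_mem _ h2.p_mem)⟩⟩

theorem link_same (g : ℕ → ℕ → ℕ) (i p v q : ℕ) :
    link g i p v q i = Function.update (Function.update (g i) p v) v q := by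
  simp [link]

theorem link_ne (g : ℕ → ℕ → ℕ) {i j : ℕ} (p v q : ℕ) (h : j ≠ i) : link g i p v q j = g j := by
  simp [link, h]

theorem Walk.step {test : ℕ → ℕ → Prop} (h : A.Walk r c J D E x) (hc : c.cnt + 1 < r)
    (htest : ∀ k q, 1 ≤ k → k < q → q < r → (test k q ↔ A.X r k < A.X k q)) :
    ∃ J' D' E' x', A.Walk r (c.step test r) J' D' E' x' ∧
      stepsLeft r (c.step test r).up J' D' E' < stepsLeft r c.up J D E := by
  have hrN := h.crossed.hr
  have hJr := h.card_J_lt (by omega)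
  have hDr := h.card_D_lt (by omega)
  have hEr := h.card_E_lt (by omega)
  have hne : ∃ l, 1 ≤ l ∧ l < r ∧ l ∉ J := by
    by_contra! hn
    have : Finset.Icc 1 (r - 1) ⊆ J := fun l hl => by
      simp at hl
      exact hn l hl.1 (by omega)
    have := Finset.card_le_card this
    rw [← h.card] at this
    simp at this; omega
  rcases h.phase with ⟨hup, hu, hD, hE⟩ | ⟨hup, hd, hD, hE⟩
  · by_cases hq : 0 < c.nx c.k c.p
    · have hs : c.step test r =
          { c with up := if c.nx c.k c.p < c.k then 0 else c.up, p := c.k, k := c.nx c.k c.p } := by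
        simp [Conf.step, hup, hq]
      have hu : A.Up r J c.cur c.k c.p x := by
        rcases hu with ⟨h1, -, -⟩ | hu
        · rw [h1, h.zero] at hq; simp at hq
        · exact hu
      have hk := h.crossed.sub _ hu.mem
      have hl := h.rows _ hk.1 hk.2
      have hp0 : c.p ≠ 0 := by have := (mem_elems.1 hu.p_mem).1; omega
      have hqm := (hl.nx_mem _ (Or.inr hu.p_mem)).resolve_left hq.ne'
      have hxq : x < A.X c.k (c.nx c.k c.p) := by
        rw [← hu.x_eq]; exact hl.lt _ hu.p_mem hq.ne'
      have hgap : ∀ l ∈ elems r J c.k, A.X c.k l ≤ x ∨ A.X c.k (c.nx c.k c.p) ≤ A.X c.k l := by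
        intro l hl'
        rw [← hu.x_eq]
        rcases hl.gap _ (Or.inr hu.p_mem) l hl' with ⟨-, h1⟩ | ⟨-, h1⟩
        · exact Or.inl h1
        · exact Or.inr h1
      have hqk := (mem_elems.1 hqm).2.2.1
      rcases lt_or_gt_of_ne hqk with hlt | hlt
      · obtain ⟨h1, h2, h3⟩ := hu.turn h.crossed hqm hxq hgap hD hE hlt
        rw [if_pos hlt] at hs
        refine ⟨J, D, E, A.X c.k (c.nx c.k c.p), ?_, ?_⟩
        · rw [hs]
          exact ⟨h.crossed, h.card, h.rows, h.row, h.zero, h.untouched, Or.inr ⟨rfl, h1, h2, h3⟩⟩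
        · simp only [hs, stepsLeft]; omega
      · obtain ⟨h1, h2, h3⟩ := hu.stay h.crossed hqm hxq hgap hD hlt
        rw [if_neg (by omega)] at hs
        have hw : A.Walk r (c.step test r) J (insert c.k D) E (A.X c.k (c.nx c.k c.p)) := by
          rw [hs]
          exact ⟨h.crossed, h.card, h.rows, h.row, h.zero, h.untouched,
            Or.inl ⟨hup, Or.inr h1, h3, hE⟩⟩
        refine ⟨J, insert c.k D, E, _, hw, ?_⟩
        have := hw.card_D_lt (by omega)
        rw [Finset.card_insert_of_notMem h2] at this
        simp only [hs, stepsLeft, Finset.card_insert_of_notMem h2]; omega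
    · have hs : c.step test r = { c with k := c.k + 1, p := 0, up := 0 } := by
        simp [Conf.step, hup, hq]
      have hq0 : c.nx c.k c.p = 0 := by omega
      obtain ⟨x', h1, h2, h3⟩ := Up.unbounded (k := c.k) (p := c.p) h.crossed (by tauto) hne (by
        rcases hu with ⟨h1, -⟩ | hu
        · exact Or.inl h1
        · have hk := h.crossed.sub _ hu.mem
          have hl := h.rows _ hk.1 hk.2
          refine Or.inr fun l hl' => ?_
          rcases hl.gap _ (Or.inr hu.p_mem) l hl' with ⟨-, h1⟩ | ⟨h1, -⟩
          · rwa [hu.x_eq] at h1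
          · exact absurd hq0 h1) hD hE
      refine ⟨J, D, E, x', ?_, ?_⟩
      · rw [hs]
        exact ⟨h.crossed, h.card, h.rows, h.row, h.zero, h.untouched, Or.inr ⟨rfl, h1, h2, h3⟩⟩
      · simp only [hs, stepsLeft]; omega
  · have hl := h.rows _ hd.one_le hd.lt_r
    have hnx := hl.nx_pv _ hd.p_mem
    have hqm := hl.pv_mem _ hd.p_mem
    have hq : c.pv c.k c.p = 0 ∨
        (c.pv c.k c.p ∈ elems r J c.k ∧ A.X c.k (c.pv c.k c.p) < x) := by
      rcases hqm with h0 | hm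
      · exact Or.inl h0
      · refine Or.inr ⟨hm, ?_⟩
        by_cases hp0 : c.p = 0
        · exact hd.x_gt hp0 _ hm
        · rw [← hd.x_eq hp0]
          have := hl.lt _ hm (by rw [hnx]; exact hp0)
          rwa [hnx] at this
    have hgap : ∀ l ∈ elems r J c.k,
        (c.pv c.k c.p ≠ 0 ∧ A.X c.k l ≤ A.X c.k (c.pv c.k c.p)) ∨ x ≤ A.X c.k l := by
      intro l hl'
      rcases hl.gap _ hqm l hl' with h1 | ⟨h1, h2⟩
      · exact Or.inl h1
      · rw [hnx] at h1 h2
        rw [hd.x_eq h1] at h2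
        exact Or.inr h2
    have hqr : c.pv c.k c.p ∈ elems r J c.k → c.pv c.k c.p < r := fun h' => by
      rw [mem_elems] at h'
      exact lt_of_le_of_ne h'.2.1 fun e => hd.not_mem (h'.2.2.2 e)
    have htest' : (c.k < c.pv c.k c.p ∧ test c.k (c.pv c.k c.p)) ↔
        (c.k < c.pv c.k c.p ∧ A.X r c.k < A.X c.k (c.pv c.k c.p)) := by
      refine and_congr_right fun hlt => htest _ _ hd.one_le hlt ?_
      exact hqr (hqm.resolve_left (by omega))
    by_cases ht : c.k < c.pv c.k c.p ∧ test c.k (c.pv c.k c.p)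
    · have hs : c.step test r = { c with p := c.k, k := c.pv c.k c.p } := by
        simp [Conf.step, hup, ht]
      obtain ⟨hm, hqx⟩ := hq.resolve_left (by omega)
      obtain ⟨h1, h2, h3⟩ := hd.stay h.crossed hm hqx
        (fun l hl' => (hgap l hl').imp And.right id) ht.1 (htest'.1 ht).2 hE
      have hw : A.Walk r (c.step test r) J D (insert (c.pv c.k c.p) E)
          (A.X c.k (c.pv c.k c.p)) := by
        rw [hs]
        exact ⟨h.crossed, h.card, h.rows, h.row, h.zero, h.untouched,
          Or.inr ⟨hup, h1, hD, h3⟩⟩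
      refine ⟨J, D, _, _, hw, ?_⟩
      have := hw.card_E_lt (by omega)
      rw [Finset.card_insert_of_notMem h2] at this
      simp only [hs, stepsLeft, Finset.card_insert_of_notMem h2]; omega
    · have hs : c.step test r =
          { nx := link (link c.nx c.k (c.pv c.k c.p) r c.p) r c.cur c.k 0
            pv := link (link c.pv c.k c.p r (c.pv c.k c.p)) r 0 c.k c.cur
            k := c.k, p := r, cur := c.k, cnt := c.cnt + 1, up := 1 } := by
        rw [Conf.step, if_neg (by omega), if_neg ht]
      rw [htest'] at ht
      obtain ⟨h1, h2, h3, h4, h5⟩ := hd.cross h.crossed hq hgap ht hD hE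
      have hk1 := hd.one_le
      have hkr := hd.lt_r
      have hcard : (insert c.k J).card = J.card + 1 := Finset.card_insert_of_notMem hd.not_mem
      have hnx0 : c.nx r c.cur = 0 := by
        rcases h.crossed.cur with ⟨e1, e2⟩ | ⟨e1, e2⟩
        · have := h.row.nx_mem _ (Or.inl e1)
          rw [e2] at this
          simpa using this
        · by_contra hn
          have := h.row.nx_mem _ (Or.inr e1)
          have h6 := h.row.lt _ e1 hn
          linarith [e2 _ (this.resolve_left hn)]
      have hcurm : c.cur = 0 ∨ c.cur ∈ J := h.crossed.cur.imp And.left And.left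
      have hw : A.Walk r (c.step test r) (insert c.k J) D E (A.X c.k r) := by
        rw [hs]
        refine ⟨h1, ?_, ?_, ?_, ?_, ?_, Or.inl ⟨rfl, Or.inr h2, h3, h4⟩⟩
        · simp only [hcard, h.card]
        · intro i i1 i2
          simp only
          rw [link_ne _ _ _ _ i2.ne, link_ne _ _ _ _ i2.ne]
          by_cases hik : i = c.k
          · subst hik
            rw [link_same, link_same]
            have hel : elems r (insert c.k J) c.k = insert r (elems r J c.k) := by
              ext l
              simp only [mem_elems, Finset.mem_insert, true_or, implies_true, and_true]
              constructor
              · rintro ⟨a1, a2, a3⟩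
                by_cases hlr : l = r
                · exact Or.inl hlr
                · exact Or.inr ⟨a1, a2, a3, fun e => absurd e hlr⟩
              · rintro (rfl | ⟨a1, a2, a3, -⟩)
                · exact ⟨by omega, le_rfl, by omega⟩
                · exact ⟨a1, a2, a3⟩
            rw [hel]
            have hX : c.p ≠ 0 → A.X c.k r < A.X c.k c.p := fun hp0 => by
              rw [hd.x_eq hp0, A.symm]; exact hd.r_lt
            have := hl.insert (X_injOn hk1 (by omega) fun a ha => by
                rw [mem_elems] at ha; omega) (v := r) (p := c.pv c.k c.p)
                (by rw [mem_elems]; intro e; exact hd.not_mem (e.2.2.2 rfl)) (by omega) hqm h5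
                (by rw [hnx]; exact hX)
            rwa [hnx] at this
          · rw [link_ne _ _ _ _ hik, link_ne _ _ _ _ hik]
            have hel : elems r (insert c.k J) i = elems r J i := by
              ext l
              simp only [mem_elems, Finset.mem_insert, hik, false_or]
            rw [hel]
            exact h.rows i i1 i2
        · simp only
          rw [link_same, link_same, link_ne _ _ _ _ hkr.ne', link_ne _ _ _ _ hkr.ne']
          have := h.row.insert (X_injOn (by omega) hrN fun a ha => by
                have := h.crossed.sub a ha; omega) (v := c.k) (p := c.cur)
                hd.not_mem (by omega) hcurm
                (fun hc0 => h.crossed.lt _ (hcurm.resolve_left hc0) _ hk1 hkr hd.not_mem)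
                (fun e => absurd hnx0 e)
          rwa [hnx0] at this
        · simp only
          rw [link_ne _ _ _ _ (by omega), link_ne _ _ _ _ (by omega)]
          exact h.zero
        · intro i hi
          simp only
          rw [link_ne _ _ _ _ (by omega), link_ne _ _ _ _ (by omega), link_ne _ _ _ _ (by omega),
            link_ne _ _ _ _ (by omega)]
          exact h.untouched i hi
      refine ⟨_, D, E, _, hw, ?_⟩
      simp only [hs, stepsLeft, hcard]; omega

end Lines

/-- Vectors `e 0, …, e (m - 1)`, given by coordinates, in the order of a rotational sweep. -/
structure Sweep (ex ey : ℕ → ℝ) (m : ℕ) : Prop where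
  expire : ∀ s t t', s < t → t < t' → t' < m → ex t * ex s + ey t * ey s ≤ 0 →
    ex t' * ex s + ey t' * ey s ≤ 0
  cross_pos : ∀ s t, s < t → t < m → 0 < ex t * ex s + ey t * ey s →
    0 < ex s * ey t - ey s * ex t
  norm_pos : ∀ t, t < m → 0 < ex t * ex t + ey t * ey t

namespace Sweep

/-- The vector `e s` is in the closed disk with diameter `0`, `e t`. -/
def Kills (ex ey : ℕ → ℝ) (s t : ℕ) : Prop :=
  ex s * ex s + ey s * ey s ≤ ex t * ex s + ey t * ey s

/-- The inverse of `e y` is not beyond the line through the inverses of `e x` and `e z`. -/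
def Useless (ex ey : ℕ → ℝ) (x y z : ℕ) : Prop :=
  (ex y * ey z - ey y * ex z) * (ex x * ex x + ey x * ey x) +
    (ex x * ey y - ey x * ex y) * (ex z * ex z + ey z * ey z) ≤
    (ex x * ey z - ey x * ex z) * (ex y * ex y + ey y * ey y)

/-- The part of the queue `q` between `lo` and `hi` contains what matters of the vectors `e s`,
`s < t`, `W s`, for the vectors from `e t` on. -/
structure Queue (ex ey : ℕ → ℝ) (m : ℕ) (W : ℕ → Prop) (q : ℕ → ℕ) (lo hi t : ℕ) : Prop where
  le : lo ≤ hi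
  mem : ∀ i, lo ≤ i → i < hi → q i < t ∧ W (q i)
  mono : ∀ i, lo ≤ i → i + 1 < hi → q i < q (i + 1)
  convex : ∀ i, lo ≤ i → i + 2 < hi → ¬ Useless ex ey (q i) (q (i + 1)) (q (i + 2))
  dom : ∀ s, s < t → W s → ∀ t', t ≤ t' → t' < m → Kills ex ey s t' →
    (∃ i, lo ≤ i ∧ i < hi ∧ Kills ex ey (q i) t') ∨ (t < t' ∧ W t ∧ Kills ex ey t t')

variable {ex ey : ℕ → ℝ} {m : ℕ} {W : ℕ → Prop} {q : ℕ → ℕ} {lo hi t : ℕ}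

theorem dot_pos_of_lt (h : Sweep ex ey m) {s t t' : ℕ} (hst : s < t) (htt : t < t') (ht : t' < m)
    (h0 : 0 < ex t' * ex s + ey t' * ey s) :
    0 < ex t * ex s + ey t * ey s ∧ 0 < ex t' * ex t + ey t' * ey t := by
  have h1 : 0 < ex t * ex s + ey t * ey s := by
    by_contra hn
    exact absurd (h.expire s t t' hst htt ht (not_lt.1 hn)) (not_le.2 h0)
  refine ⟨h1, ?_⟩
  have h2 := h.cross_pos s t hst (by omega) h1
  have h3 := h.cross_pos s t' (by omega) ht h0
  have h4 := h.norm_pos s (by omega)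
  have h5 := add_pos (mul_pos h1 h0) (mul_pos h2 h3)
  have h6 : (ex t * ex s + ey t * ey s) * (ex t' * ex s + ey t' * ey s) +
      (ex s * ey t - ey s * ex t) * (ex s * ey t' - ey s * ex t') =
      (ex s * ex s + ey s * ey s) * (ex t' * ex t + ey t' * ey t) := by ring
  rw [h6] at h5
  exact pos_of_mul_pos_right h5 h4.le

theorem Queue.start : Queue ex ey m W q 0 0 0 :=
  ⟨le_rfl, by omega, by omega, by omega, by omega⟩

theorem Queue.strictMono (h : Queue ex ey m W q lo hi t) {i j : ℕ} (hi' : lo ≤ i) (hij : i < j)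
    (hj : j < hi) : q i < q j := by
  induction j, hij using Nat.le_induction with
  | base => exact h.mono i hi' hj
  | succ j hij ih => exact (ih (by omega)).trans (h.mono j (by omega) hj)

/-- If the front of the queue has a positive product with `e t`, then so do all its elements. -/
theorem Queue.pos (h : Queue ex ey m W q lo hi t) (hs : Sweep ex ey m) (ht : t < m)
    (h0 : 0 < ex t * ex (q lo) + ey t * ey (q lo)) {i : ℕ} (h1 : lo ≤ i) (h2 : i < hi) :
    0 < ex t * ex (q i) + ey t * ey (q i) := by
  rcases h1.eq_or_lt with rfl | h1
  · exact h0
  · exact (hs.dot_pos_of_lt (h.strictMono le_rfl h1 h2) (h.mem i h1.le h2).1 ht h0).2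

theorem Queue.expire (h : Queue ex ey m W q lo hi t) (hs : Sweep ex ey m)
    (hlo : lo < hi) (h0 : ¬ 0 < ex t * ex (q lo) + ey t * ey (q lo)) :
    Queue ex ey m W q (lo + 1) hi t := by
  refine ⟨hlo, fun i h1 => h.mem i (by omega), fun i h1 => h.mono i (by omega),
    fun i h1 => h.convex i (by omega), fun s s1 s2 t' t1 t2 hk => ?_⟩
  rcases h.dom s s1 s2 t' t1 t2 hk with ⟨i, h1, h2, h3⟩ | h3
  · refine Or.inl ⟨i, ?_, h2, h3⟩
    rcases h1.eq_or_lt with rfl | h1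
    · exfalso
      have hq := (h.mem lo le_rfl hlo).1
      have h4 := hs.norm_pos (q lo) (by omega)
      have h5 : ex t' * ex (q lo) + ey t' * ey (q lo) ≤ 0 := by
        rcases t1.eq_or_lt with rfl | t1
        · exact not_lt.1 h0
        · exact hs.expire _ t t' hq t1 t2 (not_lt.1 h0)
      unfold Kills at h3
      linarith
    · exact h1
  · exact Or.inr h3

theorem Queue.advance (h : Queue ex ey m W q lo hi t) (hs : Sweep ex ey m) (ht : t < m)
    (hlo : lo + 1 < hi) (h0 : 0 < ex t * ex (q lo) + ey t * ey (q lo))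
    (hle : ¬ (ex t * ex (q (lo + 1)) + ey t * ey (q (lo + 1))) *
        (ex (q lo) * ex (q lo) + ey (q lo) * ey (q lo)) <
      (ex t * ex (q lo) + ey t * ey (q lo)) *
        (ex (q (lo + 1)) * ex (q (lo + 1)) + ey (q (lo + 1)) * ey (q (lo + 1)))) :
    Queue ex ey m W q (lo + 1) hi t := by
  refine ⟨hlo.le, fun i h1 => h.mem i (by omega), fun i h1 => h.mono i (by omega),
    fun i h1 => h.convex i (by omega), fun s s1 s2 t' t1 t2 hk => ?_⟩
  rcases h.dom s s1 s2 t' t1 t2 hk with ⟨i, h1, h2, h3⟩ | h3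
  · left
    rcases h1.eq_or_lt with rfl | h1
    · refine ⟨lo + 1, le_rfl, hlo, ?_⟩
      have hx := (h.mem lo le_rfl (by omega)).1
      have hy := (h.mem (lo + 1) (by omega) hlo).1
      have hxy := h.mono lo le_rfl hlo
      generalize q lo = x at *
      generalize q (lo + 1) = y at *
      have nx := hs.norm_pos x (by omega)
      have ny := hs.norm_pos y (by omega)
      unfold Kills at h3 ⊢
      have px : 0 < ex t' * ex x + ey t' * ey x := nx.trans_le h3
      rw [not_lt] at hle
      have key : (ex t' * ex x + ey t' * ey x) * (ex y * ex y + ey y * ey y) ≤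
          (ex t' * ex y + ey t' * ey y) * (ex x * ex x + ey x * ey x) := by
        rcases t1.eq_or_lt with rfl | t1
        · exact hle
        · have c1 := hs.cross_pos x y hxy (by omega)
            (hs.dot_pos_of_lt hxy hy ht h0).1
          have c2 := hs.cross_pos t t' t1 t2 (hs.dot_pos_of_lt hx t1 t2 px).2
          have c3 := mul_pos c2 c1
          have c4 : (ex t * ey t' - ey t * ex t') * (ex x * ey y - ey x * ex y) =
              (ex t * ex x + ey t * ey x) * (ex t' * ex y + ey t' * ey y) -
              (ex t * ex y + ey t * ey y) * (ex t' * ex x + ey t' * ey x) := by ring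
          rw [c4] at c3
          refine le_of_mul_le_mul_left ?_ h0
          have c5 := mul_le_mul_of_nonneg_left hle px.le
          have c6 := mul_le_mul_of_nonneg_right c3.le nx.le
          linarith
      refine le_of_mul_le_mul_right ?_ nx
      have := mul_le_mul_of_nonneg_right h3 ny.le
      linarith
    · exact ⟨i, h1, h2, h3⟩
  · exact Or.inr h3

/-- The facts about three elements of the queue, or two of them and the next vector. -/
theorem triple (hs : Sweep ex ey m) {x y z : ℕ} (hxy : x < y) (hyz : y < z) (hz : z < m)
    (h0 : 0 < ex z * ex x + ey z * ey x) :
    0 < ex x * ey y - ey x * ex y ∧ 0 < ex y * ey z - ey y * ex z ∧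
      0 < ex x * ey z - ey x * ex z ∧ 0 < ex x * ex x + ey x * ey x ∧
      0 < ex y * ex y + ey y * ey y ∧ 0 < ex z * ex z + ey z * ey z := by
  obtain ⟨h1, h2⟩ := hs.dot_pos_of_lt hxy hyz hz h0
  exact ⟨hs.cross_pos x y hxy (by omega) h1, hs.cross_pos y z hyz hz h2,
    hs.cross_pos x z (by omega) hz h0, hs.norm_pos x (by omega), hs.norm_pos y (by omega),
    hs.norm_pos z hz⟩

theorem Queue.popBack (h : Queue ex ey m W q lo hi t) (hs : Sweep ex ey m) (ht : t < m)
    (hW : W t) (hlo : lo + 1 < hi) (h0 : 0 < ex t * ex (q lo) + ey t * ey (q lo))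
    (hu : Useless ex ey (q (hi - 2)) (q (hi - 1)) t) :
    Queue ex ey m W q lo (hi - 1) t := by
  refine ⟨by omega, fun i h1 h2 => h.mem i h1 (by omega), fun i h1 h2 => h.mono i h1 (by omega),
    fun i h1 h2 => h.convex i h1 (by omega), fun s s1 s2 t' t1 t2 hk => ?_⟩
  rcases h.dom s s1 s2 t' t1 t2 hk with ⟨i, h1, h2, h3⟩ | h3
  · by_cases hi' : i < hi - 1
    · exact Or.inl ⟨i, h1, hi', h3⟩
    obtain rfl : i = hi - 1 := by omega
    have hxy := h.mono (hi - 2) (by omega) (by omega)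
    rw [show hi - 2 + 1 = hi - 1 by omega] at hxy
    obtain ⟨c1, c2, c3, nx, ny, nz⟩ := hs.triple hxy (h.mem (hi - 1) h1 h2).1 ht
      (h.pos hs ht h0 (show lo ≤ hi - 2 by omega) (by omega))
    have goal' : Kills ex ey (q (hi - 2)) t' ∨ (t < t' ∧ Kills ex ey t t') := by
      generalize q (hi - 2) = x at *
      generalize q (hi - 1) = y at *
      unfold Kills Useless at *
      by_contra hn
      rw [not_or] at hn
      obtain ⟨n1, n2⟩ := hn
      rw [not_le] at n1
      have n3 : ex t' * ex t + ey t' * ey t ≤ ex t * ex t + ey t * ey t := by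
        rcases t1.eq_or_lt with rfl | t1
        · exact le_rfl
        · exact (not_le.1 fun e => n2 ⟨t1, e⟩).le
      have e1 := mul_lt_mul_of_pos_left n1 c2
      have e2 := mul_le_mul_of_nonneg_left n3 c1.le
      have e3 := mul_le_mul_of_nonneg_left h3 c3.le
      have e4 : (ex x * ey t - ey x * ex t) * (ex t' * ex y + ey t' * ey y) =
        (ex y * ey t - ey y * ex t) * (ex t' * ex x + ey t' * ey x) +
        (ex x * ey y - ey x * ex y) * (ex t' * ex t + ey t' * ey t) := by ring
      linarith
    rcases goal' with g | ⟨g1, g2⟩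
    · exact Or.inl ⟨hi - 2, by omega, by omega, g⟩
    · exact Or.inr ⟨g1, hW, g2⟩
  · exact Or.inr h3

theorem Queue.front_best (h : Queue ex ey m W q lo hi t) (hs : Sweep ex ey m) (ht : t < m)
    (h0 : 0 < ex t * ex (q lo) + ey t * ey (q lo))
    (hlt : lo + 1 < hi → (ex t * ex (q (lo + 1)) + ey t * ey (q (lo + 1))) *
        (ex (q lo) * ex (q lo) + ey (q lo) * ey (q lo)) <
      (ex t * ex (q lo) + ey t * ey (q lo)) *
        (ex (q (lo + 1)) * ex (q (lo + 1)) + ey (q (lo + 1)) * ey (q (lo + 1))))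
    {i : ℕ} (h1 : lo ≤ i) (h2 : i + 1 < hi) :
    (ex t * ex (q (i + 1)) + ey t * ey (q (i + 1))) *
        (ex (q i) * ex (q i) + ey (q i) * ey (q i)) ≤
      (ex t * ex (q i) + ey t * ey (q i)) *
        (ex (q (i + 1)) * ex (q (i + 1)) + ey (q (i + 1)) * ey (q (i + 1))) := by
  induction i, h1 using Nat.le_induction with
  | base => exact (hlt h2).le
  | succ i h1 ih =>
    have ih' := ih (by omega)
    have hxy := h.mono i h1 (by omega)
    have hyz := h.mono (i + 1) (by omega) h2
    have hz := (h.mem (i + 1 + 1) (by omega) h2).1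
    have hc := h.convex i h1 (by omega)
    have px := h.pos hs ht h0 h1 (by omega)
    have pz := h.pos hs ht h0 (show lo ≤ i + 1 by omega) (by omega)
    rw [show i + 2 = i + 1 + 1 by rfl] at hc
    generalize q i = x at *
    generalize q (i + 1) = y at *
    generalize q (i + 1 + 1) = z at *
    have p1 := (hs.dot_pos_of_lt (hxy.trans hyz) hz ht px).1
    obtain ⟨c1, c2, c3, nx, ny, nz⟩ := hs.triple hxy hyz (by omega) p1
    unfold Useless at hc
    rw [not_le] at hc
    refine le_of_mul_le_mul_left ?_ c1
    have e1 : (ex x * ey z - ey x * ex z) * (ex t * ex y + ey t * ey y) =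
        (ex y * ey z - ey y * ex z) * (ex t * ex x + ey t * ey x) +
        (ex x * ey y - ey x * ex y) * (ex t * ex z + ey t * ey z) := by ring
    have e2 := mul_le_mul_of_nonneg_left ih' c2.le
    have e3 := mul_lt_mul_of_pos_right hc pz
    have e4 := congrArg (· * (ex y * ex y + ey y * ey y)) e1
    linarith

theorem Queue.exists_kills_iff (h : Queue ex ey m W q lo hi t) (hs : Sweep ex ey m) (ht : t < m)
    (h0 : lo < hi → 0 < ex t * ex (q lo) + ey t * ey (q lo))
    (hlt : lo + 1 < hi → (ex t * ex (q (lo + 1)) + ey t * ey (q (lo + 1))) *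
        (ex (q lo) * ex (q lo) + ey (q lo) * ey (q lo)) <
      (ex t * ex (q lo) + ey t * ey (q lo)) *
        (ex (q (lo + 1)) * ex (q (lo + 1)) + ey (q (lo + 1)) * ey (q (lo + 1)))) :
    (lo < hi ∧ Kills ex ey (q lo) t) ↔ ∃ s, s < t ∧ W s ∧ Kills ex ey s t := by
  constructor
  · rintro ⟨h1, h2⟩
    exact ⟨q lo, (h.mem lo le_rfl h1).1, (h.mem lo le_rfl h1).2, h2⟩
  · rintro ⟨s, h1, h2, h3⟩
    rcases h.dom s h1 h2 t le_rfl ht h3 with ⟨i, i1, i2, i3⟩ | ⟨h4, -⟩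
    · refine ⟨by omega, ?_⟩
      clear h3 h2 h1
      induction i, i1 using Nat.le_induction with
      | base => exact i3
      | succ i i1 ih =>
        refine ih (by omega) ?_
        have h4 := h.front_best hs ht (h0 (by omega)) hlt i1 i2
        have n1 := hs.norm_pos (q i) (by have := (h.mem i i1 (by omega)).1; omega)
        have n2 := hs.norm_pos (q (i + 1)) (by have := (h.mem (i + 1) (by omega) i2).1; omega)
        unfold Kills at i3 ⊢
        refine le_of_mul_le_mul_right ?_ n2
        have := mul_le_mul_of_nonneg_right i3 n1.le
        linarith
    · omega

theorem Queue.skip (h : Queue ex ey m W q lo hi t) (hW : ¬ W t) :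
    Queue ex ey m W q lo hi (t + 1) := by
  refine ⟨h.le, fun i h1 h2 => ⟨by have := (h.mem i h1 h2).1; omega, (h.mem i h1 h2).2⟩, h.mono,
    h.convex, fun s s1 s2 t' t1 t2 hk => ?_⟩
  rcases (Nat.le_of_lt_succ s1).eq_or_lt with rfl | s1
  · exact absurd s2 hW
  · rcases h.dom s (by omega) s2 t' (by omega) t2 hk with h3 | ⟨-, h3, -⟩
    · exact Or.inl h3
    · exact absurd h3 hW

theorem Queue.push (h : Queue ex ey m W q lo hi t) (hW : W t)
    (hu : lo + 1 < hi → ¬ Useless ex ey (q (hi - 2)) (q (hi - 1)) t) :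
    Queue ex ey m W (Function.update q hi t) lo (hi + 1) (t + 1) := by
  have hlt : ∀ i, i < hi → Function.update q hi t i = q i := fun i hi' => by
    rw [Function.update_of_ne hi'.ne]
  have heq : Function.update q hi t hi = t := Function.update_self ..
  refine ⟨h.le.trans (Nat.le_succ _), fun i h1 h2 => ?_, fun i h1 h2 => ?_, fun i h1 h2 => ?_,
    fun s s1 s2 t' t1 t2 hk => ?_⟩
  · rcases (Nat.le_of_lt_succ h2).eq_or_lt with rfl | h2
    · rw [heq]; exact ⟨by omega, hW⟩
    · rw [hlt i h2]
      exact ⟨by have := (h.mem i h1 h2).1; omega, (h.mem i h1 h2).2⟩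
  · rw [hlt i (by omega)]
    rcases (Nat.le_of_lt_succ h2).eq_or_lt with e | h2
    · rw [e, heq]; exact (h.mem i h1 (by omega)).1
    · rw [hlt _ h2]; exact h.mono i h1 h2
  · rw [hlt i (by omega), hlt (i + 1) (by omega)]
    rcases (Nat.le_of_lt_succ h2).eq_or_lt with e | h2
    · rw [e, heq]
      have := hu (by omega)
      rwa [show hi - 2 = i by omega, show hi - 1 = i + 1 by omega] at this
    · rw [hlt _ h2]; exact h.convex i h1 h2
  · left
    rcases (Nat.le_of_lt_succ s1).eq_or_lt with rfl | s1
    · exact ⟨hi, h.le, by omega, by rwa [heq]⟩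
    · rcases h.dom s (by omega) s2 t' (by omega) t2 hk with ⟨i, i1, i2, i3⟩ | ⟨-, -, h3⟩
      · exact ⟨i, i1, by omega, by rwa [hlt i i2]⟩
      · exact ⟨hi, h.le, by omega, by rwa [heq]⟩

end Sweep

/-! Arrays of natural numbers are named `n…`, scalar variables, which occupy cell `0` of an array
of natural numbers, `v…`, and arrays of real numbers `r…`. -/

notation "nDup" => 10
notation "nRank" => 11
notation "nPid" => 12
notation "nIsW" => 13
notation "nRow" => 14
notation "nNext" => 15
notation "nPrev" => 16
notation "nEv" => 17
notation "nQueue" => 18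
notation "nDead" => 19
notation "vSize" => 20
notation "vNum" => 21
notation "vI" => 22
notation "vJ" => 23
notation "vR" => 24
notation "vK" => 25
notation "vP" => 26
notation "vCur" => 27
notation "vCnt" => 28
notation "vUp" => 29
notation "vQ" => 30
notation "vA" => 31
notation "vC" => 32
notation "vM" => 33
notation "vT" => 34
notation "vLo" => 35
notation "vHi" => 36
notation "vB" => 37
notation "rZX" => 4
notation "rZY" => 5
notation "rX" => 6
notation "rY" => 7
notation "rEX" => 8
notation "rEY" => 9

namespace RealRAM

/-- The constant `1`. -/
abbrev NExpr.one : NExpr := .const 1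

/-- The constant `0`. -/
abbrev NExpr.zero : NExpr := .const 0

open NExpr Prog

/-- The array `a` represents the matrix `g` with indices at most `N`. -/
def Rep (N : ℕ) (g : ℕ → ℕ → ℕ) (a : ℕ → ℕ) : Prop :=
  ∀ i j, i ≤ N → j ≤ N → a (i * (N + 1) + j) = g i j

theorem index_inj {N i j i' j' : ℕ} (hj : j ≤ N) (hj' : j' ≤ N)
    (h : i * (N + 1) + j = i' * (N + 1) + j') : i = i' ∧ j = j' := by
  have h1 : (i * (N + 1) + j) / (N + 1) = i := by
    rw [Nat.mul_comm, Nat.mul_add_div (by omega), Nat.div_eq_of_lt (by omega), Nat.add_zero]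
  have h2 : (i' * (N + 1) + j') / (N + 1) = i' := by
    rw [Nat.mul_comm, Nat.mul_add_div (by omega), Nat.div_eq_of_lt (by omega), Nat.add_zero]
  have h3 : i = i' := by rw [← h1, ← h2, h]
  subst h3
  exact ⟨rfl, by omega⟩

theorem Rep.link {N : ℕ} {g : ℕ → ℕ → ℕ} {a : ℕ → ℕ} (h : Rep N g a) {i p v q : ℕ}
    (hp : p ≤ N) (hv : v ≤ N) :
    Rep N (Lines.link g i p v q)
      (Function.update (Function.update a (i * (N + 1) + p) v) (i * (N + 1) + v) q) := by
  intro i' j' hi' hj'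
  simp only [Lines.link, Function.update_apply]
  by_cases hii : i' = i
  · subst hii
    simp [Function.update_apply, h i' j' hi' hj']
  · have h1 : ∀ z, z ≤ N → i' * (N + 1) + j' ≠ i * (N + 1) + z := fun z hz e =>
      hii (index_inj hj' hz e).1
    rw [if_neg (h1 _ hv), if_neg (h1 _ hp), if_neg hii]
    exact h i' j' hi' hj'

/-- Compute the next row address. -/
def rowsBody : Prog :=
  .nset nRow (.add (var vI) one) (.add (.get nRow (var vI)) (.add (var vNum) one))

/-- Set `row[i] := i * (N + 1)`. -/
def rowsProg : Prog := .forLoop vI zero (.add (var vNum) one) rowsBody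

theorem rowsProg_runs : ∃ C, ∀ (s : State) (N : ℕ), s.nat vNum 0 = N → s.nat nRow 0 = 0 →
    Runs rowsProg s (C * (N + 1)) (fun s' => ∀ i ≤ N, s'.nat nRow i = i * (N + 1)) := by
  refine ⟨100, fun s N hN h0 => ?_⟩
  refine (Runs.for_rule (fun i s' => s'.nat vNum 0 = N ∧ ∀ j ≤ i, s'.nat nRow j = j * (N + 1))
    rowsBody.maxCost 0 (N + 1) rfl (by omega) (by simp [rowsBody, natWrites]) ?_ ?_ ?_).mono ?_ ?_
  · rintro i s' ⟨h1, -⟩ -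
    simp [NExpr.eval, h1]
  · simp [hN, h0]
  · rintro i s' - hi ⟨h1, h2⟩ h3
    refine Runs.straight (c := rowsBody) trivial ?_
    refine ⟨by simp [rowsBody, denote, h1], fun j hj => ?_⟩
    simp only [rowsBody, denote, NExpr.eval, h3, h1, State.setNat_nat, Nat.reduceEqDiff, if_true, if_false,
      Function.update_apply]
    split_ifs with h
    · rw [h2 i le_rfl, h]; ring
    · exact h2 j (by omega)
  · simp [NExpr.cost, rowsBody, maxCost]; omega
  · rintro s' ⟨⟨-, h⟩, -⟩ i hi
    exact h i (by omega)

/-- Orientation determinant of the points with the given indices. -/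
def orientE (i j k : NExpr) : RExpr :=
  .sub (.mul (.sub (.get rX j) (.get rX i)) (.sub (.get rY k) (.get rY i)))
    (.mul (.sub (.get rY j) (.get rY i)) (.sub (.get rX k) (.get rX i)))

/-- Orientation determinant. -/
def orient (x y : ℕ → ℝ) (i j k : ℕ) : ℝ :=
  (x j - x i) * (y k - y i) - (y j - y i) * (x k - x i)

def cell (i j : NExpr) : NExpr := .add (.get nRow i) j

def stepUp : Prog :=
  .seq (.assign vQ (.get nNext (cell (var vK) (var vP))))
    (.ite (.nlt zero (var vQ))
      (.seq (.ite (.nlt (var vQ) (var vK)) (.assign vUp zero) .skip)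
        (.seq (.assign vP (var vK)) (.assign vK (var vQ))))
      (.seq (.assign vK (.add (var vK) one)) (.seq (.assign vP zero) (.assign vUp zero))))

def linkProg (a : ℕ) (i p v q : NExpr) : Prog :=
  .seq (.nset a (cell i p) v) (.nset a (cell i v) q)

def stepCross : Prog :=
  .seq (linkProg nNext (var vK) (var vQ) (var vR) (var vP))
    (.seq (linkProg nPrev (var vK) (var vP) (var vR) (var vQ))
    (.seq (linkProg nNext (var vR) (var vCur) (var vK) zero)
    (.seq (linkProg nPrev (var vR) zero (var vK) (var vCur))
    (.seq (.assign vCur (var vK))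
    (.seq (.assign vP (var vR))
    (.seq (.assign vCnt (.add (var vCnt) one)) (.assign vUp one)))))))

def stepDown : Prog :=
  .seq (.assign vQ (.get nPrev (cell (var vK) (var vP))))
    (.ite (.and (.nlt (var vK) (var vQ)) (.rlt (orientE (var vK) (var vQ) (var vR)) (.const 0)))
      (.seq (.assign vP (var vK)) (.assign vK (var vQ)))
      stepCross)

/-- One step of the walk. -/
def stepProg : Prog := .ite (.nlt zero (var vUp)) stepUp stepDown

/-- The state represents the configuration `c`. -/
structure Holds (N : ℕ) (x y : ℕ → ℝ) (r : ℕ) (c : Lines.Conf) (s : State) : Prop where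
  nx : Rep N c.nx (s.nat nNext)
  pv : Rep N c.pv (s.nat nPrev)
  k : s.nat vK 0 = c.k
  p : s.nat vP 0 = c.p
  cur : s.nat vCur 0 = c.cur
  cnt : s.nat vCnt 0 = c.cnt
  up : s.nat vUp 0 = c.up
  r : s.nat vR 0 = r
  num : s.nat vNum 0 = N
  row : ∀ i ≤ N, s.nat nRow i = i * (N + 1)
  x : s.real rX = x
  y : s.real rY = y

theorem Holds.step {N : ℕ} {x y : ℕ → ℝ} {r : ℕ} {c : Lines.Conf} {s : State}
    (h : Holds N x y r c s) (hr : r ≤ N) (hk : c.k ≤ r) (hp : c.p ≤ r) (hcur : c.cur ≤ r)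
    (hq : c.up = 0 → c.pv c.k c.p ≤ r) :
    Holds N x y r (c.step (fun k q => orient x y k q r < 0) r) (stepProg.denote s) := by
  have hn := h.nx c.k c.p (by omega) (by omega)
  have hv := h.pv c.k c.p (by omega) (by omega)
  have hrk := h.row c.k (by omega)
  have hrr := h.row r (by omega)
  by_cases hup : 0 < c.up
  · by_cases hq : 0 < c.nx c.k c.p
    · by_cases hlt : c.nx c.k c.p < c.k
      · have e : c.step (fun k q => orient x y k q r < 0) r =
            { c with up := 0, p := c.k, k := c.nx c.k c.p } := by
          simp [Lines.Conf.step, hup, hq, hlt]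
        rw [e]
        constructor <;> simp [stepProg, stepUp, cell, denote, NExpr.eval, BExpr.eval, h.nx, h.pv,
          h.k, h.p, h.cur, h.cnt, h.up, h.r, h.num, h.x, h.y, hup, hn, hrk, hq, hlt]
        exact h.row
      · have e : c.step (fun k q => orient x y k q r < 0) r =
            { c with p := c.k, k := c.nx c.k c.p } := by
          simp [Lines.Conf.step, hup, hq, hlt]
        rw [e]
        constructor <;> simp [stepProg, stepUp, cell, denote, NExpr.eval, BExpr.eval, h.nx, h.pv,
          h.k, h.p, h.cur, h.cnt, h.up, h.r, h.num, h.x, h.y, hup, hn, hrk, hq, hlt]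
        exact h.row
    · have e : c.step (fun k q => orient x y k q r < 0) r =
          { c with k := c.k + 1, p := 0, up := 0 } := by
        simp [Lines.Conf.step, hup, hq]
      rw [e]
      constructor <;> simp [stepProg, stepUp, cell, denote, NExpr.eval, BExpr.eval, h.nx, h.pv,
        h.k, h.p, h.cur, h.cnt, h.up, h.r, h.num, h.x, h.y, hup, hn, hrk, hq]
      exact h.row
  · have hq := hq (by omega)
    by_cases ht : c.k < c.pv c.k c.p ∧ orient x y c.k (c.pv c.k c.p) r < 0
    · have e : c.step (fun k q => orient x y k q r < 0) r =
          { c with p := c.k, k := c.pv c.k c.p } := by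
        simp only [Lines.Conf.step, if_neg hup, if_pos ht]
      rw [e]
      have ht1 := ht.1
      have ht2 := ht.2
      simp only [orient] at ht2
      constructor <;> simp [stepProg, stepDown, cell, orientE, denote, NExpr.eval, RExpr.eval,
        BExpr.eval, h.nx, h.pv, h.k, h.p, h.cur, h.cnt, h.up, h.r, h.num, h.x, h.y, hup, hv, hrk,
        ht1, ht2, -sub_neg]
      exact h.row
    · have e : c.step (fun k q => orient x y k q r < 0) r =
          { nx := Lines.link (Lines.link c.nx c.k (c.pv c.k c.p) r c.p) r c.cur c.k 0
            pv := Lines.link (Lines.link c.pv c.k c.p r (c.pv c.k c.p)) r 0 c.k c.cur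
            k := c.k, p := r, cur := c.k, cnt := c.cnt + 1, up := 1 } := by
        rw [Lines.Conf.step, if_neg hup, if_neg ht]
      rw [e]
      simp only [orient] at ht
      have hnx := (h.nx.link (i := c.k) (p := c.pv c.k c.p) (v := r) (q := c.p)
        (by omega) hr).link (i := r) (p := c.cur) (v := c.k) (q := 0) (by omega) (by omega)
      have hpv := (h.pv.link (i := c.k) (p := c.p) (v := r) (q := c.pv c.k c.p)
        (by omega) hr).link (i := r) (p := 0) (v := c.k) (q := c.cur) (by omega) (by omega)
      constructor <;> simp [stepProg, stepDown, stepCross, linkProg, cell, orientE, denote,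
        NExpr.eval, RExpr.eval, BExpr.eval, h.k, h.p, h.cur, h.cnt, h.up, h.r, h.num,
        h.x, h.y, hup, hv, hrk, hrr, ht, -sub_neg, -not_and]
      · exact hnx
      · simpa using hpv
      · exact h.row

end RealRAM

namespace RealRAM

open NExpr Prog

def insertInit : Prog :=
  .seq (.assign vK zero) (.seq (.assign vP zero) (.seq (.assign vCur zero)
    (.seq (.assign vCnt zero) (.assign vUp one))))

/-- Insert line `r` into the arrangement. -/
def insertProg : Prog :=
  .seq insertInit (.while (.nlt (.add (var vCnt) one) (var vR)) stepProg)

/-- Build the arrangement. -/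
def arrangeProg : Prog := .forLoop vR one (.add (var vNum) one) insertProg

/-- The state represents the arrangement of the lines `1, …, r`. -/
structure Arranged {N : ℕ} (A : Lines N) (x y : ℕ → ℝ) (r : ℕ) (s : State) : Prop where
  num : s.nat vNum 0 = N
  row : ∀ i ≤ N, s.nat nRow i = i * (N + 1)
  x : s.real rX = x
  y : s.real rY = y
  built : ∃ nx pv, Rep N nx (s.nat nNext) ∧ Rep N pv (s.nat nPrev) ∧ A.Built r nx pv

theorem insertProg_runs : ∃ C, ∀ (N : ℕ) (A : Lines N) (x y : ℕ → ℝ) (r : ℕ) (s : State),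
    (∀ k q r, 1 ≤ k → k < q → q < r → r ≤ N → (orient x y k q r < 0 ↔ A.X r k < A.X k q)) →
    r + 1 ≤ N → Arranged A x y r s → s.nat vR 0 = r + 1 →
    Runs insertProg s (C * (N + 1)) (Arranged A x y (r + 1)) := by
  refine ⟨insertInit.maxCost + 6 * (8 + stepProg.maxCost), fun N A x y r s horient hrN h hR => ?_⟩
  obtain ⟨nx, pv, hnx, hpv, hb⟩ := h.built
  refine (Runs.seq (T := insertInit.maxCost)
    (T' := (4 * r + 6) * (8 + stepProg.maxCost)) ?_).mono ?_ (fun _ h => h)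
  · refine Runs.straight (by simp [insertInit, Straight]) ?_
    have h0 : Holds N x y (r + 1) ⟨nx, pv, 0, 0, 0, 0, 1⟩ (insertInit.denote s) := by
      constructor <;> simp [insertInit, denote, NExpr.eval, hnx, hpv, hR, h.num, h.x, h.y]
      exact h.row
    refine (Runs.while_rule
      (γ := Lines.Conf × Finset ℕ × Finset ℕ × Finset ℕ × ℝ)
      (fun g s' => Holds N x y (r + 1) g.1 s' ∧ A.Walk (r + 1) g.1 g.2.1 g.2.2.1 g.2.2.2.1 g.2.2.2.2)
      (fun g => Lines.stepsLeft (r + 1) g.1.up g.2.1 g.2.2.1 g.2.2.2.1) stepProg.maxCost _ ?_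
      (⟨nx, pv, 0, 0, 0, 0, 1⟩, ∅, ∅, ∅, 0) (Frame.refl _ _)
      ⟨h0, hb.start hrN⟩).mono ?_ ?_
    · rintro ⟨c, J, D, E, z⟩ s' - ⟨h1, h2⟩ hlt
      simp only [BExpr.eval, NExpr.eval, h1.cnt, h1.r] at hlt
      obtain ⟨b1, b2, b3, b4, b5⟩ := h2.bounds
      refine Runs.straight (by simp [stepProg, stepUp, stepDown, stepCross, linkProg, Straight]) ?_
      obtain ⟨J', D', E', z', w1, w2⟩ := h2.step
        (test := fun k q => orient x y k q (r + 1) < 0) hlt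
        (fun k q k1 k2 k3 => horient k q (r + 1) k1 k2 k3 hrN)
      exact ⟨⟨_, J', D', E', z'⟩, ⟨h1.step hrN b1 b2 b3 (fun e => (b5 e).2), w1⟩, w2⟩
    · simp only [Lines.stepsLeft, BExpr.cost, NExpr.cost, Finset.card_empty]
      apply Nat.mul_le_mul <;> omega
    · rintro s' ⟨⟨c, J, D, E, z⟩, ⟨h1, h2⟩, hlt, -⟩
      simp only [BExpr.eval, NExpr.eval, h1.cnt, h1.r] at hlt
      exact ⟨h1.num, h1.row, h1.x, h1.y, _, _, h1.nx, h1.pv, h2.built (by omega) hlt⟩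
  · have h1 : (4 * r + 6) * (8 + stepProg.maxCost) ≤ (6 * (N + 1)) * (8 + stepProg.maxCost) :=
      Nat.mul_le_mul_right _ (by omega)
    have h2 : insertInit.maxCost * 1 ≤ insertInit.maxCost * (N + 1) :=
      Nat.mul_le_mul_left _ (by omega)
    have h3 : (insertInit.maxCost + 6 * (8 + stepProg.maxCost)) * (N + 1) =
      insertInit.maxCost * (N + 1) + (6 * (N + 1)) * (8 + stepProg.maxCost) := by ring
    omega

theorem arrangeProg_runs : ∃ C, ∀ (N : ℕ) (A : Lines N) (x y : ℕ → ℝ) (s : State),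
    (∀ k q r, 1 ≤ k → k < q → q < r → r ≤ N → (orient x y k q r < 0 ↔ A.X r k < A.X k q)) →
    s.nat vNum 0 = N → (∀ i ≤ N, s.nat nRow i = i * (N + 1)) → s.real rX = x → s.real rY = y →
    s.nat nNext = 0 → s.nat nPrev = 0 →
    Runs arrangeProg s (C * (N + 1) ^ 2) (Arranged A x y N) := by
  obtain ⟨C, hC⟩ := insertProg_runs
  refine ⟨C + 40, fun N A x y s horient h1 h2 h3 h4 h5 h6 => ?_⟩
  refine (Runs.for_rule (fun i s' => Arranged A x y (i - 1) s')
    (C * (N + 1)) 1 (N + 1) rfl (by omega) (by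
      simp [insertProg, insertInit, stepProg, stepUp, stepDown, stepCross, linkProg, natWrites])
    ?_ ?_ ?_).mono ?_ ?_
  · rintro i s' h -
    simp [NExpr.eval, h.num]
  · refine ⟨by simp [h1], by simpa using h2, by simp [h3], by simp [h4], 0, 0, ?_, ?_, ?_⟩
    · intro i j _ _; simp [h5]
    · intro i j _ _; simp [h6]
    · exact ⟨by omega, rfl, fun i _ => ⟨rfl, rfl⟩⟩
  · intro i s' i1 i2 h hi
    obtain ⟨r, rfl⟩ : ∃ r, i = r + 1 := ⟨i - 1, by omega⟩
    refine (hC N A x y r s' horient (by omega) (by simpa using h) hi).mono le_rfl ?_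
    intro s'' h
    obtain ⟨nx, pv, a1, a2, a3⟩ := h.built
    exact ⟨by simp [h.num], by simpa using h.row, by simp [h.x], by simp [h.y], nx, pv, by simpa,
      by simpa, by simpa using a3⟩
  · simp only [NExpr.cost]
    have : (C + 40) * (N + 1) ^ 2 =
        (N + 1) * (C * (N + 1)) + 40 * ((N + 1) * N) + 40 * (N + 1) := by ring
    have h2 : (N + 1 - 1 + 1) * (1 + 1 + 1 + 1 + 4 + (C * (N + 1) + 6)) =
      (N + 1) * (C * (N + 1)) + 14 * (N + 1) := by
      rw [Nat.add_sub_cancel]; ring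
    omega
  · rintro s' ⟨h, -⟩
    simpa using h

end RealRAM

namespace RealRAM

open NExpr Prog

theorem Prog.denote_seq (c d : Prog) (s : State) : (seq c d).denote s = d.denote (c.denote s) := rfl

theorem Prog.denote_ite_pos {b : BExpr} {c d : Prog} {s : State} (h : b.eval s) :
    (ite b c d).denote s = c.denote s := if_pos h

theorem Prog.denote_ite_neg {b : BExpr} {c d : Prog} {s : State} (h : ¬ b.eval s) :
    (ite b c d).denote s = d.denote s := if_neg h

def dotE (i j : NExpr) : RExpr :=
  .add (.mul (.get rEX i) (.get rEX j)) (.mul (.get rEY i) (.get rEY j))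

def crossE (i j : NExpr) : RExpr :=
  .sub (.mul (.get rEX i) (.get rEY j)) (.mul (.get rEY i) (.get rEX j))

def uselessE (x y z : NExpr) : BExpr :=
  .not (.rlt (.mul (crossE x z) (dotE y y))
    (.add (.mul (crossE y z) (dotE x x)) (.mul (crossE x y) (dotE z z))))

def queueE (i : NExpr) : NExpr := .get nQueue i

def eventW : BExpr := .nlt zero (.get nIsW (.get nEv (var vT)))

def expiredE : BExpr :=
  .and (.nlt (var vLo) (var vHi)) (.not (.rlt (.const 0) (dotE (var vT) (queueE (var vLo)))))

def worseE : BExpr :=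
  .and (.nlt (.add (var vLo) one) (var vHi))
    (.not (.rlt
      (.mul (dotE (var vT) (queueE (.add (var vLo) one)))
        (dotE (queueE (var vLo)) (queueE (var vLo))))
      (.mul (dotE (var vT) (queueE (var vLo)))
        (dotE (queueE (.add (var vLo) one)) (queueE (.add (var vLo) one))))))

def backE : BExpr :=
  .and eventW (.and (.nlt (.add (var vLo) one) (var vHi))
    (uselessE (queueE (.sub (var vHi) (.const 2))) (queueE (.sub (var vHi) one)) (var vT)))

def killE : BExpr :=
  .and (.nlt (var vLo) (var vHi))
    (.not (.rlt (dotE (var vT) (queueE (var vLo))) (dotE (queueE (var vLo)) (queueE (var vLo)))))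

/-- Mark the current vector if it is killed, insert it into the queue if it is a witness, and pass
to the next vector. -/
def finishEvent : Prog :=
  .seq (.ite killE (.nset nDead (.get nEv (var vT)) one) .skip)
    (.seq (.ite eventW
      (.seq (.nset nQueue (var vHi) (var vT)) (.assign vHi (.add (var vHi) one))) .skip)
      (.assign vT (.add (var vT) one)))

/-- One step of the sweep. -/
def sweepStep : Prog :=
  .ite expiredE (.assign vLo (.add (var vLo) one))
    (.ite worseE (.assign vLo (.add (var vLo) one))
      (.ite backE (.assign vHi (.sub (var vHi) one)) finishEvent))

def sweepInit : Prog :=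
  .seq (.assign vT zero) (.seq (.assign vLo zero) (.assign vHi zero))

/-- Mark the vectors that are killed by an earlier witness. -/
def sweepProg : Prog := .seq sweepInit (.while (.nlt (var vT) (var vM)) sweepStep)

/-- The state of the sweep. -/
structure Sweeping (ex ey : ℕ → ℝ) (m : ℕ) (ev w dead : ℕ → ℕ) (lo hi t : ℕ) (s : State) :
    Prop where
  ex_eq : s.real rEX = ex
  ey_eq : s.real rEY = ey
  m_eq : s.nat vM 0 = m
  ev_eq : s.nat nEv = ev
  w_eq : s.nat nIsW = w
  lo_eq : s.nat vLo 0 = lo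
  hi_eq : s.nat vHi 0 = hi
  t_eq : s.nat vT 0 = t
  t_le : t ≤ m
  queue : Sweep.Queue ex ey m (fun i => 0 < w (ev i)) (s.nat nQueue) lo hi t
  dead : ∀ j, 0 < s.nat nDead j ↔ 0 < dead j ∨
    ∃ t', t' < t ∧ ev t' = j ∧ ∃ i, i < t' ∧ 0 < w (ev i) ∧ Sweep.Kills ex ey i t'

theorem Sweeping.step {ex ey : ℕ → ℝ} {m : ℕ} {ev w dead : ℕ → ℕ} {lo hi t : ℕ} {s : State}
    (hs : Sweep ex ey m) (h : Sweeping ex ey m ev w dead lo hi t s) (ht : t < m) :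
    ∃ lo' hi' t', Sweeping ex ey m ev w dead lo' hi' t' (sweepStep.denote s) ∧
      2 * (m - t') + (hi' - lo') < 2 * (m - t) + (hi - lo) := by
  have hq := h.queue
  have e1 : expiredE.eval s ↔
      lo < hi ∧ ¬ 0 < ex t * ex (s.nat nQueue lo) + ey t * ey (s.nat nQueue lo) := by
    simp only [expiredE, queueE, dotE, BExpr.eval, NExpr.eval, RExpr.eval, h.lo_eq, h.hi_eq,
        h.t_eq, h.ex_eq,
      h.ey_eq, Nat.cast_zero]
  have e2 : worseE.eval s ↔ lo + 1 < hi ∧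
      ¬ (ex t * ex (s.nat nQueue (lo + 1)) + ey t * ey (s.nat nQueue (lo + 1))) *
        (ex (s.nat nQueue lo) * ex (s.nat nQueue lo) +
          ey (s.nat nQueue lo) * ey (s.nat nQueue lo)) <
      (ex t * ex (s.nat nQueue lo) + ey t * ey (s.nat nQueue lo)) *
        (ex (s.nat nQueue (lo + 1)) * ex (s.nat nQueue (lo + 1)) +
          ey (s.nat nQueue (lo + 1)) * ey (s.nat nQueue (lo + 1))) := by
    simp only [worseE, queueE, dotE, BExpr.eval, NExpr.eval, RExpr.eval, h.lo_eq, h.hi_eq, h.t_eq,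
        h.ex_eq,
      h.ey_eq]
  have e3 : backE.eval s ↔ 0 < w (ev t) ∧ lo + 1 < hi ∧
      Sweep.Useless ex ey (s.nat nQueue (hi - 2)) (s.nat nQueue (hi - 1)) t := by
    simp only [backE, eventW, uselessE, crossE, queueE, dotE, BExpr.eval, NExpr.eval, RExpr.eval,
      h.lo_eq, h.hi_eq, h.t_eq, h.ex_eq, h.ey_eq, h.w_eq, h.ev_eq, Sweep.Useless, not_lt]
  have e4 : killE.eval s ↔ lo < hi ∧ Sweep.Kills ex ey (s.nat nQueue lo) t := by
    simp only [killE, queueE, dotE, BExpr.eval, NExpr.eval, RExpr.eval, h.lo_eq, h.hi_eq, h.t_eq,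
        h.ex_eq,
      h.ey_eq, Sweep.Kills, not_lt]
  have e5 : eventW.eval s ↔ 0 < w (ev t) := by
    simp only [eventW, BExpr.eval, NExpr.eval, h.w_eq, h.ev_eq, h.t_eq]
  by_cases c1 : expiredE.eval s
  · obtain ⟨d1, d2⟩ := e1.1 c1
    refine ⟨lo + 1, hi, t, ?_, by omega⟩
    rw [sweepStep, denote_ite_pos c1]
    constructor <;> try simp [denote, NExpr.eval, h.ex_eq, h.ey_eq, h.m_eq, h.ev_eq, h.w_eq,
        h.lo_eq, h.hi_eq, h.t_eq, h.dead]
    · exact h.t_le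
    · exact hq.expire hs d1 d2
  have f1 : lo < hi → 0 < ex t * ex (s.nat nQueue lo) + ey t * ey (s.nat nQueue lo) := by
    intro hlt; by_contra hn; exact c1 (e1.2 ⟨hlt, hn⟩)
  by_cases c2 : worseE.eval s
  · obtain ⟨d1, d2⟩ := e2.1 c2
    refine ⟨lo + 1, hi, t, ?_, by omega⟩
    rw [sweepStep, denote_ite_neg c1, denote_ite_pos c2]
    constructor <;> try simp [denote, NExpr.eval, h.ex_eq, h.ey_eq, h.m_eq, h.ev_eq, h.w_eq,
        h.lo_eq, h.hi_eq, h.t_eq, h.dead]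
    · exact h.t_le
    · exact hq.advance hs ht d1 (f1 (by omega)) d2
  have f2 := fun hlt : lo + 1 < hi => not_not.1 fun hn => c2 (e2.2 ⟨hlt, hn⟩)
  by_cases c3 : backE.eval s
  · obtain ⟨d1, d2, d3⟩ := e3.1 c3
    refine ⟨lo, hi - 1, t, ?_, by omega⟩
    rw [sweepStep, denote_ite_neg c1, denote_ite_neg c2, denote_ite_pos c3]
    constructor <;> try simp [denote, NExpr.eval, h.ex_eq, h.ey_eq, h.m_eq, h.ev_eq, h.w_eq,
        h.lo_eq, h.hi_eq, h.t_eq, h.dead]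
    · exact h.t_le
    · exact hq.popBack hs ht d1 d2 (f1 (by omega)) d3
  rw [e3] at c3
  have f4 := hq.exists_kills_iff hs ht f1 f2
  rw [← e4] at f4
  have hden : sweepStep.denote s = finishEvent.denote s := by
    rw [sweepStep, denote_ite_neg c1, denote_ite_neg c2, denote_ite_neg (by rwa [e3])]
  rw [hden]
  set s1 : State := (Prog.ite killE (.nset nDead (.get nEv (var vT)) one) .skip).denote s with hs1
  have g1 : s1.real = s.real := by
    rw [hs1, denote]; split_ifs <;> simp [denote]
  have g2 : ∀ b, b ≠ nDead → s1.nat b = s.nat b := by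
    intro b hb
    rw [hs1, denote]; split_ifs <;> simp [denote, hb]
  have g3 : ∀ j, 0 < s1.nat nDead j ↔ 0 < dead j ∨
      ∃ t', t' < t + 1 ∧ ev t' = j ∧ ∃ i, i < t' ∧ 0 < w (ev i) ∧ Sweep.Kills ex ey i t' := by
    intro j
    have : 0 < s1.nat nDead j ↔ 0 < s.nat nDead j ∨ (j = ev t ∧ killE.eval s) := by
      rw [hs1, denote]
      split_ifs with hk
      · simp only [denote, NExpr.eval, h.ev_eq, h.t_eq, State.setNat_nat, if_true,
          Function.update_apply, hk, and_true]
        split_ifs with hj <;> simp [hj]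
      · simp [denote, hk]
    rw [this, h.dead, or_assoc, f4]
    refine or_congr_right ?_
    constructor
    · rintro (⟨t', h1, h2⟩ | ⟨h1, h2⟩)
      · exact ⟨t', by omega, h2⟩
      · exact ⟨t, by omega, h1.symm, h2⟩
    · rintro ⟨t', h1, h2, h3⟩
      rcases (Nat.le_of_lt_succ h1).eq_or_lt with rfl | h1
      · exact Or.inr ⟨h2.symm, h3⟩
      · exact Or.inl ⟨t', h1, h2, h3⟩
  have e6 : eventW.eval s1 ↔ 0 < w (ev t) := by
    rw [← e5]; simp [eventW, BExpr.eval, NExpr.eval, g2]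
  by_cases c5 : 0 < w (ev t)
  · refine ⟨lo, hi + 1, t + 1, ?_, by have := hq.le; omega⟩
    rw [finishEvent, denote_seq, ← hs1, denote_seq, denote_ite_pos (e6.2 c5)]
    constructor <;> try simp [denote, NExpr.eval, h.ex_eq, h.ey_eq, h.m_eq, h.ev_eq, h.w_eq,
        h.lo_eq, h.hi_eq, h.t_eq, g1, g2,
      g3]
    · exact ht
    · exact hq.push c5 (fun hlt hu => c3 ⟨c5, hlt, hu⟩)
  · refine ⟨lo, hi, t + 1, ?_, by omega⟩
    rw [finishEvent, denote_seq, ← hs1, denote_seq, denote_ite_neg (by rwa [e6])]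
    constructor <;> try simp [denote, NExpr.eval, h.ex_eq, h.ey_eq, h.m_eq, h.ev_eq, h.w_eq,
        h.lo_eq, h.hi_eq, h.t_eq, g1, g2,
      g3]
    · exact ht
    · exact hq.skip c5

theorem sweepProg_runs : ∃ C, ∀ (ex ey : ℕ → ℝ) (m : ℕ) (s : State), Sweep ex ey m →
    s.real rEX = ex → s.real rEY = ey → s.nat vM 0 = m →
    Runs sweepProg s (C * (m + 1)) (fun s' => ∀ j, 0 < s'.nat nDead j ↔ 0 < s.nat nDead j ∨
      ∃ t, t < m ∧ s.nat nEv t = j ∧ ∃ i, i < t ∧ 0 < s.nat nIsW (s.nat nEv i) ∧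
        Sweep.Kills ex ey i t) := by
  refine ⟨sweepInit.maxCost + 2 * (6 + sweepStep.maxCost), fun ex ey m s hs h1 h2 h3 => ?_⟩
  refine (Runs.seq (T := sweepInit.maxCost)
    (T' := (2 * m + 1) * (6 + sweepStep.maxCost)) ?_).mono ?_ (fun _ h => h)
  · refine Runs.straight (by simp [sweepInit, Straight]) ?_
    have h0 : Sweeping ex ey m (s.nat nEv) (s.nat nIsW) (s.nat nDead) 0 0 0
        (sweepInit.denote s) := by
      constructor <;> simp [sweepInit, denote, NExpr.eval, h1, h2, h3]
      exact Sweep.Queue.start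
    refine (Runs.while_rule (γ := ℕ × ℕ × ℕ)
      (fun g s' => Sweeping ex ey m (s.nat nEv) (s.nat nIsW) (s.nat nDead) g.1 g.2.1 g.2.2 s')
      (fun g => 2 * (m - g.2.2) + (g.2.1 - g.1)) sweepStep.maxCost _ ?_
      (0, 0, 0) (Frame.refl _ _) h0).mono ?_ ?_
    · rintro ⟨lo, hi, t⟩ s' - h hlt
      simp only [BExpr.eval, NExpr.eval, h.t_eq, h.m_eq] at hlt
      obtain ⟨lo', hi', t', w1, w2⟩ := h.step hs hlt
      refine Runs.straight (by simp [sweepStep, finishEvent, Straight]) ?_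
      exact ⟨(lo', hi', t'), w1, w2⟩
    · simp [BExpr.cost, NExpr.cost]
    · rintro s' ⟨⟨lo, hi, t⟩, h, hlt, -⟩ j
      simp only [BExpr.eval, NExpr.eval, h.t_eq, h.m_eq] at hlt
      obtain rfl : t = m := le_antisymm h.t_le (by omega)
      exact h.dead j
  · have h1 : (2 * m + 1) * (6 + sweepStep.maxCost) ≤ (2 * (m + 1)) * (6 + sweepStep.maxCost) :=
      Nat.mul_le_mul_right _ (by omega)
    have h2 : sweepInit.maxCost * 1 ≤ sweepInit.maxCost * (m + 1) :=
      Nat.mul_le_mul_left _ (by omega)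
    have h3 : (sweepInit.maxCost + 2 * (6 + sweepStep.maxCost)) * (m + 1) =
      sweepInit.maxCost * (m + 1) + (2 * (m + 1)) * (6 + sweepStep.maxCost) := by ring
    omega

end RealRAM

namespace Sweep

open Classical in
/-- The indices of the vectors in the order of the sweep: first those before `a` below the axis,
then those after `a`. -/
noncomputable def events (a : ℕ) (vy : ℕ → ℝ) (L : List ℕ) : List ℕ :=
  L.filter (fun j => j < a ∧ vy j < 0) ++ L.filter (fun j => a < j)

/-- The vectors from point `a` to the other points, in the order of the slopes. -/
structure Star (a : ℕ) (vx vy : ℕ → ℝ) (L : List ℕ) : Prop where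
  sorted : L.Pairwise fun j k => ((a < j ∧ a < k) ∨ (j < a ∧ k < a)) →
    0 < vx j * vy k - vy j * vx k
  right : ∀ j ∈ L, a < j → 0 ≤ vx j ∧ (vx j ≠ 0 ∨ vy j ≠ 0)
  left : ∀ j ∈ L, j < a → vx j ≤ 0
  mixed : ∀ w ∈ L, ∀ j ∈ L, w < a → vy w < 0 → a < j → vx w < 0 ∨ 0 < vx j ∨ 0 < vy j

variable {a : ℕ} {vx vy ex ey : ℕ → ℝ} {L : List ℕ}

theorem Star.events_pairwise (h : Star a vx vy L) :
    (events a vy L).Pairwise fun j k => ((j < a ∧ vy j < 0) ∧ a < k) ∨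
      (((j < a ∧ vy j < 0) ∧ (k < a ∧ vy k < 0)) ∧ 0 < vx j * vy k - vy j * vx k) ∨
      ((a < j ∧ a < k) ∧ 0 < vx j * vy k - vy j * vx k) := by
  classical
  rw [events, List.pairwise_append]
  refine ⟨?_, ?_, ?_⟩
  · rw [List.pairwise_filter]
    refine h.sorted.imp ?_
    intro j k hjk hj hk
    simp only [decide_eq_true_eq] at hj hk
    exact Or.inr (Or.inl ⟨⟨hj, hk⟩, hjk (Or.inr ⟨hj.1, hk.1⟩)⟩)
  · rw [List.pairwise_filter]
    refine h.sorted.imp ?_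
    intro j k hjk hj hk
    simp only [decide_eq_true_eq] at hj hk
    exact Or.inr (Or.inr ⟨⟨hj, hk⟩, hjk (Or.inl ⟨hj, hk⟩)⟩)
  · intro j hj k hk
    simp only [List.mem_filter, decide_eq_true_eq] at hj hk
    exact Or.inl ⟨hj.2, hk.2⟩

theorem mem_events {j : ℕ} :
    j ∈ events a vy L ↔ j ∈ L ∧ ((j < a ∧ vy j < 0) ∨ a < j) := by
  simp only [events, List.mem_append, List.mem_filter, decide_eq_true_eq]
  tauto

theorem Star.sweep (h : Star a vx vy L)
    (he : ∀ t (ht : t < (events a vy L).length),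
      ex t = vx (events a vy L)[t] ∧ ey t = vy (events a vy L)[t]) :
    Sweep ex ey (events a vy L).length := by
  have hp := List.pairwise_iff_getElem.1 h.events_pairwise
  have hm : ∀ t (ht : t < (events a vy L).length), (events a vy L)[t] ∈ L ∧
      (((events a vy L)[t] < a ∧ vy (events a vy L)[t] < 0) ∨ a < (events a vy L)[t]) :=
    fun t ht => mem_events.1 (List.getElem_mem ht)
  have hp2 := fun (s t : ℕ) (hst : s < t) (ht : t < (events a vy L).length) =>
    hp s t (hst.trans ht) ht hst
  have hneg : ∀ p q x y : ℝ, p ≤ 0 → q < 0 → 0 ≤ x → 0 < x * p + y * q → y < 0 := by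
    intro p q x y h1 h2 h3 h4
    by_contra hy
    nlinarith [mul_nonneg h3 (neg_nonneg.2 h1), mul_nonneg (not_lt.1 hy) (neg_nonneg.2 h2.le)]
  refine ⟨?_, ?_, ?_⟩
  · intro s t t' hst htt ht' hd
    have e1 := he s (by omega)
    have e2 := he t (by omega)
    have e3 := he t' ht'
    have p1 := hp2 s t hst (by omega)
    have p2 := hp2 t t' htt ht'
    have p3 := hp2 s t' (hst.trans htt) ht'
    have m1 := hm s (by omega)
    have m2 := hm t (by omega)
    have m3 := hm t' ht'
    rw [e1.1, e1.2, e2.1, e2.2] at hd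
    rw [e1.1, e1.2, e3.1, e3.2]
    generalize (events a vy L)[s] = u at *
    generalize (events a vy L)[t] = v at *
    generalize (events a vy L)[t'] = w at *
    by_contra hn
    rw [not_le] at hn
    rcases p1 with ⟨l1, l2⟩ | ⟨⟨l1, l2⟩, -⟩ | ⟨⟨l1, l2⟩, c1⟩
    · have c2 : (a < v ∧ a < w) ∧ 0 < vx v * vy w - vy v * vx w := by
        rcases p2 with ⟨k1, k2⟩ | ⟨⟨k1, k2⟩, -⟩ | k1
        · omega
        · omega
        · exact k1
      have r1 := (h.right v m2.1 l2).1
      have r2 := (h.right w m3.1 c2.1.2).1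
      nlinarith [mul_nonneg hn.le r1, mul_nonneg (neg_nonneg.2 hd) r2,
        mul_pos (neg_pos.2 l1.2) c2.2]
    · have r1 := mul_nonneg_of_nonpos_of_nonpos (h.left v m2.1 l2.1) (h.left u m1.1 l1.1)
      have r2 := mul_pos_of_neg_of_neg l2.2 l1.2
      linarith
    · have c2 : (a < v ∧ a < w) ∧ 0 < vx v * vy w - vy v * vx w := by
        rcases p2 with ⟨k1, k2⟩ | ⟨⟨k1, k2⟩, -⟩ | k1
        · omega
        · omega
        · exact k1
      have c3 : 0 < vx u * vy w - vy u * vx w := by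
        rcases p3 with ⟨k1, k2⟩ | ⟨⟨k1, k2⟩, -⟩ | k1
        · omega
        · omega
        · exact k1.2
      have i1 : (vx v * vy w - vy v * vx w) * (vx u * vx u + vy u * vy u) =
        (vx v * vx u + vy v * vy u) * (vx u * vy w - vy u * vx w) -
        (vx u * vy v - vy u * vx v) * (vx w * vx u + vy w * vy u) := by ring
      have i2 := mul_nonneg c2.2.le
        (add_nonneg (mul_self_nonneg (vx u)) (mul_self_nonneg (vy u)))
      have i3 := mul_pos c1 hn
      have i4 := mul_nonneg (neg_nonneg.2 hd) c3.le
      linarith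
  · intro s t hst ht hd
    have e1 := he s (by omega)
    have e2 := he t ht
    have p1 := hp2 s t hst ht
    have m1 := hm s (by omega)
    have m2 := hm t ht
    rw [e1.1, e1.2, e2.1, e2.2] at hd
    rw [e1.1, e1.2, e2.1, e2.2]
    generalize (events a vy L)[s] = u at *
    generalize (events a vy L)[t] = v at *
    rcases p1 with ⟨l1, l2⟩ | ⟨-, l1⟩ | ⟨-, l1⟩
    · have r1 := (h.right v m2.1 l2).1
      have r2 := h.left u m1.1 l1.1
      have r3 := hneg _ _ _ _ r2 l1.2 r1 hd
      have r4 := mul_nonneg_of_nonpos_of_nonpos r2 r3.le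
      have r5 := mul_nonneg (neg_nonneg.2 l1.2.le) r1
      rcases h.mixed u m1.1 v m2.1 l1.1 l1.2 l2 with h6 | h6 | h6
      · linarith [mul_pos_of_neg_of_neg h6 r3]
      · linarith [mul_pos (neg_pos.2 l1.2) h6]
      · linarith
    · exact l1
    · exact l1
  · intro t ht
    have e1 := he t ht
    have m1 := hm t ht
    rw [e1.1, e1.2]
    generalize (events a vy L)[t] = u at *
    have r1 := mul_self_nonneg (vx u)
    have r2 := mul_self_nonneg (vy u)
    rcases m1.2 with l1 | l1
    · linarith [mul_pos_of_neg_of_neg l1.2 l1.2]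
    · rcases (h.right u m1.1 l1).2 with h6 | h6
      · linarith [mul_self_pos.2 h6]
      · linarith [mul_self_pos.2 h6]

/-- Which points are killed by an earlier event. -/
theorem Star.exists_kills_iff (h : Star a vx vy L) {ev : ℕ → ℕ}
    (he : ∀ t (ht : t < (events a vy L).length), ev t = (events a vy L)[t] ∧
      ex t = vx (events a vy L)[t] ∧ ey t = vy (events a vy L)[t])
    {W : ℕ → Prop} {j : ℕ} (hj : a < j) :
    (∃ t, t < (events a vy L).length ∧ ev t = j ∧ ∃ i, i < t ∧ W (ev i) ∧ Kills ex ey i t) ↔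
      j ∈ L ∧ ∃ w ∈ L, W w ∧ vx w * vx w + vy w * vy w ≤ vx j * vx w + vy j * vy w ∧
        ((w < a ∧ vy w < 0) ∨ (a < w ∧ 0 < vx w * vy j - vy w * vx j)) := by
  have hp := List.pairwise_iff_getElem.1 h.events_pairwise
  constructor
  · rintro ⟨t, ht, rfl, i, hi, hw, hk⟩
    obtain ⟨e1, e2, e3⟩ := he t ht
    obtain ⟨f1, f2, f3⟩ := he i (hi.trans ht)
    have p := hp i t (hi.trans ht) ht hi
    have m1 := mem_events.1 (List.getElem_mem (hi.trans ht))
    have m2 := mem_events.1 (List.getElem_mem ht)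
    rw [f1] at hw
    unfold Kills at hk
    rw [e2, e3, f2, f3] at hk
    rw [e1] at hj ⊢
    refine ⟨m2.1, _, m1.1, hw, hk, ?_⟩
    rcases p with ⟨l1, l2⟩ | ⟨⟨l1, l2⟩, -⟩ | ⟨⟨l1, l2⟩, l3⟩
    · exact Or.inl l1
    · omega
    · exact Or.inr ⟨l1, l3⟩
  · rintro ⟨hjL, w, hwL, hw, hk, hc⟩
    obtain ⟨t, ht, et⟩ := List.mem_iff_getElem.1 (mem_events.2 ⟨hjL, Or.inr hj⟩)
    obtain ⟨i, hi, ei⟩ := List.mem_iff_getElem.1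
      (mem_events.2 ⟨hwL, hc.imp id And.left⟩)
    obtain ⟨e1, e2, e3⟩ := he t ht
    obtain ⟨f1, f2, f3⟩ := he i hi
    rw [et] at e1 e2 e3
    rw [ei] at f1 f2 f3
    refine ⟨t, ht, e1, i, ?_, by rwa [f1], by unfold Kills; rwa [e2, e3, f2, f3]⟩
    by_contra hn
    rcases (not_lt.1 hn).eq_or_lt with rfl | hn
    · rw [et] at ei
      subst ei
      rcases hc with ⟨h1, -⟩ | ⟨-, h1⟩
      · omega
      · linarith
    · have p := hp t i ht hi hn
      rw [et, ei] at p
      rcases p with ⟨l1, l2⟩ | ⟨⟨l1, l2⟩, -⟩ | ⟨⟨l1, l2⟩, l3⟩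
      · omega
      · omega
      · rcases hc with ⟨h1, -⟩ | ⟨-, h1⟩
        · omega
        · linarith

end Sweep

namespace RealRAM

open NExpr Prog

/-- Append the current point to the list of events if `b` holds, and pass to the next point. -/
def collectStep (nx : ℕ) (b : BExpr) (yd : RExpr) : Prog :=
  .seq (.ite b
    (.seq (.nset nEv (var vM) (var vC))
      (.seq (.rset rEX (var vM) (.sub (.get rX (var vC)) (.get rX (var vA))))
        (.seq (.rset rEY (var vM) yd) (.assign vM (.add (var vM) one))))) .skip)
    (.assign vC (.get nx (cell (var vA) (var vC))))

/-- Append the points of the linked list of `A` that satisfy `b` to the list of events. -/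
def collectProg (nx : ℕ) (b : BExpr) (yd : RExpr) : Prog :=
  .seq (.assign vC (.get nx (cell (var vA) zero)))
    (.while (.nlt zero (var vC)) (collectStep nx b yd))

/-- The list of events stored in the state. -/
def Stored (vx vy : ℕ → ℝ) (E : List ℕ) (s : State) : Prop :=
  s.nat vM 0 = E.length ∧ ∀ t (ht : t < E.length), s.nat nEv t = E[t] ∧
    s.real rEX t = vx E[t] ∧ s.real rEY t = vy E[t]

/-- The current point is `a`, and the points have the coordinates `x`, `y`. -/
def Scene (a : ℕ) (x y : ℕ → ℝ) (s : State) : Prop :=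
  s.nat vA 0 = a ∧ s.real rX = x ∧ s.real rY = y

theorem Stored.append {vx vy : ℕ → ℝ} {E : List ℕ} {s s' : State} (h : Stored vx vy E s) (c : ℕ)
    (hm : s'.nat vM 0 = E.length + 1)
    (hev : s'.nat nEv = Function.update (s.nat nEv) E.length c)
    (hx : s'.real rEX = Function.update (s.real rEX) E.length (vx c))
    (hy : s'.real rEY = Function.update (s.real rEY) E.length (vy c)) :
    Stored vx vy (E ++ [c]) s' := by
  refine ⟨by simp [hm], fun t ht => ?_⟩
  rw [hev, hx, hy]
  simp only [List.length_append, List.length_singleton] at ht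
  rcases (Nat.le_of_lt_succ ht).eq_or_lt with rfl | ht
  · simp
  · simp only [Function.update_of_ne ht.ne, List.getElem_append_left ht]
    exact h.2 t ht

theorem collectProg_runs {nx : ℕ} (hnx : nx = nNext ∨ nx = nPrev) (b : BExpr) (yd : RExpr)
    {N a : ℕ} {x y vy : ℕ → ℝ} {f : ℕ → ℕ} {P : ℕ → Prop} [DecidablePred P] {L E : List ℕ}
    {s : State} (hs : Scene a x y s)
    (hb : ∀ s', Scene a x y s' → (b.eval s' ↔ P (s'.nat vC 0)))
    (hyd : ∀ s', Scene a x y s' → yd.eval s' = vy (s'.nat vC 0))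
    (hf : ∀ j ≤ N, s.nat nx (s.nat nRow a + j) = f j)
    (hL : ∀ j ∈ L, 1 ≤ j ∧ j ≤ N) (hc : (0 :: L ++ [0]).IsChain fun j k => f j = k)
    (hE : Stored (fun j => x j - x a) vy E s) :
    Runs (collectProg nx b yd) s ((L.length + 1) * ((collectStep nx b yd).maxCost + 13))
      (Stored (fun j => x j - x a) vy (E ++ L.filter fun j => P j)) := by
  have hw : nx ∉ (collectStep nx b yd).natWrites ∧ nRow ∉ (collectStep nx b yd).natWrites ∧
      vA ∉ (collectStep nx b yd).natWrites ∧ rX ∉ (collectStep nx b yd).realWrites ∧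
      rY ∉ (collectStep nx b yd).realWrites := by
    rcases hnx with rfl | rfl <;> simp [collectStep, natWrites, realWrites]
  have hhead : ∀ (j : ℕ) (l : List ℕ), (j :: l ++ [0]).IsChain (fun j k => f j = k) →
      f j = l.headD 0 := by
    intro j l h
    cases l with
    | nil => simpa using h
    | cons k l => simp only [List.cons_append, List.isChain_cons_cons] at h; exact h.1
  refine (Runs.seq (T := 8)
    (T' := (L.length + 1) * (5 + (collectStep nx b yd).maxCost)) ?_).mono ?_ (fun _ h => h)
  · refine (Runs.straight (c := .assign vC (.get nx (cell (var vA) zero))) trivial ?_).mono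
      (by simp [maxCost, NExpr.cost, cell]) (fun _ h => h)
    set s0 := (Prog.assign vC (.get nx (cell (var vA) zero))).denote s with hs0
    have q1 : ∀ c, c ≠ vC → s0.nat c = s.nat c := fun c hc => by simp [hs0, denote, hc]
    have q2 : s0.real = s.real := rfl
    have q3 : s0.nat vC 0 = L.headD 0 := by
      rw [← hhead 0 L hc, ← hf 0 (Nat.zero_le _), ← hs.1]
      simp [hs0, denote, NExpr.eval, cell]
    have q4 : Scene a x y s0 := by
      refine ⟨by rw [q1 _ (by decide)]; exact hs.1, hs.2⟩
    have q5 : Stored (fun j => x j - x a) vy E s0 := by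
      rw [Stored, q1 _ (by decide), q1 _ (by decide), q2]; exact hE
    have q6 : ∀ j ≤ N, s0.nat nx (s0.nat nRow a + j) = f j := by
      rw [q1 nRow (by decide), q1 nx (by rcases hnx with rfl | rfl <;> decide)]; exact hf
    refine (Runs.while_rule (γ := List ℕ × List ℕ)
      (fun g s' => g.1 ++ g.2 = L ∧ (g.2 ++ [0]).IsChain (fun j k => f j = k) ∧
        s'.nat vC 0 = g.2.headD 0 ∧
        Stored (fun j => x j - x a) vy (E ++ g.1.filter fun j => P j) s')
      (fun g => g.2.length) (collectStep nx b yd).maxCost s0 ?_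
      ([], L) (Frame.refl _ _) ⟨rfl, (List.isChain_cons.1 hc).2, q3, by simpa using q5⟩).mono
      (by simp [BExpr.cost, NExpr.cost]) ?_
    · rintro ⟨l, r⟩ s' hfr ⟨h1, h2, h3, h4⟩ hlt
      simp only [BExpr.eval, NExpr.eval] at hlt
      cases r with
      | nil => rw [h3] at hlt; simp at hlt
      | cons c r =>
        simp only [List.headD_cons] at h3
        have hcL : c ∈ L := by rw [← h1]; simp
        have hnext := hhead c r h2
        have hsc : Scene a x y s' := by
          refine ⟨?_, ?_, ?_⟩
          · rw [hfr.1 _ hw.2.2.1]; exact q4.1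
          · rw [hfr.2.1 _ hw.2.2.2.1]; exact q4.2.1
          · rw [hfr.2.1 _ hw.2.2.2.2]; exact q4.2.2
        have hfs : ∀ j ≤ N, s'.nat nx (s'.nat nRow a + j) = f j := by
          rw [hfr.1 _ hw.1, hfr.1 _ hw.2.1]; exact q6
        refine Runs.straight (by simp [collectStep, Straight]) ?_
        rw [collectStep, denote_seq]
        have key : ∃ s1, (Prog.ite b
            (.seq (.nset nEv (var vM) (var vC))
              (.seq (.rset rEX (var vM) (.sub (.get rX (var vC)) (.get rX (var vA))))
                (.seq (.rset rEY (var vM) yd) (.assign vM (.add (var vM) one))))) .skip).denote s' = s1 ∧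
            (∀ z, z ≠ nEv → z ≠ vM → s1.nat z = s'.nat z) ∧
            Stored (fun j => x j - x a) vy (E ++ (l ++ [c]).filter fun j => P j) s1 := by
          refine ⟨_, rfl, ?_⟩
          have hbs := hb s' hsc
          rw [h3] at hbs
          by_cases hP : P c
          · rw [denote_ite_pos (hbs.2 hP)]
            refine ⟨fun z z1 z2 => by simp [denote, z1, z2], ?_⟩
            have hl : (l ++ [c]).filter (fun j => P j) = l.filter (fun j => P j) ++ [c] := by
              simp [List.filter_append, hP]
            rw [hl, ← List.append_assoc]
            have hyd' := hyd ((s'.setNat nEv (s'.nat vM 0) c).setReal rEX (s'.nat vM 0)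
              (x c - x a)) (by
                refine ⟨?_, ?_, ?_⟩
                · simpa using hsc.1
                · simpa using hsc.2.1
                · simpa using hsc.2.2)
            simp [h4.1, h3] at hyd'
            apply h4.append c
            · simp [denote, NExpr.eval, h4.1]
            · simp [denote, NExpr.eval, h4.1, h3]
            · simp [denote, NExpr.eval, RExpr.eval, h4.1, h3, hsc.2.1, hsc.1]
            · simp [denote, NExpr.eval, RExpr.eval, h4.1, h3, hsc.2.1, hsc.1, hyd']
          · rw [denote_ite_neg (mt hbs.1 hP)]
            refine ⟨fun z _ _ => rfl, ?_⟩
            have hl : (l ++ [c]).filter (fun j => P j) = l.filter (fun j => P j) := by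
              simp [List.filter_append, hP]
            rw [hl]
            exact h4
        obtain ⟨s1, e1, e2, e3⟩ := key
        rw [e1]
        refine ⟨(l ++ [c], r), ⟨by simpa using h1, (List.isChain_cons.1 h2).2, ?_, ?_⟩, by simp⟩
        · simp only [denote, NExpr.eval, cell, State.setNat_nat, if_true, Function.update_self]
          rw [e2 vA (by decide) (by decide), e2 nRow (by decide) (by decide),
            e2 vC (by decide) (by decide),
            e2 nx (by rcases hnx with rfl | rfl <;> decide) (by rcases hnx with rfl | rfl <;> decide),
            hsc.1, h3, hfs c (hL c hcL).2, hnext]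
        · refine ⟨?_, fun t ht => ?_⟩
          · simpa [denote] using e3.1
          · simpa [denote] using e3.2 t ht
    · rintro s' ⟨⟨l, r⟩, ⟨h1, h2, h3, h4⟩, hlt, -⟩
      simp only [BExpr.eval, NExpr.eval, h3] at hlt
      cases r with
      | nil =>
        rw [List.append_nil] at h1
        rw [← h1]; exact h4
      | cons c r =>
        have : c ∈ L := by rw [← h1]; simp
        have := hL c this
        simp at hlt
        omega
  · have h1 : (L.length + 1) * ((collectStep nx b yd).maxCost + 13) =
      (L.length + 1) * (5 + (collectStep nx b yd).maxCost) + 8 * (L.length + 1) := by ring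
    omega

end RealRAM

namespace RealRAM

open NExpr Prog

def leftE (yd : RExpr) : BExpr := .and (.nlt (var vC) (var vA)) (.rlt yd (.const 0))

def rightE : BExpr := .nlt (var vA) (var vC)

/-- Sweep around the point `A`, and mark the points killed by an earlier witness. -/
def passProg (nx : ℕ) (yd : RExpr) : Prog :=
  .seq (.assign vM zero)
    (.seq (collectProg nx (leftE yd) yd) (.seq (collectProg nx rightE yd) sweepProg))

theorem passProg_runs {nx : ℕ} (hnx : nx = nNext ∨ nx = nPrev) (yd : RExpr) :
    ∃ C, ∀ {N a : ℕ} {x y vy : ℕ → ℝ} {f : ℕ → ℕ} {L : List ℕ} {s : State},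
    Scene a x y s → (∀ s', Scene a x y s' → yd.eval s' = vy (s'.nat vC 0)) →
    (∀ j ≤ N, s.nat nx (s.nat nRow a + j) = f j) → (∀ j ∈ L, 1 ≤ j ∧ j ≤ N) →
    (0 :: L ++ [0]).IsChain (fun j k => f j = k) →
    Sweep.Star a (fun j => x j - x a) vy L →
    Runs (passProg nx yd) s (C * (L.length + 1)) (fun s' => ∀ j, a < j →
      (0 < s'.nat nDead j ↔ 0 < s.nat nDead j ∨
        (j ∈ L ∧ ∃ w ∈ L, 0 < s.nat nIsW w ∧ (x w - x a) * (x w - x a) + vy w * vy w ≤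
          (x j - x a) * (x w - x a) + vy j * vy w ∧
          ((w < a ∧ vy w < 0) ∨ (a < w ∧ 0 < (x w - x a) * vy j - vy w * (x j - x a)))))) := by
  classical
  obtain ⟨C, hC⟩ := sweepProg_runs
  refine ⟨3 + ((collectStep nx (leftE yd) yd).maxCost + 13) +
    ((collectStep nx rightE yd).maxCost + 13) + 2 * C, ?_⟩
  intro N a x y vy f L s hs hyd hf hL hc hstar
  have hnv : nx ≠ vM := by rcases hnx with rfl | rfl <;> decide
  have hw : ∀ b, nx ∉ (collectProg nx b yd).natWrites := by
    intro b
    rcases hnx with rfl | rfl <;> simp [collectProg, collectStep, natWrites]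
  have hw2 : ∀ b z, z = nRow ∨ z = vA ∨ z = nIsW ∨ z = nDead →
      z ∉ (collectProg nx b yd).natWrites := by
    rintro b z (rfl | rfl | rfl | rfl) <;> simp [collectProg, collectStep, natWrites]
  have hw3 : ∀ b z, z = rX ∨ z = rY → z ∉ (collectProg nx b yd).realWrites := by
    rintro b z (rfl | rfl) <;> simp [collectProg, collectStep, realWrites]
  refine (Runs.seq (T := 3) (T' := (L.length + 1) * ((collectStep nx (leftE yd) yd).maxCost + 13) +
    ((L.length + 1) * ((collectStep nx rightE yd).maxCost + 13) + C * (2 * L.length + 1)))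
    ?_).mono ?_ (fun _ h => h)
  · refine (Runs.straight (c := .assign vM zero) trivial ?_).mono (by simp [maxCost, NExpr.cost])
      (fun _ h => h)
    set s0 := (Prog.assign vM zero).denote s with hs0
    have q1 : ∀ c, c ≠ vM → s0.nat c = s.nat c := fun c hc => by simp [hs0, denote, hc]
    have q2 : s0.real = s.real := rfl
    have q4 : Scene a x y s0 := ⟨by rw [q1 _ (by decide)]; exact hs.1, hs.2⟩
    have q5 : Stored (fun j => x j - x a) vy [] s0 := by
      refine ⟨by simp [hs0, denote, NExpr.eval], fun t ht => by simp at ht⟩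
    refine Runs.seq ?_
    refine (collectProg_runs hnx (leftE yd) yd (P := fun j => j < a ∧ vy j < 0) q4 ?_ hyd
      (by rw [q1 nRow (by decide), q1 nx hnv]; exact hf) hL hc q5).frame.mono le_rfl ?_
    · intro s' hs'
      simp only [leftE, BExpr.eval, NExpr.eval, RExpr.eval, hyd s' hs', hs'.1, Nat.cast_zero]
    rintro s1 ⟨p1, fr1⟩
    have r4 : Scene a x y s1 := ⟨by rw [fr1.1 _ (hw2 _ _ (by simp))]; exact q4.1,
      by rw [fr1.2.1 _ (hw3 _ _ (by simp))]; exact q4.2.1,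
      by rw [fr1.2.1 _ (hw3 _ _ (by simp))]; exact q4.2.2⟩
    refine Runs.seq ?_
    refine (collectProg_runs hnx rightE yd (P := fun j => a < j) r4 ?_ hyd
      (by rw [fr1.1 nx (hw _), fr1.1 nRow (hw2 _ _ (by simp)), q1 nRow (by decide), q1 nx hnv]
          exact hf) hL hc p1).frame.mono le_rfl ?_
    · intro s' hs'
      simp only [rightE, BExpr.eval, NExpr.eval, hs'.1]
    rintro s2 ⟨p2, fr2⟩
    have he : ([] ++ List.filter (fun j => decide (j < a ∧ vy j < 0)) L ++
        List.filter (fun j => decide (a < j)) L) = Sweep.events a vy L := by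
      rw [Sweep.events, List.nil_append]
    rw [he] at p2
    have hlen : (Sweep.events a vy L).length ≤ 2 * L.length := by
      rw [Sweep.events, List.length_append]
      have h1 := List.length_filter_le (fun j => decide (j < a ∧ vy j < 0)) L
      have h2 := List.length_filter_le (fun j => decide (a < j)) L
      omega
    refine (hC _ _ _ s2 (hstar.sweep fun t ht => (p2.2 t ht).2) rfl rfl p2.1).mono
      (Nat.mul_le_mul_left _ (by omega)) ?_
    intro s3 h3 j hj
    have k1 := fr2.1 nDead (hw2 _ _ (by simp))
    have k2 := fr1.1 nDead (hw2 _ _ (by simp))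
    have k3 := fr2.1 nIsW (hw2 _ _ (by simp))
    have k4 := fr1.1 nIsW (hw2 _ _ (by simp))
    rw [h3, k1, k2, q1 _ (by decide)]
    refine or_congr_right ?_
    rw [k3, k4, q1 nIsW (by decide)]
    exact hstar.exists_kills_iff (W := fun w => 0 < s.nat nIsW w) p2.2 hj
  · have h1 : (3 + ((collectStep nx (leftE yd) yd).maxCost + 13) +
      ((collectStep nx rightE yd).maxCost + 13) + 2 * C) * (L.length + 1) =
      3 * (L.length + 1) + (L.length + 1) * ((collectStep nx (leftE yd) yd).maxCost + 13) +
      (L.length + 1) * ((collectStep nx rightE yd).maxCost + 13) + C * (2 * L.length + 1) + C := by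
      ring
    omega

/-- The points `1, …, N` are in lexicographic order, no three of them are collinear, and the lines
of `A` are dual to them. -/
structure Dual {N : ℕ} (A : Lines N) (x y : ℕ → ℝ) : Prop where
  lex : ∀ i j, 1 ≤ i → i < j → j ≤ N → x i < x j ∨ (x i = x j ∧ y i < y j)
  ne : ∀ i j k, 1 ≤ i → 1 ≤ j → 1 ≤ k → i ≤ N → j ≤ N → k ≤ N → i ≠ j → i ≠ k → j ≠ k →
    orient x y i j k ≠ 0
  test : ∀ k q r, 1 ≤ k → k < q → q < r → r ≤ N → (orient x y k q r < 0 ↔ A.X r k < A.X k q)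
  slope : ∀ a j k, 1 ≤ a → 1 ≤ j → 1 ≤ k → a ≤ N → j ≤ N → k ≤ N →
    ((a < j ∧ a < k) ∨ (j < a ∧ k < a)) → A.X a j < A.X a k → 0 < orient x y a j k

/-- The witness with index `w` is in the closed disk whose diameter joins the points with indices
`a` and `b`. -/
def KillsAt (x y : ℕ → ℝ) (a w b : ℕ) : Prop :=
  (x w - x a) * (x w - x a) + (y w - y a) * (y w - y a) ≤
    (x b - x a) * (x w - x a) + (y b - y a) * (y w - y a)

theorem Dual.star {N : ℕ} {A : Lines N} {x y : ℕ → ℝ} (h : Dual A x y) {a : ℕ} (ha : 1 ≤ a)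
    (haN : a ≤ N) {L : List ℕ} (hL : ∀ j, j ∈ L ↔ j ∈ (Finset.Icc 1 N).erase a)
    (hs : L.Pairwise fun j k => A.X a j < A.X a k) :
    Sweep.Star a (fun j => x j - x a) (fun j => y j - y a) L ∧
      Sweep.Star a (fun j => x j - x a) (fun j => y a - y j) L.reverse := by
  have hL' : ∀ j ∈ L, j ≠ a ∧ 1 ≤ j ∧ j ≤ N := fun j hj => by
    rw [hL] at hj; simpa using hj
  have hs' : L.Pairwise fun j k => ((a < j ∧ a < k) ∨ (j < a ∧ k < a)) → 0 < orient x y a j k := by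
    refine hs.imp_of_mem ?_
    intro j k hj hk hjk hc
    obtain ⟨-, j1, j2⟩ := hL' j hj
    obtain ⟨-, k1, k2⟩ := hL' k hk
    exact h.slope a j k ha j1 k1 haN j2 k2 hc hjk
  have hr : ∀ j ∈ L, a < j → 0 < x j - x a ∨ (x j - x a = 0 ∧ 0 < y j - y a) := by
    intro j hj haj
    rcases h.lex a j ha haj (hL' j hj).2.2 with h1 | ⟨h1, h2⟩
    · exact Or.inl (sub_pos.2 h1)
    · exact Or.inr ⟨by rw [h1, sub_self], sub_pos.2 h2⟩
  have hl : ∀ j ∈ L, j < a → x j - x a < 0 ∨ (x j - x a = 0 ∧ y j - y a < 0) := by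
    intro j hj haj
    rcases h.lex j a (hL' j hj).2.1 haj haN with h1 | ⟨h1, h2⟩
    · exact Or.inl (sub_neg.2 h1)
    · exact Or.inr ⟨by rw [h1, sub_self], sub_neg.2 h2⟩
  constructor
  · refine ⟨hs', ?_, ?_, ?_⟩
    · intro j hj haj
      rcases hr j hj haj with h1 | ⟨h1, h2⟩
      · exact ⟨h1.le, Or.inl h1.ne'⟩
      · exact ⟨h1.ge, Or.inr h2.ne'⟩
    · intro j hj haj
      rcases hl j hj haj with h1 | ⟨h1, h2⟩
      · exact h1.le
      · exact h1.le
    · intro w hw j hj h1 h2 h3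
      rcases hr j hj h3 with h4 | ⟨-, h4⟩
      · exact Or.inr (Or.inl h4)
      · exact Or.inr (Or.inr h4)
  · refine ⟨?_, ?_, ?_, ?_⟩
    · rw [List.pairwise_reverse]
      refine hs'.imp ?_
      intro j k hjk hc
      have := hjk (hc.imp And.symm And.symm)
      unfold orient at this
      linarith
    · intro j hj haj
      rw [List.mem_reverse] at hj
      rcases hr j hj haj with h1 | ⟨h1, h2⟩
      · exact ⟨h1.le, Or.inl h1.ne'⟩
      · exact ⟨h1.ge, Or.inr (by linarith)⟩
    · intro j hj haj
      rw [List.mem_reverse] at hj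
      rcases hl j hj haj with h1 | ⟨h1, h2⟩
      · exact h1.le
      · exact h1.le
    · intro w hw j hj h1 h2 h3
      rw [List.mem_reverse] at hw
      rcases hl w hw h1 with h4 | ⟨-, h4⟩
      · exact Or.inl h4
      · linarith

theorem Dual.kills_iff {N : ℕ} {A : Lines N} {x y : ℕ → ℝ} (h : Dual A x y) {a b : ℕ} (ha : 1 ≤ a)
    (hab : a < b) (hb : b ≤ N) {L : List ℕ} (hL : ∀ j, j ∈ L ↔ j ∈ (Finset.Icc 1 N).erase a)
    (W : ℕ → Prop) :
    ((b ∈ L ∧ ∃ w ∈ L, W w ∧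
      (x w - x a) * (x w - x a) + (y w - y a) * (y w - y a) ≤
        (x b - x a) * (x w - x a) + (y b - y a) * (y w - y a) ∧
      ((w < a ∧ y w - y a < 0) ∨
        (a < w ∧ 0 < (x w - x a) * (y b - y a) - (y w - y a) * (x b - x a)))) ∨
    (b ∈ L.reverse ∧ ∃ w ∈ L.reverse, W w ∧
      (x w - x a) * (x w - x a) + (y a - y w) * (y a - y w) ≤
        (x b - x a) * (x w - x a) + (y a - y b) * (y a - y w) ∧
      ((w < a ∧ y a - y w < 0) ∨
        (a < w ∧ 0 < (x w - x a) * (y a - y b) - (y a - y w) * (x b - x a))))) ↔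
    ∃ w, 1 ≤ w ∧ w ≤ N ∧ w ≠ a ∧ w ≠ b ∧ W w ∧ KillsAt x y a w b := by
  have hL' : ∀ j, j ∈ L ↔ j ≠ a ∧ 1 ≤ j ∧ j ≤ N := fun j => by rw [hL]; simp
  simp only [List.mem_reverse, hL', KillsAt]
  constructor
  · rintro (⟨-, w, ⟨w1, w2, w3⟩, hw, hk, hc⟩ | ⟨-, w, ⟨w1, w2, w3⟩, hw, hk, hc⟩)
    · refine ⟨w, w2, w3, w1, ?_, hw, hk⟩
      rintro rfl
      rcases hc with ⟨h1, -⟩ | ⟨-, h1⟩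
      · omega
      · linarith
    · refine ⟨w, w2, w3, w1, ?_, hw, by linarith⟩
      rintro rfl
      rcases hc with ⟨h1, -⟩ | ⟨-, h1⟩
      · omega
      · linarith
  · rintro ⟨w, w2, w3, w1, wb, hw, hk⟩
    have hbL : b ≠ a ∧ 1 ≤ b ∧ b ≤ N := ⟨by omega, by omega, hb⟩
    have hbx : 0 ≤ x b - x a := by
      rcases h.lex a b ha hab hb with h1 | ⟨h1, -⟩ <;> linarith
    rcases lt_or_gt_of_ne w1 with hwa | hwa
    · have hwx : x w < x a ∨ (x w = x a ∧ y w < y a) := h.lex w a w2 hwa (by omega)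
      have hxw : x w - x a ≤ 0 := by rcases hwx with h1 | ⟨h1, -⟩ <;> linarith
      rcases lt_trichotomy (y w - y a) 0 with hy | hy | hy
      · exact Or.inl ⟨hbL, w, ⟨w1, w2, w3⟩, hw, hk, Or.inl ⟨hwa, hy⟩⟩
      · exfalso
        rcases hwx with h1 | ⟨-, h1⟩
        · rw [hy] at hk
          have := mul_pos_of_neg_of_neg (sub_neg.2 h1) (sub_neg.2 h1)
          have := mul_nonneg hbx (neg_nonneg.2 hxw)
          linarith
        · linarith
      · exact Or.inr ⟨hbL, w, ⟨w1, w2, w3⟩, hw, by linarith, Or.inl ⟨hwa, by linarith⟩⟩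
    · have hne := h.ne a w b ha w2 (by omega) (by omega) w3 hb (by omega) (by omega) wb
      unfold orient at hne
      rcases lt_or_gt_of_ne hne with h1 | h1
      · exact Or.inr ⟨hbL, w, ⟨w1, w2, w3⟩, hw, by linarith, Or.inr ⟨hwa, by linarith⟩⟩
      · exact Or.inl ⟨hbL, w, ⟨w1, w2, w3⟩, hw, hk, Or.inr ⟨hwa, h1⟩⟩

end RealRAM

namespace RealRAM

open NExpr Prog

/-- Unmark all points. -/
def clearProg : Prog :=
  .forLoop vI zero (.add (var vNum) one) (.nset nDead (var vI) zero)

theorem clearProg_runs : ∃ C, ∀ {N : ℕ} {s : State}, s.nat vNum 0 = N →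
    Runs clearProg s (C * (N + 1)) (fun s' => ∀ j ≤ N, s'.nat nDead j = 0) := by
  refine ⟨100, fun {N s} hN => ?_⟩
  refine (Runs.for_rule (fun i s' => s'.nat vNum 0 = N ∧ ∀ j < i, s'.nat nDead j = 0)
    4 0 (N + 1) rfl (by omega) (by simp [natWrites]) ?_ ?_ ?_).mono ?_ ?_
  · rintro i s' ⟨h1, -⟩ -
    simp [NExpr.eval, h1]
  · simp [hN]
  · rintro i s' - hi ⟨h1, h2⟩ h3
    refine (Runs.straight (c := .nset nDead (var vI) zero) trivial ?_).mono
      (by simp [maxCost, NExpr.cost]) (fun _ h => h)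
    refine ⟨by simp [denote, h1], fun j hj => ?_⟩
    simp only [denote, NExpr.eval, h3, State.setNat_nat, Nat.reduceEqDiff, if_true, if_false,
      Function.update_apply]
    split_ifs with h
    · rfl
    · exact h2 j (by omega)
  · simp [NExpr.cost]; omega
  · rintro s' ⟨⟨-, h⟩, -⟩ i hi
    exact h i (by omega)

/-- Output the pair of points `A`, `B` unless `B` is marked. -/
def emitBody : Prog :=
  .ite (.and (.nlt zero (.get nPid (var vA))) (.and (.nlt zero (.get nPid (var vB)))
      (.not (.nlt zero (.get nDead (var vB))))))
    (.emit (.sub (.get nPid (var vA)) one) (.sub (.get nPid (var vB)) one)) .skip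

/-- Output the edges from `A` to later points. -/
def emitProg : Prog :=
  .forLoop vB (.add (var vA) one) (.add (var vNum) one) emitBody

/-- The pairs of identifiers of `a` and the later points `b` related to it by `G`. -/
def edgesFrom (N : ℕ) (pid : ℕ → ℕ) (G : ℕ → ℕ → Prop) [DecidableRel G] (a : ℕ) : List (ℕ × ℕ) :=
  ((List.range' (a + 1) (N - a)).filter fun b => 0 < pid a ∧ 0 < pid b ∧ G a b).map
    fun b => (pid a - 1, pid b - 1)

open Classical in
theorem emitProg_runs : ∃ C, ∀ {N a : ℕ} {G : ℕ → ℕ → Prop} {s : State}, s.nat vNum 0 = N →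
    s.nat vA 0 = a → a ≤ N → (∀ b, a < b → b ≤ N → (G a b ↔ ¬ 0 < s.nat nDead b)) →
    Runs emitProg s (C * (N + 1)) (fun s' => s'.out = s.out ++ edgesFrom N (s.nat nPid) G a) := by
  refine ⟨50 + emitBody.maxCost, fun {N a G s} hN ha haN hG => ?_⟩
  refine (Runs.for_rule (fun i s' => s'.nat vNum 0 = N ∧ s'.nat vA 0 = a ∧
      s'.nat nPid = s.nat nPid ∧ s'.nat nDead = s.nat nDead ∧
      s'.out = s.out ++ edgesFrom (i - 1) (s.nat nPid) G a)
    emitBody.maxCost (a + 1) (N + 1) (by simp [NExpr.eval, ha]) (by omega)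
    (by simp [emitBody, natWrites]) ?_ ?_ ?_).mono ?_ ?_
  · rintro i s' ⟨h1, -⟩ -
    simp [NExpr.eval, h1]
  · simp [hN, ha, edgesFrom]
  · rintro i s' hai hi ⟨h1, h2, h3, h4, h5⟩ h6
    refine Runs.straight (c := emitBody) (by simp [emitBody, Straight]) ?_
    have he : edgesFrom i (s.nat nPid) G a = edgesFrom (i - 1) (s.nat nPid) G a ++
        if 0 < s.nat nPid a ∧ 0 < s.nat nPid i ∧ G a i then
          [(s.nat nPid a - 1, s.nat nPid i - 1)] else [] := by
      have e : i - a = (i - 1 - a) + 1 := by omega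
      rw [edgesFrom, e, List.range'_1_concat, List.filter_append, List.map_append]
      have e2 : a + 1 + (i - 1 - a) = i := by omega
      rw [e2, edgesFrom]
      split_ifs with h <;> simp [h]
    by_cases hc : 0 < s.nat nPid a ∧ 0 < s.nat nPid i ∧ G a i
    · have hd : emitBody.denote s' = s'.output (s.nat nPid a - 1) (s.nat nPid i - 1) := by
        rw [emitBody, denote_ite_pos]
        · simp [denote, NExpr.eval, h2, h3, h6]
        · simpa [BExpr.eval, NExpr.eval, h2, h3, h4, h6, ← hG i (by omega) (by omega)] using hc
      rw [hd]
      refine ⟨by simp [h1], by simp [h2], by simp [h3], by simp [h4], ?_⟩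
      rw [Nat.add_sub_cancel, he, if_pos hc]
      simp [h5]
    · have hd : emitBody.denote s' = s' := by
        rw [emitBody, denote_ite_neg]
        · rfl
        · simp only [BExpr.eval, NExpr.eval, h2, h3, h4, h6, ← hG i (by omega) (by omega)]
          exact hc
      rw [hd]
      refine ⟨by simp [h1], by simp [h2], by simp [h3], by simp [h4], ?_⟩
      rw [Nat.add_sub_cancel, he, if_neg hc]
      simp [h5]
  · simp only [NExpr.cost]
    have h1 : N + 1 - (a + 1) + 1 ≤ N + 1 := by omega
    have h2 := Nat.mul_le_mul_right (3 + 1 + 1 + 4 + (emitBody.maxCost + 6)) h1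
    nlinarith [Nat.zero_le emitBody.maxCost]
  · rintro s' ⟨⟨-, -, -, -, h⟩, -⟩
    exact h

/-- The ordinate of the current point relative to `A`. -/
def upE : RExpr := .sub (.get rY (var vC)) (.get rY (var vA))

/-- The opposite of the ordinate of the current point relative to `A`. -/
def downE : RExpr := .sub (.get rY (var vA)) (.get rY (var vC))

/-- Output the edges from `A` to later points, by two sweeps around `A`. -/
def pointProg : Prog :=
  .seq clearProg (.seq (passProg nNext upE) (.seq (passProg nPrev downE) emitProg))

/-- No witness kills the pair `a`, `b`. -/
def Spared (N : ℕ) (x y : ℕ → ℝ) (isW : ℕ → ℕ) (a b : ℕ) : Prop :=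
  ¬ ∃ w, 1 ≤ w ∧ w ≤ N ∧ w ≠ a ∧ w ≠ b ∧ 0 < isW w ∧ KillsAt x y a w b

theorem pointProg_natWrites {z : ℕ}
    (hz : z = vNum ∨ z = nRow ∨ z = nNext ∨ z = nPrev ∨ z = vA ∨ z = nPid ∨ z = nIsW) :
    z ∉ pointProg.natWrites := by
  have h : ∀ z ∈ pointProg.natWrites, z ∉ [vNum, nRow, nNext, nPrev, vA, nPid, nIsW] := by
    decide
  intro hm
  exact h z hm (by simpa using hz)

theorem pointProg_realWrites {z : ℕ} (hz : z = rX ∨ z = rY) : z ∉ pointProg.realWrites := by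
  have h : ∀ z ∈ pointProg.realWrites, z ∉ [rX, rY] := by decide
  intro hm
  exact h z hm (by simpa using hz)

open Classical in
theorem pointProg_runs : ∃ C, ∀ {N a : ℕ} {A : Lines N} {x y : ℕ → ℝ} {s : State},
    Dual A x y → Arranged A x y N s → s.nat vA 0 = a → 1 ≤ a → a ≤ N →
    Runs pointProg s (C * (N + 1)) (fun s' => s'.out = s.out ++
      edgesFrom N (s.nat nPid) (Spared N x y (s.nat nIsW)) a) := by
  obtain ⟨C1, h1⟩ := clearProg_runs
  obtain ⟨C2, h2⟩ := passProg_runs (Or.inl rfl) upE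
  obtain ⟨C3, h3⟩ := passProg_runs (Or.inr rfl) downE
  obtain ⟨C4, h4⟩ := emitProg_runs
  refine ⟨C1 + C2 + C3 + C4, ?_⟩
  intro N a A x y s hd hs ha ha1 haN
  obtain ⟨nx, pv, hnx, hpv, hb⟩ := hs.built
  have hsub : ∀ z, (z = vNum ∨ z = nRow ∨ z = nNext ∨ z = nPrev ∨ z = vA ∨ z = nPid ∨ z = nIsW) →
      z ∉ clearProg.natWrites ∧ z ∉ (passProg nNext upE).natWrites ∧
      z ∉ (passProg nPrev downE).natWrites := by
    intro z hz
    have := pointProg_natWrites hz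
    simp only [pointProg, natWrites, List.mem_append, not_or] at this
    exact ⟨this.1, this.2.1, this.2.2.1⟩
  have hsubr : ∀ z, (z = rX ∨ z = rY) →
      z ∉ clearProg.realWrites ∧ z ∉ (passProg nNext upE).realWrites ∧
      z ∉ (passProg nPrev downE).realWrites := by
    intro z hz
    have := pointProg_realWrites hz
    simp only [pointProg, realWrites, List.mem_append, not_or] at this
    exact ⟨this.1, this.2.1, this.2.2.1⟩
  obtain ⟨L, hL1, hL2, hL3⟩ := (hb.rows a ha1 haN).exists_list
    (Lines.X_injOn ha1 haN (by simp; tauto))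
  have hmem : ∀ j ∈ L, 1 ≤ j ∧ j ≤ N := fun j hj => by
    rw [hL2] at hj; simp at hj; exact hj.2
  have hlen : L.length ≤ N := by
    have hnd : L.Nodup := hL1.imp fun h => by rintro rfl; exact lt_irrefl _ h
    have := (List.toFinset_card_of_nodup hnd).symm.le.trans
      (Finset.card_le_card (t := Finset.Icc 1 N) fun j hj => by
        simpa using hmem j (List.mem_toFinset.1 hj))
    simpa using this
  have hrowa := hs.row a haN
  have hrev : (0 :: L.reverse ++ [0]).IsChain fun j k => pv a j = k := by
    have : 0 :: L.reverse ++ [0] = (0 :: L ++ [0]).reverse := by simp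
    rw [this, List.isChain_reverse]
    exact hL3.imp fun _ _ h => h.2
  have hsil : clearProg.Silent ∧ (passProg nNext upE).Silent ∧ (passProg nPrev downE).Silent := by
    simp [clearProg, passProg, collectProg, collectStep, sweepProg, sweepInit, sweepStep, finishEvent,
      Silent]
  refine (Runs.seq (T := C1 * (N + 1)) (T' := C2 * (N + 1) + (C3 * (N + 1) + C4 * (N + 1)))
    ?_).mono (le_of_eq (by ring)) fun _ h => h
  refine (h1 hs.num).frame.mono le_rfl ?_
  rintro s1 ⟨p1, f1⟩
  have g1 : ∀ z, (z = vNum ∨ z = nRow ∨ z = nNext ∨ z = nPrev ∨ z = vA ∨ z = nPid ∨ z = nIsW) →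
      s1.nat z = s.nat z := fun z hz => f1.1 z (hsub z hz).1
  have g1r : ∀ z, (z = rX ∨ z = rY) → s1.real z = s.real z := fun z hz => f1.2.1 z (hsubr z hz).1
  have c1 : Scene a x y s1 := ⟨by rw [g1 _ (by simp), ha], by rw [g1r _ (by simp), hs.x],
    by rw [g1r _ (by simp), hs.y]⟩
  refine Runs.seq ?_
  refine (h2 c1 (vy := fun j => y j - y a) ?_ (f := nx a) ?_ hmem
    (hL3.imp fun _ _ h => h.1) (hd.star ha1 haN hL2 hL1).1).frame.mono
    (Nat.mul_le_mul_left _ (by omega)) ?_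
  · rintro s' ⟨k1, -, k3⟩
    simp [upE, RExpr.eval, NExpr.eval, k1, k3]
  · intro j hj
    rw [g1 nRow (by simp), g1 nNext (by simp), hrowa]
    exact hnx a j haN hj
  rintro s2 ⟨p2, f2⟩
  have g2 : ∀ z, (z = vNum ∨ z = nRow ∨ z = nNext ∨ z = nPrev ∨ z = vA ∨ z = nPid ∨ z = nIsW) →
      s2.nat z = s.nat z := fun z hz => (f2.1 z (hsub z hz).2.1).trans (g1 z hz)
  have g2r : ∀ z, (z = rX ∨ z = rY) → s2.real z = s.real z :=
    fun z hz => (f2.2.1 z (hsubr z hz).2.1).trans (g1r z hz)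
  have c2 : Scene a x y s2 := ⟨by rw [g2 _ (by simp), ha], by rw [g2r _ (by simp), hs.x],
    by rw [g2r _ (by simp), hs.y]⟩
  refine Runs.seq ?_
  refine (h3 c2 (vy := fun j => y a - y j) ?_ (f := pv a) ?_ (L := L.reverse)
    (fun j hj => hmem j (List.mem_reverse.1 hj)) hrev (hd.star ha1 haN hL2 hL1).2).frame.mono
    (Nat.mul_le_mul_left _ (by simpa using hlen)) ?_
  · rintro s' ⟨k1, -, k3⟩
    simp [downE, RExpr.eval, NExpr.eval, k1, k3]
  · intro j hj
    rw [g2 nRow (by simp), g2 nPrev (by simp), hrowa]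
    exact hpv a j haN hj
  rintro s3 ⟨p3, f3⟩
  have g3 : ∀ z, (z = vNum ∨ z = nRow ∨ z = nNext ∨ z = nPrev ∨ z = vA ∨ z = nPid ∨ z = nIsW) →
      s3.nat z = s.nat z := fun z hz => (f3.1 z (hsub z hz).2.2).trans (g2 z hz)
  refine (h4 (G := Spared N x y (s.nat nIsW)) (by rw [g3 _ (by simp), hs.num])
    (by rw [g3 _ (by simp), ha]) haN ?_).mono le_rfl ?_
  · intro b hab hbN
    rw [Spared, ← hd.kills_iff ha1 hab hbN hL2, p3 b hab, p2 b hab, p1 b hbN,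
      g1 nIsW (by simp), g2 nIsW (by simp)]
    simp only [lt_irrefl, false_or]
  · intro s4 h
    rw [h, f3.2.2 hsil.2.2, f2.2.2 hsil.2.1, f1.2.2 hsil.1, g3 nPid (by simp)]

/-- Output the edges. -/
def sweepsProg : Prog := .forLoop vA one (.add (var vNum) one) pointProg

open Classical in
theorem sweepsProg_runs : ∃ C, ∀ {N : ℕ} {A : Lines N} {x y : ℕ → ℝ} {s : State},
    Dual A x y → Arranged A x y N s →
    Runs sweepsProg s (C * (N + 1) ^ 2) (fun s' => s'.out = s.out ++
      (List.range' 1 N).flatMap (edgesFrom N (s.nat nPid) (Spared N x y (s.nat nIsW)))) := by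
  obtain ⟨C, hC⟩ := pointProg_runs
  refine ⟨C + 50, fun {N A x y s} hd hs => ?_⟩
  refine (Runs.for_rule (fun i s' => Arranged A x y N s' ∧ s'.nat nPid = s.nat nPid ∧
      s'.nat nIsW = s.nat nIsW ∧ s'.out = s.out ++
      (List.range' 1 (i - 1)).flatMap (edgesFrom N (s.nat nPid) (Spared N x y (s.nat nIsW))))
    (C * (N + 1)) 1 (N + 1) rfl (by omega) ?_ ?_ ?_ ?_).mono ?_ ?_
  · exact pointProg_natWrites (by simp)
  · rintro i s' ⟨h1, -⟩ -
    simp [NExpr.eval, h1.num]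
  · refine ⟨⟨?_, ?_, hs.x, hs.y, ?_⟩, ?_, ?_, ?_⟩
    · simpa using hs.num
    · simpa using hs.row
    · simpa using hs.built
    all_goals simp
  · rintro i s' h1i hiN ⟨h1, h2, h3, h4⟩ h5
    refine (hC hd h1 h5 h1i (by omega)).frame.mono le_rfl ?_
    rintro s'' ⟨h6, h7⟩
    have g : ∀ z, (z = vNum ∨ z = nRow ∨ z = nNext ∨ z = nPrev ∨ z = vA ∨ z = nPid ∨ z = nIsW) →
        s''.nat z = s'.nat z := fun z hz => h7.1 z (pointProg_natWrites hz)
    have gr : ∀ z, (z = rX ∨ z = rY) → s''.real z = s'.real z :=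
      fun z hz => h7.2.1 z (pointProg_realWrites hz)
    refine ⟨⟨?_, ?_, ?_, ?_, ?_⟩, ?_, ?_, ?_⟩
    · simpa [g] using h1.num
    · simpa [g] using h1.row
    · simpa [gr] using h1.x
    · simpa [gr] using h1.y
    · simpa [g] using h1.built
    · simpa [g] using h2
    · simpa [g] using h3
    · obtain ⟨i, rfl⟩ : ∃ k, i = k + 1 := ⟨i - 1, by omega⟩
      simp only [Nat.add_sub_cancel] at h4 ⊢
      rw [List.range'_1_concat, List.flatMap_append, Nat.add_comm 1 i]
      simp [h6, h4, h2, h3]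
  · simp only [NExpr.cost]
    have e : N + 1 - 1 + 1 = N + 1 := by omega
    rw [e]
    nlinarith [Nat.zero_le (C * N), Nat.zero_le C, Nat.zero_le N]
  · rintro s' ⟨⟨-, -, -, h⟩, -⟩
    exact h

end RealRAM

namespace RealRAM

open NExpr Prog

/-- The rule for counting loops whose body contains no loop. -/
theorem Runs.for_straight {v : ℕ} {e f : NExpr} {c : Prog} {s : State} (hc : c.Straight)
    (Inv : ℕ → State → Prop) (hi : ℕ) (he : e.eval s = 0) (hv : v ∉ c.natWrites)
    (hf : ∀ i s', Inv i s' → s'.nat v 0 = i → f.eval s' = hi) (h0 : Inv 0 s)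
    (hset : ∀ i s' k, Inv i s' → Inv i (s'.setNat v 0 k))
    (hbody : ∀ i s', i < hi → Inv i s' → s'.nat v 0 = i → Inv (i + 1) (c.denote s')) :
    Runs (.forLoop v e f c) s ((e.cost + f.cost + c.maxCost + 12) * (hi + 1)) (Inv hi) := by
  refine (Runs.for_rule Inv c.maxCost 0 hi he (Nat.zero_le _) hv hf (hset _ _ _ h0) ?_).mono ?_
    fun _ h => h.1
  · intro i s' _ hi h hv
    exact Runs.straight hc (hset _ _ _ (hbody i s' hi h hv))
  · rw [Nat.sub_zero]
    nlinarith [Nat.zero_le (e.cost * hi)]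

/-- The rule for two nested counting loops whose body contains no loop. -/
theorem Runs.double_for {v w : ℕ} {f g : NExpr} {c : Prog} {s : State} (hc : c.Straight)
    (Inv : ℕ → ℕ → State → Prop) (n : ℕ) (β : ℕ → ℕ) (hβ : ∀ i < n, β i ≤ n) (hvw : v ≠ w)
    (hv : v ∉ c.natWrites) (hw : w ∉ c.natWrites)
    (hf : ∀ i j s', Inv i j s' → s'.nat v 0 = i → f.eval s' = n)
    (hg : ∀ i j s', Inv i j s' → s'.nat v 0 = i → g.eval s' = β i) (h0 : Inv 0 0 s)
    (hset : ∀ i j s' k, Inv i j s' → Inv i j (s'.setNat v 0 k) ∧ Inv i j (s'.setNat w 0 k))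
    (hnext : ∀ i s', i < n → Inv i (β i) s' → Inv (i + 1) 0 s')
    (hbody : ∀ i j s', i < n → j < β i → Inv i j s' → s'.nat v 0 = i → s'.nat w 0 = j →
      Inv i (j + 1) (c.denote s')) :
    Runs (.forLoop v .zero f (.forLoop w .zero g c)) s
      ((f.cost + g.cost + c.maxCost + 40) * (n + 1) ^ 2) (Inv n 0) := by
  refine (Runs.for_rule (fun i s' => Inv i 0 s') ((g.cost + c.maxCost + 13) * (n + 1)) 0 n rfl
    (Nat.zero_le _) (by simp [natWrites, hv, hvw]) (fun i s' => hf i 0 s') (hset _ _ _ _ h0).1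
    ?_).mono ?_ fun _ h => h.1
  · intro i s' _ hi h hvi
    refine (Runs.for_straight (v := w) (e := .zero) (f := g) hc
      (fun j s'' => Inv i j s'' ∧ s''.nat v 0 = i) (β i) rfl hw ?_ ⟨h, hvi⟩ ?_ ?_).mono
      (Nat.mul_le_mul (by simp [NExpr.cost]; omega) (Nat.succ_le_succ (hβ i hi))) ?_
    · exact fun j s'' h _ => hg i j s'' h.1 h.2
    · exact fun j s'' k h => ⟨(hset _ _ _ _ h.1).2, by simp [hvw, h.2]⟩
    · intro j s'' hj h hwj
      refine ⟨hbody i j s'' hi hj h.1 h.2 hwj, ?_⟩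
      obtain ⟨t, -, ht⟩ := hc.exec s''
      rw [ht.frame.1 v hv, h.2]
    · exact fun s'' h => (hset _ _ _ _ (hnext i s'' hi h.1)).1
  · simp only [NExpr.cost, Nat.sub_zero]
    have h1 : n + 1 ≤ (n + 1) ^ 2 := Nat.le_self_pow two_ne_zero _
    have h2 := Nat.mul_le_mul_left (f.cost + 10) h1
    nlinarith

/-- Copy the points of `P` and of `W` into one array. -/
def copyProg : Prog :=
  .seq (.assign vSize (.add (.get 0 zero) (.get 0 one)))
    (.seq (.forLoop vI zero (.get 0 zero)
      (.seq (.rset rZX (var vI) (.get 0 (var vI))) (.rset rZY (var vI) (.get 1 (var vI)))))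
      (.forLoop vI zero (.get 0 one)
        (.seq (.rset rZX (.add (.get 0 zero) (var vI)) (.get 2 (var vI)))
          (.rset rZY (.add (.get 0 zero) (var vI)) (.get 3 (var vI))))))

theorem copyProg_runs : ∃ C, ∀ {m k : ℕ} {s : State}, s.nat 0 0 = m → s.nat 0 1 = k →
    Runs copyProg s (C * (m + k + 1)) (fun s' => s'.nat vSize 0 = m + k ∧
      (∀ i < m, s'.real rZX i = s.real 0 i ∧ s'.real rZY i = s.real 1 i) ∧
      ∀ i < k, s'.real rZX (m + i) = s.real 2 i ∧ s'.real rZY (m + i) = s.real 3 i) := by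
  refine ⟨100, fun {m k s} hm hk => ?_⟩
  refine (Runs.seq (T := 7) (T' := 40 * (m + 1) + 40 * (k + 1)) ?_).mono (by ring_nf; omega)
    fun _ h => h
  refine (Runs.straight (c := .assign vSize (.add (.get 0 zero) (.get 0 one))) trivial ?_).mono
    (by simp [maxCost, NExpr.cost]) fun _ h => h
  refine Runs.seq ?_
  refine (Runs.for_straight (by simp [Straight])
    (fun i s' => s'.nat vSize 0 = m + k ∧ s'.nat 0 = s.nat 0 ∧ (∀ a < 4, s'.real a = s.real a) ∧
      ∀ j < i, s'.real rZX j = s.real 0 j ∧ s'.real rZY j = s.real 1 j)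
    m rfl (by simp [natWrites]) ?_ ?_ ?_ ?_).mono
    (Nat.mul_le_mul_right _ (by simp [maxCost, NExpr.cost, RExpr.cost])) ?_
  · rintro i s' ⟨-, h, -⟩ -
    simp [NExpr.eval, h, hm]
  · simp [denote, NExpr.eval, hm, hk]
  · rintro i s' l h
    simpa using h
  · rintro i s' hi ⟨h1, h2, h3, h4⟩ h5
    refine ⟨by simpa [denote] using h1, by simpa [denote] using h2, fun a ha => ?_, fun j hj => ?_⟩
    · simp [denote, show a ≠ 4 by omega, show a ≠ 5 by omega, h3 a ha]
    · simp only [denote, NExpr.eval, RExpr.eval, State.setReal_real, State.setReal_nat, h5,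
        h3 0 (by omega), h3 1 (by omega), Nat.reduceEqDiff, if_true, if_false,
        Function.update_apply]
      split_ifs with h
      · simp [h]
      · exact h4 j (by omega)
  rintro s1 ⟨g1, g2, g3, g4⟩
  refine (Runs.for_straight (by simp [Straight])
    (fun i s' => s'.nat vSize 0 = m + k ∧ s'.nat 0 = s.nat 0 ∧ (∀ a < 4, s'.real a = s.real a) ∧
      (∀ j < m, s'.real rZX j = s.real 0 j ∧ s'.real rZY j = s.real 1 j) ∧
      ∀ j < i, s'.real rZX (m + j) = s.real 2 j ∧ s'.real rZY (m + j) = s.real 3 j)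
    k rfl (by simp [natWrites]) ?_ ?_ ?_ ?_).mono
    (Nat.mul_le_mul_right _ (by simp [maxCost, NExpr.cost, RExpr.cost])) ?_
  · rintro i s' ⟨-, h, -⟩ -
    simp [NExpr.eval, h, hk]
  · exact ⟨g1, g2, g3, g4, by simp⟩
  · rintro i s' l h
    simpa using h
  · rintro i s' hi ⟨h1, h2, h3, h4, h6⟩ h5
    refine ⟨by simpa [denote] using h1, by simpa [denote] using h2, fun a ha => ?_, fun j hj => ?_,
      fun j hj => ?_⟩
    · simp [denote, show a ≠ 4 by omega, show a ≠ 5 by omega, h3 a ha]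
    · simp [denote, NExpr.eval, RExpr.eval, h2, hm, h5,
        show j ≠ m + i by omega, h4 j hj]
    · simp only [denote, NExpr.eval, RExpr.eval, State.setReal_real, State.setReal_nat, h5, h2, hm,
        h3 2 (by omega), h3 3 (by omega), Nat.reduceEqDiff, if_true, if_false,
        Function.update_apply, Nat.add_left_cancel_iff]
      split_ifs with h
      · simp [h]
      · exact h6 j (by omega)
  · rintro s2 ⟨h1, -, -, h2, h3⟩
    exact ⟨h1, h2, h3⟩

/-- Lexicographic order of the points with the given indices. -/
def LexLt (X Y : ℕ → ℝ) (i j : ℕ) : Prop := X i < X j ∨ (X i = X j ∧ Y i < Y j)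

def lexE (i j : NExpr) : BExpr :=
  .not (.and (.not (.rlt (.get rZX i) (.get rZX j)))
    (.not (.and (.not (.rlt (.get rZX j) (.get rZX i))) (.rlt (.get rZY i) (.get rZY j)))))

theorem lexE_eval (s : State) (i j : NExpr) :
    (lexE i j).eval s ↔ LexLt (s.real rZX) (s.real rZY) (i.eval s) (j.eval s) := by
  simp only [lexE, BExpr.eval, RExpr.eval, LexLt]
  constructor
  · intro h
    by_contra! h'
    refine h ⟨h'.1.not_gt, fun h2 => ?_⟩
    exact (h'.2 (le_antisymm (not_lt.1 h2.1) h'.1)).not_gt h2.2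
  · rintro (h | ⟨h1, h2⟩) ⟨h3, h4⟩
    · exact h3 h
    · exact h4 ⟨h1.not_gt, h2⟩

def eqE (i j : NExpr) : BExpr := .and (.not (lexE i j)) (.not (lexE j i))

theorem eqE_eval (s : State) (i j : NExpr) : (eqE i j).eval s ↔
    s.real rZX (i.eval s) = s.real rZX (j.eval s) ∧
      s.real rZY (i.eval s) = s.real rZY (j.eval s) := by
  simp only [eqE, BExpr.eval, lexE_eval, LexLt]
  constructor
  · intro h
    push Not at h
    obtain ⟨⟨h1, h2⟩, h3, h4⟩ := h
    have e := le_antisymm h3 h1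
    exact ⟨e, le_antisymm (h4 e.symm) (h2 e)⟩
  · rintro ⟨h1, h2⟩
    simp [h1, h2]

def dupBody : Prog := .ite (eqE (var vJ) (var vI)) (.nset nDup (var vI) one) .skip

/-- Mark the points that occur earlier in the array. -/
def dupProg : Prog := .forLoop vI zero (var vSize) (.forLoop vJ zero (var vI) dupBody)

theorem dupProg_runs : ∃ C, ∀ {n : ℕ} {s : State}, s.nat vSize 0 = n → s.nat nDup = 0 →
    Runs dupProg s (C * (n + 1) ^ 2) (fun s' => ∀ a < n, 0 < s'.nat nDup a ↔
      ∃ b < a, s.real rZX b = s.real rZX a ∧ s.real rZY b = s.real rZY a) := by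
  refine ⟨(var vSize).cost + (var vI).cost + dupBody.maxCost + 40, fun {n s} hn hd => ?_⟩
  refine (Runs.double_for (by simp [dupBody, Straight]) (fun i j s' => s'.nat vSize 0 = n ∧
    s'.real = s.real ∧ ∀ a, 0 < s'.nat nDup a ↔ ∃ b, ((a < i ∧ b < a) ∨ (a = i ∧ b < j)) ∧
      s.real rZX b = s.real rZX a ∧ s.real rZY b = s.real rZY a) n (fun i => i) (fun i hi => hi.le)
    (by decide) (by simp [dupBody, natWrites]) (by simp [dupBody, natWrites]) ?_ ?_ ?_ ?_ ?_
    ?_).mono le_rfl ?_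
  · exact fun i j s' h _ => h.1
  · exact fun i j s' _ h => h
  · simp [hn, hd]
  · intro i j s' k h
    constructor <;> simpa using h
  · rintro i s' - ⟨h1, h2, h3⟩
    refine ⟨h1, h2, fun a => (h3 a).trans (exists_congr fun b => and_congr_left' ?_)⟩
    omega
  · rintro i j s' hi hj ⟨h1, h2, h3⟩ hvi hvj
    have hE := eqE_eval s' (var vJ) (var vI)
    simp only [NExpr.eval, hvi, hvj, h2] at hE
    by_cases he : s.real rZX j = s.real rZX i ∧ s.real rZY j = s.real rZY i
    · rw [dupBody, denote_ite_pos (hE.2 he)]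
      refine ⟨by simpa [denote] using h1, by simpa [denote] using h2, fun a => ?_⟩
      simp only [denote, NExpr.eval, hvi, State.setNat_nat, if_true, Function.update_apply]
      split_ifs with ha
      · subst ha
        simp only [Nat.one_pos, true_iff]
        exact ⟨j, Or.inr ⟨trivial, Nat.lt_succ_self j⟩, he⟩
      · rw [h3 a]
        refine exists_congr fun b => and_congr_left' ?_
        simp [ha]
    · rw [dupBody, denote_ite_neg (fun h => he (hE.1 h))]
      refine ⟨h1, h2, fun a => ?_⟩
      rw [denote, h3 a]
      refine exists_congr fun b => and_congr_left fun hb => ?_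
      have : ¬ (a = i ∧ b = j) := by rintro ⟨rfl, rfl⟩; exact he hb
      omega
  · rintro s' ⟨-, -, h⟩ a ha
    rw [h a]
    refine exists_congr fun b => and_congr_left' ?_
    omega

def rankBody : Prog :=
  .ite (.and (.not (.nlt zero (.get nDup (var vJ)))) (lexE (var vJ) (var vI)))
    (.nset nRank (var vI) (.add (.get nRank (var vI)) one)) .skip

/-- Compute the rank of each point in lexicographic order. -/
def rankProg : Prog := .forLoop vI zero (var vSize) (.forLoop vJ zero (var vSize) rankBody)

open Classical in
theorem rankProg_runs : ∃ C, ∀ {n : ℕ} {s : State}, s.nat vSize 0 = n → s.nat nRank = 0 →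
    Runs rankProg s (C * (n + 1) ^ 2) (fun s' => ∀ a < n, s'.nat nRank a =
      Nat.count (fun b => ¬ 0 < s.nat nDup b ∧ LexLt (s.real rZX) (s.real rZY) b a) n) := by
  refine ⟨(var vSize).cost + (var vSize).cost + rankBody.maxCost + 40, fun {n s} hn hd => ?_⟩
  refine (Runs.double_for (by simp [rankBody, Straight]) (fun i j s' => s'.nat vSize 0 = n ∧
    s'.real = s.real ∧ s'.nat nDup = s.nat nDup ∧ ∀ a, s'.nat nRank a =
      Nat.count (fun b => ¬ 0 < s.nat nDup b ∧ LexLt (s.real rZX) (s.real rZY) b a)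
        (if a < i then n else if a = i then j else 0)) n (fun _ => n) (fun i hi => le_rfl)
    (by decide) (by simp [rankBody, natWrites]) (by simp [rankBody, natWrites]) ?_ ?_ ?_ ?_ ?_
    ?_).mono le_rfl ?_
  · exact fun i j s' h _ => h.1
  · exact fun i j s' h _ => h.1
  · simp [hn, hd]
  · intro i j s' k h
    constructor <;> simpa using h
  · rintro i s' - ⟨h1, h2, h3, h4⟩
    refine ⟨h1, h2, h3, fun a => (h4 a).trans ?_⟩
    congr 1
    split_ifs <;> omega
  · rintro i j s' hi hj ⟨h1, h2, h3, h4⟩ hvi hvj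
    have hE := lexE_eval s' (var vJ) (var vI)
    simp only [NExpr.eval, hvi, hvj, h2] at hE
    by_cases he : ¬ 0 < s.nat nDup j ∧ LexLt (s.real rZX) (s.real rZY) j i
    · rw [rankBody, denote_ite_pos (by
        simp only [BExpr.eval, NExpr.eval, hvj, h3]; exact ⟨he.1, hE.2 he.2⟩)]
      refine ⟨by simpa [denote] using h1, by simpa [denote] using h2, by simpa [denote] using h3,
        fun a => ?_⟩
      simp only [denote, NExpr.eval, hvi, State.setNat_nat, if_true, Function.update_apply]
      split_ifs with ha hai hai
      · omega
      · subst ha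
        rw [Nat.count_succ, if_pos he, h4 a]
        simp
      · rw [h4 a, if_pos hai]
      · rw [h4 a, if_neg hai, if_neg ha]
    · rw [rankBody, denote_ite_neg (by
        simp only [BExpr.eval, NExpr.eval, hvj, h3]; exact fun h => he ⟨h.1, hE.1 h.2⟩)]
      refine ⟨h1, h2, h3, fun a => ?_⟩
      rw [denote, h4 a]
      by_cases hai : a < i
      · simp [hai]
      by_cases ha : a = i
      · subst ha
        simp only [lt_irrefl, if_false, if_true]
        rw [Nat.count_succ, if_neg he, Nat.add_zero]
      · simp [hai, ha]
  · rintro s' ⟨-, -, -, h⟩ a ha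
    rw [h a, if_pos ha]

def placeE : NExpr := .add (.get nRank (var vI)) one

def placeBody : Prog :=
  .seq (.rset rX placeE (.get rZX (var vI))) (.seq (.rset rY placeE (.get rZY (var vI)))
    (.seq (.ite (.nlt (var vI) (.get 0 zero)) (.nset nPid placeE (.add (var vI) one))
        (.nset nIsW placeE one))
      (.ite (.nlt zero (.get nDup (var vI))) .skip (.assign vNum (.add (var vNum) one)))))

/-- Place each point according to its rank. -/
def placeProg : Prog := .forLoop vI zero (var vSize) placeBody

open Classical in
theorem placeProg_runs : ∃ C, ∀ {n m : ℕ} {s : State}, s.nat vSize 0 = n → s.nat 0 0 = m →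
    s.nat vNum 0 = 0 → s.nat nPid = 0 → s.nat nIsW = 0 →
    Runs placeProg s (C * (n + 1)) (fun s' =>
      s'.nat vNum 0 = Nat.count (fun b => ¬ 0 < s.nat nDup b) n ∧
      (∀ r, (∀ i < n, s.nat nRank i + 1 = r →
        ∃ j < n, s.nat nRank j + 1 = r ∧ s'.real rX r = s.real rZX j ∧
          s'.real rY r = s.real rZY j) ∧
        (0 < s'.nat nPid r ↔ ∃ i < n, i < m ∧ s.nat nRank i + 1 = r) ∧
        (0 < s'.nat nPid r → ∃ i < n, i < m ∧ s.nat nRank i + 1 = r ∧ s'.nat nPid r = i + 1) ∧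
        (0 < s'.nat nIsW r ↔ ∃ i < n, m ≤ i ∧ s.nat nRank i + 1 = r))) := by
  refine ⟨zero.cost + (var vSize).cost + placeBody.maxCost + 12, fun {n m s} hn hm hN hp hw => ?_⟩
  refine (Runs.for_straight (by simp [placeBody, Straight]) (fun k s' => (s'.nat vSize 0 = n ∧
      s'.nat 0 0 = m ∧ s'.nat nDup = s.nat nDup ∧ s'.nat nRank = s.nat nRank ∧
      s'.real rZX = s.real rZX ∧ s'.real rZY = s.real rZY) ∧
      s'.nat vNum 0 = Nat.count (fun b => ¬ 0 < s.nat nDup b) k ∧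
      (∀ r, (∀ i < k, s.nat nRank i + 1 = r →
        ∃ j < k, s.nat nRank j + 1 = r ∧ s'.real rX r = s.real rZX j ∧
          s'.real rY r = s.real rZY j) ∧
        (0 < s'.nat nPid r ↔ ∃ i < k, i < m ∧ s.nat nRank i + 1 = r) ∧
        (0 < s'.nat nPid r → ∃ i < k, i < m ∧ s.nat nRank i + 1 = r ∧ s'.nat nPid r = i + 1) ∧
        (0 < s'.nat nIsW r ↔ ∃ i < k, m ≤ i ∧ s.nat nRank i + 1 = r)))
    n rfl (by simp [placeBody, natWrites]) ?_ ?_ ?_ ?_).mono le_rfl ?_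
  · exact fun i s' h _ => h.1.1
  · simp [hn, hm, hN, hp, hw]
  · intro i s' k h
    simpa using h
  · rintro k s' hk ⟨⟨h1, h2, h3, h4, h5, h6⟩, h7, h8⟩ h9
    have e1 : (placeBody.denote s').real rX =
        Function.update (s'.real rX) (s.nat nRank k + 1) (s.real rZX k) := by
      by_cases hkm : k < m <;> by_cases hd : 0 < s.nat nDup k <;>
        simp [placeBody, placeE, denote, NExpr.eval, RExpr.eval, BExpr.eval, h9, h2, h3, h4, h5,
          hkm, hd]
    have e2 : (placeBody.denote s').real rY =
        Function.update (s'.real rY) (s.nat nRank k + 1) (s.real rZY k) := by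
      by_cases hkm : k < m <;> by_cases hd : 0 < s.nat nDup k <;>
        simp [placeBody, placeE, denote, NExpr.eval, RExpr.eval, BExpr.eval, h9, h2, h3, h4, h6,
          hkm, hd]
    have e3 : (placeBody.denote s').nat nPid = if k < m then
        Function.update (s'.nat nPid) (s.nat nRank k + 1) (k + 1) else s'.nat nPid := by
      by_cases hkm : k < m <;> by_cases hd : 0 < s.nat nDup k <;>
        simp [placeBody, placeE, denote, NExpr.eval, BExpr.eval, h9, h2, h3, h4, hkm, hd]
    have e4 : (placeBody.denote s').nat nIsW = if k < m then s'.nat nIsW else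
        Function.update (s'.nat nIsW) (s.nat nRank k + 1) 1 := by
      by_cases hkm : k < m <;> by_cases hd : 0 < s.nat nDup k <;>
        simp [placeBody, placeE, denote, NExpr.eval, BExpr.eval, h9, h2, h3, h4, hkm, hd]
    have e5 : (placeBody.denote s').nat vNum 0 = Nat.count (fun b => ¬ 0 < s.nat nDup b) (k + 1) := by
      rw [Nat.count_succ]
      by_cases hkm : k < m <;> by_cases hd : 0 < s.nat nDup k <;>
        simp [placeBody, placeE, denote, NExpr.eval, BExpr.eval, h9, h2, h3, hkm, hd, h7]
    have hfr : Frame placeBody s' (placeBody.denote s') := by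
      obtain ⟨t, -, ht⟩ := Straight.exec (c := placeBody) (by simp [placeBody, Straight]) s'
      exact ht.frame
    refine ⟨⟨?_, ?_, ?_, ?_, ?_, ?_⟩, e5, fun r => ?_⟩
    · rwa [hfr.1 _ (by simp [placeBody, natWrites])]
    · rwa [hfr.1 _ (by simp [placeBody, natWrites])]
    · rwa [hfr.1 _ (by simp [placeBody, natWrites])]
    · rwa [hfr.1 _ (by simp [placeBody, natWrites])]
    · rwa [hfr.2.1 _ (by simp [placeBody, realWrites])]
    · rwa [hfr.2.1 _ (by simp [placeBody, realWrites])]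
    obtain ⟨h10, h11, h12, h13⟩ := h8 r
    rw [e1, e2, e3, e4]
    by_cases hr : r = s.nat nRank k + 1
    · subst hr
      simp only [Function.update_self]
      refine ⟨fun i hi hik => ⟨k, by omega, rfl, rfl, rfl⟩, ?_, ?_, ?_⟩
      · split_ifs with hkm
        · simp only [Function.update_self, Nat.succ_pos, true_iff]
          exact ⟨k, by omega, hkm, rfl⟩
        · rw [h11]
          refine exists_congr fun i => ?_
          constructor <;> rintro ⟨i1, i2, i3⟩ <;> exact ⟨by omega, i2, i3⟩
      · split_ifs with hkm
        · simp only [Function.update_self]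
          exact fun _ => ⟨k, by omega, hkm, rfl, rfl⟩
        · intro h
          obtain ⟨i, i1, i2⟩ := h12 h
          exact ⟨i, by omega, i2⟩
      · split_ifs with hkm
        · rw [h13]
          refine exists_congr fun i => ?_
          constructor <;> rintro ⟨i1, i2, i3⟩ <;> exact ⟨by omega, i2, i3⟩
        · simp only [Function.update_self, Nat.one_pos, true_iff]
          exact ⟨k, by omega, by omega, rfl⟩
    · have hk' : ∀ i, i < k + 1 ∧ s.nat nRank i + 1 = r ↔ i < k ∧ s.nat nRank i + 1 = r := by
        intro i
        constructor
        · rintro ⟨i1, i2⟩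
          rcases Nat.lt_succ_iff_lt_or_eq.1 i1 with h | rfl
          · exact ⟨h, i2⟩
          · exact absurd i2.symm hr
        · rintro ⟨i1, i2⟩
          exact ⟨by omega, i2⟩
      have e6 : (if k < m then Function.update (s'.nat nPid) (s.nat nRank k + 1) (k + 1)
          else s'.nat nPid) r = s'.nat nPid r := by
        split_ifs
        · rw [Function.update_of_ne hr]
        · rfl
      have e7 : (if k < m then s'.nat nIsW else
          Function.update (s'.nat nIsW) (s.nat nRank k + 1) 1) r = s'.nat nIsW r := by
        split_ifs
        · rfl
        · rw [Function.update_of_ne hr]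
      rw [Function.update_of_ne hr, Function.update_of_ne hr, e6, e7]
      refine ⟨fun i hi hik => ?_, ?_, fun h => ?_, ?_⟩
      · obtain ⟨j, j1, j2⟩ := h10 i ((hk' i).1 ⟨hi, hik⟩).1 hik
        exact ⟨j, by omega, j2⟩
      · rw [h11]
        exact exists_congr fun i => by have := hk' i; tauto
      · obtain ⟨i, i1, i2⟩ := h12 h
        exact ⟨i, by omega, i2⟩
      · rw [h13]
        exact exists_congr fun i => by have := hk' i; tauto
  · exact fun s' h => h.2

end RealRAM

open Filter Topology in
/-- A small rotation separates the abscissas of lexicographically sorted points. -/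
theorem exists_shear {N : ℕ} {x y : ℕ → ℝ}
    (h : ∀ i j, 1 ≤ i → i < j → j ≤ N → x i < x j ∨ (x i = x j ∧ y i < y j)) :
    ∃ ε : ℝ, ∀ i j, 1 ≤ i → i < j → j ≤ N → x i + ε * y i < x j + ε * y j := by
  have key : ∀ᶠ ε : ℝ in 𝓝[>] 0, ∀ i ∈ Finset.Icc 1 N, ∀ j ∈ Finset.Icc 1 N, i < j →
      x i + ε * y i < x j + ε * y j := by
    rw [Filter.eventually_all_finset]
    intro i hi
    rw [Filter.eventually_all_finset]
    intro j hj
    rw [Finset.mem_Icc] at hi hj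
    by_cases hij : i < j
    · rcases h i j hi.1 hij hj.2 with hx | ⟨hx, hy⟩
      · have h1 : Tendsto (fun ε : ℝ => x i + ε * y i) (𝓝[>] 0) (𝓝 (x i + 0 * y i)) :=
          (Continuous.tendsto (by fun_prop) 0).mono_left nhdsWithin_le_nhds
        have h2 : Tendsto (fun ε : ℝ => x j + ε * y j) (𝓝[>] 0) (𝓝 (x j + 0 * y j)) :=
          (Continuous.tendsto (by fun_prop) 0).mono_left nhdsWithin_le_nhds
        filter_upwards [h1.eventually_lt h2 (by simpa using hx)] with ε hε _ using hε
      · filter_upwards [self_mem_nhdsWithin] with ε hε _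
        rw [hx]
        have := mul_lt_mul_of_pos_left hy (Set.mem_Ioi.1 hε)
        linarith
    · exact Eventually.of_forall fun _ h => absurd h hij
  obtain ⟨ε, hε⟩ := key.exists
  exact ⟨ε, fun i j hi hij hj => hε i (Finset.mem_Icc.2 ⟨hi, by omega⟩) j
    (Finset.mem_Icc.2 ⟨by omega, hj⟩) hij⟩

namespace RealRAM

theorem orient_shear (x y : ℕ → ℝ) (ε : ℝ) (i j k : ℕ) :
    orient (fun i => x i + ε * y i) y i j k = orient x y i j k := by
  unfold orient
  ring

/-- The duality between points and lines. -/
theorem exists_dual {N : ℕ} {x y : ℕ → ℝ}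
    (lex : ∀ i j, 1 ≤ i → i < j → j ≤ N → x i < x j ∨ (x i = x j ∧ y i < y j))
    (ne : ∀ i j k, 1 ≤ i → 1 ≤ j → 1 ≤ k → i ≤ N → j ≤ N → k ≤ N → i ≠ j → i ≠ k → j ≠ k →
      orient x y i j k ≠ 0) : ∃ A : Lines N, Dual A x y := by
  obtain ⟨ε, hε⟩ := exists_shear lex
  obtain ⟨p, hp⟩ : ∃ p : ℕ → ℝ, p = fun i => x i + ε * y i := ⟨_, rfl⟩
  have hlt : ∀ i j, 1 ≤ i → i < j → j ≤ N → p i < p j := by rw [hp]; exact hε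
  have ho : ∀ i j k, orient x y i j k = orient p y i j k := by
    intro i j k; rw [hp, orient_shear]
  simp only [ho] at ne
  have hmul : ∀ a j k, 1 ≤ a → 1 ≤ j → 1 ≤ k → a ≤ N → j ≤ N → k ≤ N →
      ((a < j ∧ a < k) ∨ (j < a ∧ k < a)) → 0 < (p j - p a) * (p k - p a) := by
    rintro a j k a1 j1 k1 aN jN kN (⟨h1, h2⟩ | ⟨h1, h2⟩)
    · exact mul_pos (sub_pos.2 (hlt _ _ a1 h1 jN)) (sub_pos.2 (hlt _ _ a1 h2 kN))
    · exact mul_pos_of_neg_of_neg (sub_neg.2 (hlt _ _ j1 h1 aN)) (sub_neg.2 (hlt _ _ k1 h2 aN))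
  have hsymm : ∀ i j, (y j - y i) / (p j - p i) = (y i - y j) / (p i - p j) := by
    intro i j
    rw [← neg_sub (y j), ← neg_sub (p j), neg_div_neg_eq]
  have hne : ∀ i j, 1 ≤ i → 1 ≤ j → i ≤ N → j ≤ N → i ≠ j → p j - p i ≠ 0 := by
    intro i j i1 j1 iN jN hij
    rcases lt_or_gt_of_ne hij with h | h
    · exact (sub_pos.2 (hlt _ _ i1 h jN)).ne'
    · exact (sub_neg.2 (hlt _ _ j1 h iN)).ne
  refine ⟨⟨fun i s => y i - p i * s, fun i j => (y j - y i) / (p j - p i), hsymm, ?_, ?_, ?_⟩,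
    lex, ?_, ?_, ?_⟩
  · intro i j hj hji hi s
    have h := hlt j i hj hji hi
    rw [hsymm, div_lt_iff₀ (sub_pos.2 h)]
    constructor <;> intro h <;> linarith
  · intro i j hj hji hi s
    have h := hlt j i hj hji hi
    rw [hsymm, lt_div_iff₀ (sub_pos.2 h)]
    constructor <;> intro h <;> linarith
  · intro i j k i1 j1 k1 iN jN kN hij hik hjk he
    refine ne i j k i1 j1 k1 iN jN kN hij hik hjk ?_
    rw [div_eq_div_iff (hne i j i1 j1 iN jN hij) (hne i k i1 k1 iN kN hik)] at he
    unfold orient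
    linarith
  · simpa only [ho] using ne
  · intro k q r k1 hkq hqr rN
    have h1 := sub_pos.2 (hlt k q k1 hkq (by omega))
    have h2 := sub_pos.2 (hlt k r k1 (by omega) rN)
    change _ ↔ (y k - y r) / (p k - p r) < (y q - y k) / (p q - p k)
    rw [hsymm r k, div_lt_div_iff₀ h2 h1, ho, orient]
    constructor <;> intro h <;> linarith
  · intro a j k a1 j1 k1 aN jN kN hc h
    change (y j - y a) / (p j - p a) < (y k - y a) / (p k - p a) at h
    have h1 := mul_lt_mul_of_pos_left h (hmul a j k a1 j1 k1 aN jN kN hc)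
    have hj := hne a j a1 j1 aN jN (by omega)
    have hk := hne a k a1 k1 aN kN (by omega)
    have h2 : (p j - p a) * (p k - p a) * ((y j - y a) / (p j - p a)) =
        (p k - p a) * (y j - y a) := by field_simp
    have h3 : (p j - p a) * (p k - p a) * ((y k - y a) / (p k - p a)) =
        (p j - p a) * (y k - y a) := by field_simp
    rw [ho, orient]
    linarith

/-- The lexicographic ranks, among the first occurrences, of the points of an array. -/
theorem rank_spec {X Y : ℕ → ℝ} {n : ℕ} {D : ℕ → Prop} [DecidablePred D]
    [∀ a, DecidablePred fun b => ¬ D b ∧ LexLt X Y b a]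
    (hD : ∀ a < n, D a ↔ ∃ b < a, X b = X a ∧ Y b = Y a) {ρ : ℕ → ℕ}
    (hρ : ∀ a < n, ρ a = Nat.count (fun b => ¬ D b ∧ LexLt X Y b a) n) :
    (∀ a < n, ρ a + 1 ≤ Nat.count (fun b => ¬ D b) n) ∧
    (∀ a < n, ∀ b < n, ρ a < ρ b → LexLt X Y a b) ∧
    (∀ a < n, ∀ b < n, ρ a = ρ b → X a = X b ∧ Y a = Y b) ∧
    ∀ r, 1 ≤ r → r ≤ Nat.count (fun b => ¬ D b) n → ∃ a < n, ρ a + 1 = r := by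
  have hirr : ∀ a b, X a = X b ∧ Y a = Y b → ¬ LexLt X Y a b := by
    rintro a b ⟨h1, h2⟩ (h | ⟨-, h⟩) <;> linarith
  have htrans : ∀ a b c, LexLt X Y a b → LexLt X Y b c → LexLt X Y a c := by
    rintro a b c (h | ⟨h, h'⟩) (k | ⟨k, k'⟩)
    · exact Or.inl (h.trans k)
    · exact Or.inl (k ▸ h)
    · exact Or.inl (h ▸ k)
    · exact Or.inr ⟨h.trans k, h'.trans k'⟩
  have htri : ∀ a b, LexLt X Y a b ∨ (X a = X b ∧ Y a = Y b) ∨ LexLt X Y b a := by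
    intro a b
    rcases lt_trichotomy (X a) (X b) with h | h | h
    · exact Or.inl (Or.inl h)
    · rcases lt_trichotomy (Y a) (Y b) with k | k | k
      · exact Or.inl (Or.inr ⟨h, k⟩)
      · exact Or.inr (Or.inl ⟨h, k⟩)
      · exact Or.inr (Or.inr (Or.inr ⟨h.symm, k⟩))
    · exact Or.inr (Or.inr (Or.inl h))
  have hfirst : ∀ a, a < n → ∃ b < n, ¬ D b ∧ X b = X a ∧ Y b = Y a := by
    intro a
    induction a using Nat.strong_induction_on with
    | _ a ih =>
      intro ha
      by_cases hd : D a
      · obtain ⟨b, hb, h1, h2⟩ := (hD a ha).1 hd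
        obtain ⟨c, hc, h3, h4, h5⟩ := ih b hb (hb.trans ha)
        exact ⟨c, hc, h3, h4.trans h1, h5.trans h2⟩
      · exact ⟨a, ha, hd, rfl, rfl⟩
  have hlt : ∀ a < n, ∀ b < n, LexLt X Y a b → ρ a < ρ b := by
    intro a ha b hb hab
    rw [hρ a ha, hρ b hb, Nat.count_eq_card_filter_range, Nat.count_eq_card_filter_range]
    obtain ⟨c, hc, h1, h2⟩ := hfirst a ha
    refine Finset.card_lt_card (Finset.ssubset_iff_of_subset ?_ |>.2 ⟨c, ?_, ?_⟩)
    · intro z hz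
      simp only [Finset.mem_filter] at hz ⊢
      exact ⟨hz.1, hz.2.1, htrans _ _ _ hz.2.2 hab⟩
    · simp only [Finset.mem_filter, Finset.mem_range]
      refine ⟨hc, h1, ?_⟩
      unfold LexLt
      rw [h2.1, h2.2]
      exact hab
    · simp only [Finset.mem_filter, not_and]
      exact fun _ _ => hirr _ _ h2
  have hle : ∀ a < n, ρ a + 1 ≤ Nat.count (fun b => ¬ D b) n := by
    intro a ha
    rw [hρ a ha, Nat.count_eq_card_filter_range, Nat.count_eq_card_filter_range]
    obtain ⟨c, hc, h1, h2⟩ := hfirst a ha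
    refine Finset.card_lt_card (Finset.ssubset_iff_of_subset ?_ |>.2 ⟨c, ?_, ?_⟩)
    · intro z hz
      simp only [Finset.mem_filter] at hz ⊢
      exact ⟨hz.1, hz.2.1⟩
    · simp [hc, h1]
    · simp only [Finset.mem_filter, not_and]
      exact fun _ _ => hirr _ _ h2
  have heq : ∀ a < n, ∀ b < n, ρ a = ρ b → X a = X b ∧ Y a = Y b := by
    intro a ha b hb hab
    rcases htri a b with h | h | h
    · have := hlt a ha b hb h; omega
    · exact h
    · have := hlt b hb a ha h; omega
  refine ⟨hle, fun a ha b hb hab => ?_, heq, fun r hr1 hr => ?_⟩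
  · rcases htri a b with h | h | h
    · exact h
    · have h1 : ρ a = ρ b := by
        rw [hρ a ha, hρ b hb]
        congr 1
        funext c
        simp only [LexLt, h.1, h.2]
      omega
    · have := hlt b hb a ha h; omega
  · have hsurj := Finset.surjOn_of_injOn_of_card_le (s := (Finset.range n).filter fun b => ¬ D b)
      (t := Finset.Icc 1 (Nat.count (fun b => ¬ D b) n)) (fun a => ρ a + 1) ?_ ?_ ?_
    · obtain ⟨a, ha, h⟩ := hsurj (by simpa using ⟨hr1, hr⟩ : r ∈ (Finset.Icc 1 _ : Finset ℕ))
      simp only [Finset.coe_filter, Finset.mem_range, Set.mem_ofPred_eq] at ha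
      exact ⟨a, ha.1, h⟩
    · intro a ha
      simp only [Finset.coe_filter, Finset.mem_range, Set.mem_ofPred_eq] at ha
      simpa using hle a ha.1
    · intro a ha b hb hab
      simp only [Finset.coe_filter, Finset.mem_range, Set.mem_ofPred_eq] at ha hb
      obtain ⟨h1, h2⟩ := heq a ha.1 b hb.1 (by simpa using hab)
      rcases lt_trichotomy a b with h | h | h
      · exact absurd ((hD b hb.1).2 ⟨a, h, h1, h2⟩) hb.2
      · exact h
      · exact absurd ((hD a ha.1).2 ⟨b, h, h1.symm, h2.symm⟩) ha.2
    · rw [Nat.count_eq_card_filter_range]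
      simp

end RealRAM

namespace PointInput

/-- The points of `P`, followed by those of `W`. -/
noncomputable def point (I : PointInput) (i : ℕ) : Plane :=
  if h : i < I.m then I.p ⟨i, h⟩ else if h : i - I.m < I.k then I.w ⟨i - I.m, h⟩ else 0

theorem point_left (I : PointInput) (i : Fin I.m) : I.point i = I.p i := by
  simp [point]

theorem point_right (I : PointInput) (i : Fin I.k) : I.point (I.m + i) = I.w i := by
  simp [point]

theorem exists_point_eq (I : PointInput) {i : ℕ} (hi : i < I.size) (h : I.m ≤ i) :
    ∃ j : Fin I.k, I.point i = I.w j := by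
  refine ⟨⟨i - I.m, by unfold size at hi; omega⟩, ?_⟩
  rw [← point_right, Nat.add_sub_cancel' h]

theorem point_mem (I : PointInput) {i : ℕ} (hi : i < I.size) :
    I.point i ∈ Set.range I.p ∪ Set.range I.w := by
  by_cases h : i < I.m
  · exact Or.inl ⟨⟨i, h⟩, (I.point_left ⟨i, h⟩).symm⟩
  · obtain ⟨j, hj⟩ := I.exists_point_eq hi (by omega)
    exact Or.inr ⟨j, hj.symm⟩

end PointInput

namespace RealRAM

open NExpr Prog

/-- The points with indices `1, …, N` of the state are those of the input in lexicographic order,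
and are labelled by their indices in `P` and by their membership in `W`. -/
structure Sorted (I : PointInput) (N : ℕ) (z : ℕ → Plane) (pid isW : ℕ → ℕ) : Prop where
  le : N ≤ I.size
  mem : ∀ r, 1 ≤ r → r ≤ N → z r ∈ Set.range I.p ∪ Set.range I.w
  lex : ∀ i j, 1 ≤ i → i < j → j ≤ N → z i 0 < z j 0 ∨ (z i 0 = z j 0 ∧ z i 1 < z j 1)
  exists_of_pid : ∀ r, 0 < pid r → ∃ i : Fin I.m, pid r = i + 1 ∧ z r = I.p i
  exists_pid : ∀ i, ∃ r, 1 ≤ r ∧ r ≤ N ∧ 0 < pid r ∧ z r = I.p i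
  exists_of_isW : ∀ r, 0 < isW r → ∃ i, z r = I.w i
  exists_isW : ∀ i, ∃ r, 1 ≤ r ∧ r ≤ N ∧ 0 < isW r ∧ z r = I.w i

/-- Sort the points of the input lexicographically. -/
def sortProg : Prog := .seq copyProg (.seq dupProg (.seq rankProg placeProg))

theorem sortProg_runs : ∃ C, ∀ I : PointInput, Runs sortProg I.init (C * (I.size + 1) ^ 2)
    (fun s => Sorted I (s.nat vNum 0) (fun r => !₂[s.real rX r, s.real rY r]) (s.nat nPid)
      (s.nat nIsW)) := by
  classical
  obtain ⟨C1, h1⟩ := copyProg_runs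
  obtain ⟨C2, h2⟩ := dupProg_runs
  obtain ⟨C3, h3⟩ := rankProg_runs
  obtain ⟨C4, h4⟩ := placeProg_runs
  refine ⟨C1 + C2 + C3 + C4, fun I => ?_⟩
  have hsq : I.size + 1 ≤ (I.size + 1) ^ 2 := Nat.le_self_pow two_ne_zero _
  have z0 : ∀ a, a ≠ 0 → I.init.nat a = 0 := by
    intro a ha
    funext i
    simp [PointInput.init, ha]
  refine (Runs.seq (T := C1 * (I.size + 1) ^ 2) (T' := C2 * (I.size + 1) ^ 2 +
    (C3 * (I.size + 1) ^ 2 + C4 * (I.size + 1) ^ 2)) ?_).mono (le_of_eq (by ring)) fun _ h => h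
  refine (h1 (m := I.m) (k := I.k) (by simp [PointInput.init])
    (by simp [PointInput.init])).frame.mono (Nat.mul_le_mul_left _ hsq) ?_
  rintro s1 ⟨⟨a1, a2, a3⟩, f1⟩
  have g1 : ∀ a, a = nDup ∨ a = nRank ∨ a = nPid ∨ a = nIsW ∨ a = vNum ∨ a = 0 →
      s1.nat a = I.init.nat a := by
    rintro a (rfl | rfl | rfl | rfl | rfl | rfl) <;> exact f1.1 _ (by decide)
  have hX : ∀ i < I.size, s1.real rZX i = I.point i 0 ∧ s1.real rZY i = I.point i 1 := by
    intro i hi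
    by_cases h : i < I.m
    · rw [(a2 i h).1, (a2 i h).2]
      simp [PointInput.init, PointInput.point, h]
    · obtain ⟨j, rfl⟩ : ∃ j, i = I.m + j := ⟨i - I.m, by omega⟩
      have hj : j < I.k := by unfold PointInput.size at hi; omega
      rw [(a3 j hj).1, (a3 j hj).2]
      simp [PointInput.init, PointInput.point, hj]
  refine Runs.seq ?_
  refine (h2 (n := I.size) (s := s1) a1 (by rw [g1 _ (by simp), z0 _ (by decide)])).frame.mono
    le_rfl ?_
  rintro s2 ⟨b1, f2⟩
  have g2 : ∀ a, a = nRank ∨ a = nPid ∨ a = nIsW ∨ a = vNum ∨ a = 0 →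
      s2.nat a = I.init.nat a := by
    intro a ha
    rw [← g1 a (by tauto)]
    rcases ha with rfl | rfl | rfl | rfl | rfl <;> exact f2.1 _ (by decide)
  have r2 : s2.real = s1.real := funext fun a => f2.2.1 a (by
    simp [dupProg, dupBody, realWrites])
  have v2 : s2.nat vSize 0 = I.size := by rw [f2.1 _ (by decide)]; exact a1
  refine Runs.seq ?_
  refine (h3 (n := I.size) (s := s2) v2 (by rw [g2 _ (by simp), z0 _ (by decide)])).frame.mono
    le_rfl ?_
  rintro s3 ⟨c1, f3⟩
  have g3 : ∀ a, a = nPid ∨ a = nIsW ∨ a = vNum ∨ a = 0 → s3.nat a = I.init.nat a := by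
    intro a ha
    rw [← g2 a (by tauto)]
    rcases ha with rfl | rfl | rfl | rfl <;> exact f3.1 _ (by decide)
  have r3 : s3.real = s1.real := by
    rw [← r2]
    exact funext fun a => f3.2.1 a (by simp [rankProg, rankBody, realWrites])
  have d3 : s3.nat nDup = s2.nat nDup := f3.1 _ (by decide)
  have v3 : s3.nat vSize 0 = I.size := by rw [f3.1 _ (by decide)]; exact v2
  refine (h4 (n := I.size) (m := I.m) (s := s3) v3 (by rw [g3 _ (by simp)]; simp [PointInput.init])
    (by rw [g3 _ (by simp), z0 _ (by decide)]; rfl) (by rw [g3 _ (by simp), z0 _ (by decide)])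
    (by rw [g3 _ (by simp), z0 _ (by decide)])).mono (Nat.mul_le_mul_left _ hsq) ?_
  rintro s4 ⟨e1, e2⟩
  rw [d3] at e1
  rw [r3] at e2
  rw [r2] at c1
  obtain ⟨k1, k2, k3, k4⟩ := rank_spec b1 c1
  rw [← e1] at k1 k4
  generalize hzr : (fun r => !₂[s4.real rX r, s4.real rY r]) = z
  have hz : ∀ i < I.size, ∀ r, s3.nat nRank i + 1 = r → z r = I.point i := by
    intro i hi r hr
    rw [← hzr]
    obtain ⟨j, hj, h5, h6, h7⟩ := (e2 r).1 i hi hr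
    obtain ⟨h8, h9⟩ := k3 i hi j hj (by omega)
    rw [Plane.ext_iff', ← (hX i hi).1, ← (hX i hi).2, h8, h9]
    simpa using ⟨h6, h7⟩
  refine ⟨?_, ?_, ?_, ?_, ?_, ?_, ?_⟩
  · rw [e1]
    exact Nat.count_le _
  · intro r r1 r2
    obtain ⟨i, hi, hr⟩ := k4 r r1 r2
    rw [hz i hi r hr]
    exact I.point_mem hi
  · intro i j i1 hij jN
    obtain ⟨a, ha, hai⟩ := k4 i i1 (by omega)
    obtain ⟨b, hb, hbj⟩ := k4 j (by omega) jN
    rw [hz a ha i hai, hz b hb j hbj, ← (hX a ha).1, ← (hX a ha).2, ← (hX b hb).1, ← (hX b hb).2]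
    exact k2 a ha b hb (by omega)
  · intro r hr
    obtain ⟨i, hi, him, hir, hp⟩ := (e2 r).2.2.1 hr
    exact ⟨⟨i, him⟩, hp, by rw [hz i hi r hir, ← I.point_left]⟩
  · intro i
    have hi : (i : ℕ) < I.size := by unfold PointInput.size; omega
    exact ⟨s3.nat nRank i + 1, by omega, k1 i hi, (e2 _).2.1.2 ⟨i, hi, i.2, rfl⟩, by
      rw [hz i hi _ rfl, I.point_left]⟩
  · intro r hr
    obtain ⟨i, hi, him, hir⟩ := (e2 r).2.2.2.1 hr
    obtain ⟨j, hj⟩ := I.exists_point_eq hi him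
    exact ⟨j, by rw [hz i hi r hir, hj]⟩
  · intro i
    have hi : I.m + (i : ℕ) < I.size := by unfold PointInput.size; omega
    exact ⟨s3.nat nRank (I.m + i) + 1, by omega, k1 _ hi,
      (e2 _).2.2.2.2 ⟨_, hi, by omega, rfl⟩, by rw [hz _ hi _ rfl, I.point_right]⟩

end RealRAM

theorem mem_diametralDisk_iff (a b q : Plane) : q ∈ diametralDisk a b ↔
    (q 0 - a 0) * (q 0 - a 0) + (q 1 - a 1) * (q 1 - a 1) ≤
      (b 0 - a 0) * (q 0 - a 0) + (b 1 - a 1) * (q 1 - a 1) := by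
  have h0 : ∀ i, midpoint ℝ a b i = (a i + b i) / 2 := fun i => by
    rw [midpoint_eq_smul_add]
    simp
    ring
  rw [diametralDisk, Metric.mem_closedBall, ← sq_le_sq₀ dist_nonneg (by positivity), div_pow,
    Plane.dist_sq, Plane.dist_sq, h0, h0]
  constructor <;> intro h <;> linarith

namespace RealRAM

namespace Sorted

variable {I : PointInput} {N : ℕ} {z : ℕ → Plane} {pid isW : ℕ → ℕ}

theorem eq_of_eq (h : Sorted I N z pid isW) {i j : ℕ} (hi : 1 ≤ i) (hj : 1 ≤ j) (hiN : i ≤ N)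
    (hjN : j ≤ N) (hz : z i = z j) : i = j := by
  rcases lt_trichotomy i j with hij | hij | hij
  · rcases h.lex i j hi hij hjN with h1 | ⟨-, h1⟩ <;> exact absurd h1 (by rw [hz]; exact lt_irrefl _)
  · exact hij
  · rcases h.lex j i hj hij hiN with h1 | ⟨-, h1⟩ <;> exact absurd h1 (by rw [hz]; exact lt_irrefl _)

theorem eq_of_pid_eq (h : Sorted I N z pid isW) {i j : ℕ} (hi : 1 ≤ i) (hj : 1 ≤ j) (hiN : i ≤ N)
    (hjN : j ≤ N) (h0 : 0 < pid i) (hz : pid i = pid j) : i = j := by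
  obtain ⟨a, ha, ha'⟩ := h.exists_of_pid i h0
  obtain ⟨b, hb, hb'⟩ := h.exists_of_pid j (hz ▸ h0)
  refine h.eq_of_eq hi hj hiN hjN ?_
  have : a = b := Fin.ext (by omega)
  rw [ha', hb', this]

theorem orient_ne (h : Sorted I N z pid isW) {i j k : ℕ} (hi : 1 ≤ i) (hj : 1 ≤ j) (hk : 1 ≤ k)
    (hiN : i ≤ N) (hjN : j ≤ N) (hkN : k ≤ N) (hij : i ≠ j) (hik : i ≠ k) (hjk : j ≠ k) :
    orient (fun r => z r 0) (fun r => z r 1) i j k ≠ 0 := by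
  have zij : z i ≠ z j := fun e => hij (h.eq_of_eq hi hj hiN hjN e)
  have zik : z i ≠ z k := fun e => hik (h.eq_of_eq hi hk hiN hkN e)
  have zjk : z j ≠ z k := fun e => hjk (h.eq_of_eq hj hk hjN hkN e)
  intro h0
  refine I.generalPosition.1 {z i, z j, z k} ?_ (Set.ncard_eq_three.2 ⟨_, _, _, zij, zik, zjk, rfl⟩)
    ((Plane.collinear_iff zij).2 h0)
  rintro q (rfl | rfl | rfl)
  · exact h.mem _ hi hiN
  · exact h.mem _ hj hjN
  · exact h.mem _ hk hkN

theorem adj_iff (h : Sorted I N z pid isW) {a b : ℕ} (ha : 1 ≤ a) (hb : 1 ≤ b) (haN : a ≤ N)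
    (hbN : b ≤ N) (hab : a ≠ b) {i j : Fin I.m} (hi : z a = I.p i) (hj : z b = I.p j) :
    I.graph.Adj ⟨I.p i, Set.mem_range_self _⟩ ⟨I.p j, Set.mem_range_self _⟩ ↔
      Spared N (fun r => z r 0) (fun r => z r 1) isW a b := by
  have hne : z a ≠ z b := fun e => hab (h.eq_of_eq ha hb haN hbN e)
  simp only [PointInput.graph, witnessGabrielGraph, Spared, KillsAt, Ne, Subtype.mk.injEq,
    Set.mem_sdiff, Set.mem_insert_iff, Set.mem_singleton_iff, ← hi,
    ← hj, mem_diametralDisk_iff]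
  constructor
  · rintro ⟨-, H⟩ ⟨r, r1, rN, ra, rb, hw, hk⟩
    obtain ⟨l, hl⟩ := h.exists_of_isW r hw
    refine H (z r) ⟨l, hl.symm⟩ ⟨hk, ?_⟩
    rintro (e | e)
    · exact ra (h.eq_of_eq r1 ha rN haN e)
    · exact rb (h.eq_of_eq r1 hb rN hbN e)
  · intro H
    refine ⟨hne, ?_⟩
    rintro _ ⟨l, rfl⟩ ⟨hk, hn⟩
    obtain ⟨r, r1, rN, hw, hr⟩ := h.exists_isW l
    rw [← hr] at hk hn
    refine H ⟨r, r1, rN, ?_, ?_, hw, hk⟩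
    · rintro rfl; exact hn (Or.inl rfl)
    · rintro rfl; exact hn (Or.inr rfl)

open Classical in
theorem isEdgeList (h : Sorted I N z pid isW) :
    I.IsEdgeList ((List.range' 1 N).flatMap
      (edgesFrom N pid (Spared N (fun r => z r 0) (fun r => z r 1) isW))) := by
  have hmem : ∀ a e, e ∈ edgesFrom N pid (Spared N (fun r => z r 0) (fun r => z r 1) isW) a →
      ∃ b, a < b ∧ b ≤ N ∧ 0 < pid a ∧ 0 < pid b ∧
        Spared N (fun r => z r 0) (fun r => z r 1) isW a b ∧ e = (pid a - 1, pid b - 1) := by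
    intro a e he
    simp only [edgesFrom, List.mem_map, List.mem_filter, List.mem_range'_1,
      decide_eq_true_eq] at he
    obtain ⟨b, ⟨hb, h1, h2, h3⟩, rfl⟩ := he
    exact ⟨b, by omega, by omega, h1, h2, h3, rfl⟩
  constructor
  · rw [List.map_flatMap, List.nodup_flatMap]
    constructor
    · intro a ha
      rw [List.mem_range'_1] at ha
      rw [edgesFrom, List.map_map]
      refine List.Nodup.map_on ?_ (List.Nodup.filter _ List.nodup_range')
      intro b hb c hc hbc
      simp only [List.mem_filter, List.mem_range'_1, decide_eq_true_eq] at hb hc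
      simp only [Function.comp_apply, Sym2.eq_iff] at hbc
      refine h.eq_of_pid_eq (by omega) (by omega) (by omega) (by omega) hb.2.2.1 ?_
      have := hb.2
      have := hc.2
      omega
    · refine List.Pairwise.imp_of_mem ?_ (List.pairwise_lt_range' (s := 1) (n := N))
      intro a a' ha ha' haa
      rw [List.mem_range'_1] at ha ha'
      rw [Function.onFun, List.disjoint_left]
      rintro e he he'
      obtain ⟨u, hu, rfl⟩ := List.mem_map.1 he
      obtain ⟨v, hv, huv⟩ := List.mem_map.1 he'
      obtain ⟨b, b1, b2, b3, b4, -, rfl⟩ := hmem a u hu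
      obtain ⟨b', b1', b2', b3', b4', -, rfl⟩ := hmem a' v hv
      simp only [Sym2.eq_iff] at huv
      rcases huv with ⟨e1, -⟩ | ⟨e1, e2⟩
      · have := h.eq_of_pid_eq (i := a') (j := a) (by omega) (by omega) (by omega) (by omega) b3'
          (by omega)
        omega
      · have := h.eq_of_pid_eq (i := a') (j := b) (by omega) (by omega) (by omega) (by omega) b3'
          (by omega)
        have := h.eq_of_pid_eq (i := b') (j := a) (by omega) (by omega) (by omega) (by omega) b4'
          (by omega)
        omega
  · intro i j
    simp only [List.mem_map, List.mem_flatMap, List.mem_range'_1]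
    constructor
    · rintro ⟨e, ⟨a, ha, he⟩, hij⟩
      obtain ⟨b, b1, b2, b3, b4, hs, rfl⟩ := hmem a e he
      obtain ⟨u, hu, hu'⟩ := h.exists_of_pid a b3
      obtain ⟨v, hv, hv'⟩ := h.exists_of_pid b b4
      have := (h.adj_iff (by omega) (by omega) (by omega) b2 (by omega) hu' hv').2 hs
      simp only [hu, hv, Nat.add_sub_cancel, Sym2.eq_iff] at hij
      rcases hij with ⟨rfl, rfl⟩ | ⟨rfl, rfl⟩
      · exact ⟨u.2, v.2, this⟩
      · exact ⟨v.2, u.2, this.symm⟩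
    · rintro ⟨hi, hj, hadj⟩
      obtain ⟨a, a1, aN, a0, ha⟩ := h.exists_pid ⟨i, hi⟩
      obtain ⟨b, b1, bN, b0, hb⟩ := h.exists_pid ⟨j, hj⟩
      have hab : a ≠ b := by
        rintro rfl
        exact hadj.ne (Subtype.ext (ha.symm.trans hb))
      have hpid : ∀ r (i : Fin I.m), 0 < pid r → z r = I.p i → pid r - 1 = i := by
        intro r i hr hz
        obtain ⟨u, hu, hu'⟩ := h.exists_of_pid r hr
        rw [hu, I.p_injective (hu'.symm.trans hz), Nat.add_sub_cancel]
      have hpa := hpid a _ a0 ha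
      have hpb := hpid b _ b0 hb
      have key : ∀ a b, 1 ≤ a → a < b → b ≤ N → 0 < pid a → 0 < pid b →
          Spared N (fun r => z r 0) (fun r => z r 1) isW a b →
          (pid a - 1, pid b - 1) ∈
            edgesFrom N pid (Spared N (fun r => z r 0) (fun r => z r 1) isW) a := by
        intro a b a1 hab bN a0 b0 hs
        simp only [edgesFrom, List.mem_map, List.mem_filter, List.mem_range'_1,
          decide_eq_true_eq]
        exact ⟨b, ⟨by omega, a0, b0, hs⟩, rfl⟩
      rcases lt_or_gt_of_ne hab with hlt | hlt
      · refine ⟨_, ⟨a, by omega, key a b a1 hlt bN a0 b0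
          ((h.adj_iff a1 b1 aN bN hab ha hb).1 hadj)⟩, ?_⟩
        simp only [hpa, hpb]
      · refine ⟨_, ⟨b, by omega, key b a b1 hlt aN b0 a0
          ((h.adj_iff b1 a1 bN aN hab.symm hb ha).1 hadj.symm)⟩, ?_⟩
        simp only [hpa, hpb]
        exact Sym2.eq_swap

end Sorted

open NExpr Prog

/-- Compute the witness Gabriel graph. -/
def gabrielProg : Prog := .seq sortProg (.seq rowsProg (.seq arrangeProg sweepsProg))

theorem gabrielProg_runs : ∃ C, ∀ I : PointInput,
    Runs gabrielProg I.init (C * (I.size + 1) ^ 2) (fun s => I.IsEdgeList s.out) := by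
  classical
  obtain ⟨C1, h1⟩ := sortProg_runs
  obtain ⟨C2, h2⟩ := rowsProg_runs
  obtain ⟨C3, h3⟩ := arrangeProg_runs
  obtain ⟨C4, h4⟩ := sweepsProg_runs
  refine ⟨C1 + C2 + C3 + C4, fun I => ?_⟩
  refine (Runs.seq (T := C1 * (I.size + 1) ^ 2) (T' := C2 * (I.size + 1) ^ 2 +
    (C3 * (I.size + 1) ^ 2 + C4 * (I.size + 1) ^ 2)) ?_).mono (le_of_eq (by ring)) fun _ h => h
  refine (h1 I).frame.mono le_rfl ?_
  rintro s1 ⟨a1, f1⟩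
  obtain ⟨N, hN⟩ : ∃ N, s1.nat vNum 0 = N := ⟨_, rfl⟩
  rw [hN] at a1
  have hsq : (N + 1) ^ 2 ≤ (I.size + 1) ^ 2 := Nat.pow_le_pow_left (Nat.succ_le_succ a1.le) 2
  have hsq' : N + 1 ≤ (I.size + 1) ^ 2 := (Nat.le_self_pow two_ne_zero _).trans hsq
  have z0 : ∀ a, a ≠ 0 → I.init.nat a = 0 := by
    intro a ha
    funext i
    simp [PointInput.init, ha]
  have n1 : ∀ a, a = nRow ∨ a = nNext ∨ a = nPrev → s1.nat a = 0 := by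
    rintro a (rfl | rfl | rfl) <;> exact (f1.1 _ (by decide)).trans (z0 _ (by decide))
  have o1 : s1.out = [] := f1.2.2 (by
    simp [sortProg, copyProg, dupProg, dupBody, rankProg, rankBody, placeProg, placeBody, Silent])
  obtain ⟨A, hA⟩ := exists_dual a1.lex fun i j k => a1.orient_ne
  have hx : (fun r => (!₂[s1.real rX r, s1.real rY r] : Plane) 0) = s1.real rX := rfl
  have hy : (fun r => (!₂[s1.real rX r, s1.real rY r] : Plane) 1) = s1.real rY := rfl
  rw [hx, hy] at hA
  have hE := a1.isEdgeList
  rw [hx, hy] at hE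
  refine Runs.seq ?_
  refine (h2 s1 N hN (by rw [n1 _ (by simp)]; rfl)).frame.mono (Nat.mul_le_mul_left _ hsq') ?_
  rintro s2 ⟨a2, f2⟩
  have g2 : ∀ a, a ≠ nRow → a ≠ vI → s2.nat a = s1.nat a := fun a h1 h2 =>
    f2.1 a (by simp [rowsProg, rowsBody, natWrites, h1, h2])
  have r2 : s2.real = s1.real := funext fun a => f2.2.1 a (by
    simp [rowsProg, rowsBody, realWrites])
  have o2 : s2.out = [] := (f2.2.2 (by simp [rowsProg, rowsBody, Silent])).trans o1
  refine Runs.seq ?_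
  refine (h3 N A (s1.real rX) (s1.real rY) s2 hA.test (by rw [g2 _ (by decide) (by decide), hN]) a2
    (by rw [r2]) (by rw [r2]) (by rw [g2 _ (by decide) (by decide), n1 _ (by simp)])
    (by rw [g2 _ (by decide) (by decide), n1 _ (by simp)])).frame.mono
    (Nat.mul_le_mul_left _ hsq) ?_
  rintro s3 ⟨a3, f3⟩
  have hp : s3.nat nPid = s1.nat nPid :=
    (f3.1 _ (by decide)).trans (g2 _ (by decide) (by decide))
  have hw : s3.nat nIsW = s1.nat nIsW :=
    (f3.1 _ (by decide)).trans (g2 _ (by decide) (by decide))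
  have o3 : s3.out = [] := (f3.2.2 (by
    simp [arrangeProg, insertProg, insertInit, stepProg, stepUp, stepDown, stepCross, linkProg,
      Silent])).trans o2
  refine (h4 hA a3).mono (Nat.mul_le_mul_left _ hsq) ?_
  intro s4 hs
  rw [hs, o3, List.nil_append, hp, hw]
  exact hE

end RealRAM

/-- The witness Gabriel graph of two point sets `P`, `W` with `|P| + |W| = n` can be computed in
`Θ(n ^ 2)` time on a real RAM: some program that computes it takes at most `C * n ^ 2` steps on
every input of size `n ≥ 1`, and every program that computes it takes, for each `n ≥ 2`, at least
`κ * n ^ 2` steps on some input of size `n`. -/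
theorem mainTheorem7 :
    (∃ c : RealRAM.Prog, ComputesWitnessGabriel c ∧
      ∃ C : ℝ, ∀ n : ℕ, 1 ≤ n → ∀ I : PointInput, I.size = n →
        ∀ (t : ℕ) (s : RealRAM.State), RealRAM.Exec c I.init t s → (t : ℝ) ≤ C * (n : ℝ) ^ 2) ∧
    (∃ κ : ℝ, 0 < κ ∧ ∀ c : RealRAM.Prog, ComputesWitnessGabriel c →
      ∀ n : ℕ, 2 ≤ n → ∃ I : PointInput, I.size = n ∧
        ∀ (t : ℕ) (s : RealRAM.State), RealRAM.Exec c I.init t s → κ * (n : ℝ) ^ 2 ≤ (t : ℝ)) := by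
  obtain ⟨C, hC⟩ := RealRAM.gabrielProg_runs
  refine ⟨⟨RealRAM.gabrielProg, fun I => ?_, 4 * C, fun n hn I hI t s hs => ?_⟩, 1 / 4, by norm_num,
    fun c hc n hn => LowerBound.exists_slow_input hc hn⟩
  · obtain ⟨t, s, he, -, hs⟩ := hC I
    exact ⟨t, s, he, hs⟩
  · obtain ⟨t', s', he, ht, -⟩ := hC I
    obtain ⟨rfl, -⟩ := he.deterministic hs
    have h : ((n : ℝ) + 1) ^ 2 ≤ 4 * (n : ℝ) ^ 2 := by
      have : (1 : ℝ) ≤ n := by exact_mod_cast hn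
      nlinarith
    calc (t' : ℝ) ≤ C * ((n : ℝ) + 1) ^ 2 := by rw [hI] at ht; exact_mod_cast ht
      _ ≤ C * (4 * (n : ℝ) ^ 2) := mul_le_mul_of_nonneg_left h (Nat.cast_nonneg C)
      _ = 4 * C * (n : ℝ) ^ 2 := by ring
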